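/- Setting. Let $D\ge 2$, $u\ge 3$, and let $K_1,\dots,K_u\subset\mathbb R^D$ be non-empty, pairwise disjoint, compact, strictly convex sets with $C^2$ boundary such that for all distinct $i,j,k$ the convex hull of $K_i\cup K_j$ does not meet $K_k$; let $K=\bigcup_i K_i$ and let $n_K$ be the outward unit normal of $\partial K$. A particle moves with unit speed outside $K$ and is reflected at $\partial K$ by $v^+=v^--2\langle v^-,n_K\rangle n_K$. Let $\Omega$ be the set of phase points $(q,v)$ whose trajectory has infinitely many reflections both in the past and in the future (equivalently, is bounded), let $M_0$ be the part of $\Omega$ with $q\in\partial K$ (and $v$ the outgoing velocity), and $\pi(q,v)=q$. Constants. For $i\ne j$ let $d^-_{ij},d^+_{ij}$ be the minimum and maximum distance between a point of $K_i\cap\pi M_0$ and a point of $K_j\cap \pi M_0$; let $d_{\min}=\min_{i\neq j} d^-_{ij}$, $d_{\max}=\max_{i\ne j} d^+_{ij}$. Let $\kappa_i^-,\kappa_i^+$ be the smallest and largest principal curvature of $\partial K_i$ at points of $\pi M_0$, and let $\phi^+_{ij}$ be the maximal angle between $v$ and $n_K(q)$ over all $(q,v)\in M_0$ with $q\in K_i$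 and next reflection on $K_j$. With $\iota=0$ if $D=2$ and $\iota=1$ if $D>2$, put $$\mathbb D=\bigcup_{i\neq j}\Big[\kappa_i^-\cos^\iota\phi^+_{ij},\ \frac{\kappa_i^+}{\cos\phi^+_{ij}}\Big]\times[d^-_{ij},d^+_{ij}],\qquad g(\gamma,\theta)=\gamma+\sqrt{\gamma^2+2\gamma/\theta},$$ and $g_{\min}=\min_{\mathbb D} g$, $g_{\max}=\max_{\mathbb D} g$. Fronts. Let $X\subset\mathbb R^D\setminus K$ be (a piece of) a strictly convex $C^2$ hypersurface with outer unit normal field $\nu$, that is, $\langle\nu(q),r-q\rangle<0$ for all distinct $q,r\in X$. Assume that $\nu$ is Lipschitz on $X$ with constant $L$ (so that the curvature of $X$ is at most $L$); if $X$ is compact, such an $L$ always exists. Let $\hat X_0=\{(q,\nu(q)):q\in X\}\cap\Omega$. The code of $x\in\hat X_0$ is the sequence $(\alpha_1,\alpha_2,\dots)$ such that the $j$-th reflection of the trajectory of $x$ after time $0$ is on $K_{\alpha_j}$. Proposition. There is a constant $C>0$ that depends only on the billiard, and for all $L\ge 0$ and all integers $n_0\ge 0$ there is a constant $c>0$ that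 depends only on the billiard, on $L$ and on $n_0$, with the following property. Let $a\ge 0$ and $[a,b]\supseteq[g_{\min},g_{\max}]$, and put $\lambda=\frac1{1+d_{\max}b}$, $\mu=\frac1{1+d_{\min}a}$. Then for every front $X$ as above, all $n\ge n_0$ and all $x_1,x_2\in\hat X_0$ whose codes agree in the first $n$ symbols and differ at the $(n+1)$-st, $$c\,\lambda^{n-n_0}\le\|\pi x_1-\pi x_2\|\le C\,\mu^{n-n_0}.$$ In particular, this holds for $n_0=n(a,b)$, a number such that, for the fronts considered, all solutions of $k_{j+1}=\frac{k_j}{1+\theta_jk_j}+2\gamma_j$, $(\gamma_j,\theta_j)\in\mathbb D$, that start at a curvature $k_0$ of the front satisfy $k_j\in[a,b]$ for all $j\ge n(a,b)$. -/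

import Mathlib

open Set Filter Topology
open scoped NNReal InnerProductSpace Gradient

noncomputable section

namespace OpenBilliard

/-- The configuration space `ℝ^D` with its Euclidean norm. -/
abbrev Space (D : ℕ) := EuclideanSpace ℝ (Fin D)

variable {D u : ℕ}

/-! ### Convex bodies with `C²` boundary, normals and curvature -/

/-- `A` has a `C²` boundary: near each boundary point, `A` is a sublevel set `{ρ ≤ 0}` of a
`C²` function `ρ` with non-vanishing gradient. -/
def HasC2Boundary (A : Set (Space D)) : Prop :=
  ∀ p ∈ frontier A, ∃ ρ : Space D → ℝ,
    ContDiffAt ℝ 2 ρ p ∧ ρ p = 0 ∧ ∇ ρ p ≠ 0 ∧ ∀ᶠ y in 𝓝 p, (y ∈ A ↔ ρ y ≤ 0)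

/-- `n` is an outward unit normal of the convex set `A` at `p`. -/
def IsOuterNormal (A : Set (Space D)) (p n : Space D) : Prop :=
  ‖n‖ = 1 ∧ ∀ y ∈ A, ⟪n, y - p⟫_ℝ ≤ 0

open Classical in
/-- The outward unit normal field of a convex body (unique at each boundary point when the
boundary is `C²`; the value is irrelevant elsewhere). -/
def outerNormal (A : Set (Space D)) (p : Space D) : Space D :=
  if h : ∃ n, IsOuterNormal A p n then h.choose else 0

/-- `w` is a unit vector tangent to `∂A` at `p`. -/
def IsUnitTangent (A : Set (Space D)) (p w : Space D) : Prop :=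
  ‖w‖ = 1 ∧ ⟪outerNormal A p, w⟫_ℝ = 0

/-- The curvature `⟨∇_w n, w⟩` of `∂A` at `p` in the direction of the tangent vector `w`, where
`n` is the outward unit normal field along `∂A` (the sign is such that convex bodies have
curvature `≥ 0`). On tangent vectors the derivative of `n` along `∂A` is unique. -/
def normalCurvature (A : Set (Space D)) (p w : Space D) : ℝ :=
  ⟪fderivWithin ℝ (outerNormal A) (frontier A) p w, w⟫_ℝ

/-! ### Open billiards -/

/-- Pairwise disjoint, compact, strictly convex obstacles with `C²` boundary that satisfy the
no-eclipse condition. -/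
structure IsOpenBilliard (K : Fin u → Set (Space D)) : Prop where
  nonempty : ∀ i, (K i).Nonempty
  compact : ∀ i, IsCompact (K i)
  strictConvex : ∀ i, StrictConvex ℝ (K i)
  c2Boundary : ∀ i, HasC2Boundary (K i)
  disjoint : ∀ i j, i ≠ j → Disjoint (K i) (K j)
  noEclipse : ∀ i j k, i ≠ j → j ≠ k → i ≠ k → Disjoint (convexHull ℝ (K i ∪ K j)) (K k)

/-- The unit vector pointing from `p` to `q`. -/
def unitDir (p q : Space D) : Space D := ‖q - p‖⁻¹ • (q - p)

/-- `p` is the sequence of successive reflection points of a billiard trajectory in the exterior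
of the obstacles that has infinitely many reflections in the past and in the future: the
particle flies freely along the open segment from `p j` to `p (j + 1)`, and at `p j` its velocity
changes according to `v⁺ = v⁻ - 2 ⟨v⁻, n⟩ n`. -/
structure IsOrbit (K : Fin u → Set (Space D)) (p : ℤ → Space D) : Prop where
  mem_boundary : ∀ j, ∃ i, p j ∈ frontier (K i)
  free_flight : ∀ j, Disjoint (openSegment ℝ (p j) (p (j + 1))) (⋃ i, K i)
  reflection : ∀ j i, p j ∈ K i →
    unitDir (p j) (p (j + 1)) = unitDir (p (j - 1)) (p j)
      - (2 * ⟪unitDir (p (j - 1)) (p j), outerNormal (K i) (p j)⟫_ℝ) • outerNormal (K i) (p j)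

/-- The orbit `p` passes through the phase point `x = (q, v)`, numbered so that `p 1` is the first
reflection point after `x` and `p 0` is the last one before `x` (or at `x`). -/
def PassesThrough (K : Fin u → Set (Space D)) (p : ℤ → Space D) (x : Space D × Space D) : Prop :=
  IsOrbit K p ∧ (∃ s ∈ Ico (0 : ℝ) 1, x.1 = AffineMap.lineMap (p 0) (p 1) s) ∧
    x.2 = unitDir (p 0) (p 1)

/-- The non-wandering set `Ω` of the billiard flow: the phase points whose full trajectory is
bounded, that is, whose `j`-th reflection time is finite for every `j ∈ ℤ`. -/
def nonwandering (K : Fin u → Set (Space D)) : Set (Space D × Space D) :=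
  {x | ∃ p, PassesThrough K p x}

/-- `M₀`, the restriction of `Ω` to the boundary of the obstacles. -/
def nonwanderingBoundary (K : Fin u → Set (Space D)) : Set (Space D × Space D) :=
  {x ∈ nonwandering K | ∃ i, x.1 ∈ frontier (K i)}

/-- The future code of `x`: the obstacle that contains the `(j + 1)`-st reflection point of the
trajectory of `x` is `K (α j)`, for `j = 0, 1, 2, …`. -/
def IsFutureCode (K : Fin u → Set (Space D)) (x : Space D × Space D) (α : ℕ → Fin u) : Prop :=
  ∃ p, PassesThrough K p x ∧ ∀ j : ℕ, p ((j : ℤ) + 1) ∈ K (α j)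

/-- `x ≈ₙ y`: the future codes agree in the first `n` symbols and differ at the `(n + 1)`-st. -/
def SeparateAfter (K : Fin u → Set (Space D)) (n : ℕ) (x y : Space D × Space D) : Prop :=
  ∃ α β, IsFutureCode K x α ∧ IsFutureCode K y β ∧ (∀ j < n, α j = β j) ∧ α n ≠ β n

/-! ### Billiard constants -/

/-- The reflection points `K i ∩ π M₀` on the obstacle `K i`. -/
def reflectionPoints (K : Fin u → Set (Space D)) (i : Fin u) : Set (Space D) :=
  K i ∩ Prod.fst '' nonwanderingBoundary K

/-- The curvatures of `∂K i` at points of `M₀`, in all tangent directions. -/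
def curvatures (K : Fin u → Set (Space D)) (i : Fin u) : Set ℝ :=
  {k | ∃ q ∈ reflectionPoints K i, ∃ w, IsUnitTangent (K i) q w ∧ k = normalCurvature (K i) q w}

/-- `κᵢ⁻`, the minimal curvature (smallest principal curvature) of `∂K i` on `M₀`. -/
def kappaMin (K : Fin u → Set (Space D)) (i : Fin u) : ℝ := sInf (curvatures K i)

/-- `κᵢ⁺`, the maximal curvature (largest principal curvature) of `∂K i` on `M₀`. -/
def kappaMax (K : Fin u → Set (Space D)) (i : Fin u) : ℝ := sSup (curvatures K i)

/-- The distances between points of `M₀` on `K i` and points of `M₀` on `K j`. -/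
def distances (K : Fin u → Set (Space D)) (i j : Fin u) : Set ℝ :=
  {d | ∃ q ∈ reflectionPoints K i, ∃ r ∈ reflectionPoints K j, d = dist q r}

/-- `d⁻ᵢⱼ`. -/
def distMin (K : Fin u → Set (Space D)) (i j : Fin u) : ℝ := sInf (distances K i j)

/-- `d⁺ᵢⱼ`. -/
def distMax (K : Fin u → Set (Space D)) (i j : Fin u) : ℝ := sSup (distances K i j)

/-- `d_min = min_{i ≠ j} d⁻ᵢⱼ`. -/
def dMin (K : Fin u → Set (Space D)) : ℝ := sInf {d | ∃ i j, i ≠ j ∧ d = distMin K i j}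

/-- `d_max = max_{i ≠ j} d⁺ᵢⱼ`. -/
def dMax (K : Fin u → Set (Space D)) : ℝ := sSup {d | ∃ i j, i ≠ j ∧ d = distMax K i j}

/-- `φ⁺ᵢⱼ`, the maximal collision angle (between the reflected velocity and the outward normal)
at a point of `M₀` on `K i` whose next reflection is on `K j`. -/
def angleMax (K : Fin u → Set (Space D)) (i j : Fin u) : ℝ :=
  sSup {φ | ∃ p, IsOrbit K p ∧ p 0 ∈ K i ∧ p 1 ∈ K j ∧
    φ = InnerProductGeometry.angle (unitDir (p 0) (p 1)) (outerNormal (K i) (p 0))}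

/-- The exponent `ι`: it is `0` in the plane and `1` in higher dimension. -/
def iotaExp (D : ℕ) : ℕ := if D = 2 then 0 else 1

/-- The domain `𝔻 = ⋃_{i ≠ j} [κᵢ⁻ cos^ι φ⁺ᵢⱼ, κᵢ⁺ / cos φ⁺ᵢⱼ] × [d⁻ᵢⱼ, d⁺ᵢⱼ]`. -/
def domainD (K : Fin u → Set (Space D)) : Set (ℝ × ℝ) :=
  ⋃ (i : Fin u) (j : Fin u) (_ : i ≠ j),
    Icc (kappaMin K i * Real.cos (angleMax K i j) ^ iotaExp D)
        (kappaMax K i / Real.cos (angleMax K i j)) ×ˢ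
      Icc (distMin K i j) (distMax K i j)

/-- `g(γ, θ) = γ + √(γ² + 2γ/θ)`, the non-negative fixed point of `x ↦ x / (1 + θ x) + 2 γ`. -/
def gFun (γ θ : ℝ) : ℝ := γ + Real.sqrt (γ ^ 2 + 2 * γ / θ)

/-- `g_min`, the minimum of `g` over `𝔻`. -/
def gMin (K : Fin u → Set (Space D)) : ℝ := sInf ((fun z : ℝ × ℝ => gFun z.1 z.2) '' domainD K)

/-- `g_max`, the maximum of `g` over `𝔻`. -/
def gMax (K : Fin u → Set (Space D)) : ℝ := sSup ((fun z : ℝ × ℝ => gFun z.1 z.2) '' domainD K)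

/-- `λ = 1 / (1 + d_max b)`. -/
def lam (K : Fin u → Set (Space D)) (b : ℝ) : ℝ := 1 / (1 + dMax K * b)

/-- `μ = 1 / (1 + d_min a)`. -/
def mu (K : Fin u → Set (Space D)) (a : ℝ) : ℝ := 1 / (1 + dMin K * a)

/-! ### Convex fronts -/

/-- `X` is (a piece of) a strictly convex `C²` hypersurface in the interior of the billiard
domain, and `ν` is its outer unit normal field. Strict convexity: the surface lies strictly on
the inner side of each of its tangent hyperplanes, apart from the point of contact. -/
structure IsConvexFront (K : Fin u → Set (Space D)) (X : Set (Space D))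
    (ν : Space D → Space D) : Prop where
  exterior : Disjoint X (⋃ i, K i)
  c2Surface : ∀ q ∈ X, ∃ ρ : Space D → ℝ, ContDiffAt ℝ 2 ρ q ∧ ∇ ρ q ≠ 0 ∧
    ∀ᶠ y in 𝓝[X] q, ρ y = 0 ∧ ν y = ‖∇ ρ y‖⁻¹ • ∇ ρ y
  strictlyConvex : ∀ q ∈ X, ∀ r ∈ X, r ≠ q → ⟪ν q, r - q⟫_ℝ < 0

/-- `X̂₀ = X̂ ∩ Ω`, where `X̂ = {(q, ν q) : q ∈ X}`. -/
def trappedFront (K : Fin u → Set (Space D)) (X : Set (Space D)) (ν : Space D → Space D) :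
    Set (Space D × Space D) :=
  {x | x.1 ∈ X ∧ x.2 = ν x.1} ∩ nonwandering K

end OpenBilliard

end

/-!
Two trapped trajectories that start on the front are compared through the pair of orbits `p`, `q`
that contain them. Let `Δ = p j - q j`, let `v`, `w` be the velocities after the `j`-th reflections,
`η = v - w`, and let `ξ` be the component of `Δ` orthogonal to `v + w`. The divergence
`⟪Δ, η⟫ = ⟪ξ, η⟫` never decreases while the orbits visit the same obstacles
(`IsOrbit.divergence_mono`), and it is nonnegative from the start because the front is convex. In
terms of `ξ`, a free flight is *exactly* `ξ ↦ ξ + θ η` with `θ` the mean length of the two flights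
(`transv_flight`), so the curvature recursion `k ↦ k / (1 + θ k)` holds for pairs of rays at a
finite distance, without passing to tangent vectors:

* If `k ‖ξ‖² ≤ ⟪ξ, η⟫`, then the flight expands `ξ` at least by `1 + θ k`, and the inequality holds
  afterwards with `k / (1 + θ k)` (`flight_lower`). A reflection adds almost `2 γ` to `k`, where `γ`
  bounds the curvature times the power `ι` of the cosine from below
  (`IsOrbit.exists_reflection_lower`; this is the quadratic convexity of the obstacles).
* If `‖η‖² ≤ k ⟪ξ, η⟫`, the reverse inequalities hold (`flight_upper`), and a reflection adds at
  most a little more than `2 γ`, where `γ` bounds the curvature divided by the cosine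
  (`IsOrbit.exists_reflection_upper`; this uses that an obstacle of curvature at most `κ` contains
  balls of radius almost `1 / κ`, so that `‖n p - n q‖² ≤ κ ⟪p - q, n p - n q⟫` nearly holds).

Instead of following the recursion for `k`, one uses `‖ξ‖ (k + β)` with a suitable constant `β`:
this quantity grows in each step at least (at most) by the factor `Λ = 1 + d G`, provided that
`2 γ + β` is greater (less) than `Λ β` and `d (2 γ + β)` is greater (less) than `Λ - 1`. For
`d = dMin`, `G = gMin` (`d = dMax`, `G = gMax`) such a `β` exists because `G` is a fixed point of the
recursion. There is room for the errors of the quadratic approximations because the distance of two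
obstacles is not constant on the reflection points: `distMin < distMax`, by a comparison of orbits of
periods two and three (`IsOpenBilliard.distMin_lt_distMax`).

The approximations need nearby orbits. Orbits with the same obstacles for a long time are close
except at the end, since uniform strict convexity makes the divergence of orbits that are not close
grow by a definite amount per reflection (`IsOrbit.exists_close_of_shareObstacles`). This gives the
upper bound for the distance on the front. For the lower bound, the growth is followed up to the
first time at which the orbits are not close. If there is none, the orbits separate while they are
close, which the no-eclipse condition makes impossible (`IsOrbit.exists_le_norm_sub_of_ne`).

The lower bound needs `gMax > 0`. If all curvatures at reflection points vanished, orbits would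
separate more slowly than any exponential. But there are `2 ^ T` periodic orbits with time-symmetric
codes of length of order `T`, any two of which separate, forwards or backwards, after at most `2 T`
reflections; for large `T` this contradicts a volume bound in the space of the triples
`(p 0, v, v⁻)` (`IsOpenBilliard.exists_kappaMax_pos`). Periodic orbits with prescribed codes are
closed polygons of minimal length (`IsOpenBilliard.exists_periodic_orbit`).

The bounds hold with exponent `n` and the rates of `gMin` and `gMax`; the rates of `a ≤ gMin` and
`b ≥ gMax` are weaker.
-/

namespace OpenBilliard

/-! ### Defining functions, normals and curvature of a convex body -/

/-- `ρ` is a local defining function of `A` at the boundary point `p`. -/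
structure IsDefiningFunction {D : ℕ} (A : Set (Space D)) (ρ : Space D → ℝ) (p : Space D) :
    Prop where
  contDiffAt : ContDiffAt ℝ 2 ρ p
  eq_zero : ρ p = 0
  gradient_ne : ∇ ρ p ≠ 0
  mem_iff : ∀ᶠ y in 𝓝 p, (y ∈ A ↔ ρ y ≤ 0)

lemma contDiffAt_gradient {D : ℕ} {ρ : Space D → ℝ} {p : Space D} (h : ContDiffAt ℝ 2 ρ p) :
    ContDiffAt ℝ 1 (∇ ρ) p := by
  have h1 : ContDiffAt ℝ 1 (fderiv ℝ ρ) p := h.fderiv_right (by norm_num)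
  have h2 : ContDiff ℝ 1 (InnerProductSpace.toDual ℝ (Space D)).symm :=
    (InnerProductSpace.toDual ℝ (Space D)).symm.contDiff
  exact h2.contDiffAt.comp p h1

lemma inner_gradient {D : ℕ} (ρ : Space D → ℝ) (p v : Space D) :
    ⟪∇ ρ p, v⟫_ℝ = fderiv ℝ ρ p v := by
  rw [← toDual_gradient]; simp

namespace IsDefiningFunction

variable {D : ℕ} {A : Set (Space D)} {ρ : Space D → ℝ} {p : Space D}

lemma continuousAt_gradient (h : IsDefiningFunction A ρ p) : ContinuousAt (∇ ρ) p :=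
  (contDiffAt_gradient h.contDiffAt).continuousAt

lemma gradient_norm_pos (h : IsDefiningFunction A ρ p) : 0 < ‖∇ ρ p‖ :=
  norm_pos_iff.2 h.gradient_ne

/-- A defining function at `p` is a defining function at all nearby boundary points. -/
lemma eventually (h : IsDefiningFunction A ρ p) (hA : IsClosed A) :
    ∀ᶠ q in 𝓝 p, q ∈ frontier A → IsDefiningFunction A ρ q := by
  filter_upwards [h.contDiffAt.eventually (by norm_num),
    h.continuousAt_gradient.eventually_ne h.gradient_ne, h.mem_iff.eventually_nhds]
    with q h1 h2 h3 hq
  refine ⟨h1, ?_, h2, h3⟩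
  have hqA : q ∈ A := hA.frontier_subset hq
  refine le_antisymm ((h3.self_of_nhds).1 hqA) ?_
  by_contra! hlt
  have : A ∈ 𝓝 q := by
    filter_upwards [h1.continuousAt.eventually_lt continuousAt_const hlt, h3] with y hy hy2
    exact hy2.2 hy.le
  exact hq.2 (mem_interior_iff_mem_nhds.2 this)

/-- The derivative of `ρ` along a ray from `p`. -/
lemma hasDerivAt_ray (h : IsDefiningFunction A ρ p) (v : Space D) :
    HasDerivAt (fun t : ℝ => ρ (p + t • v)) ⟪∇ ρ p, v⟫_ℝ 0 := by
  have h1 : HasFDerivAt ρ (fderiv ℝ ρ p) (p + (0 : ℝ) • v) := by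
    simpa using (h.contDiffAt.differentiableAt (by norm_num)).hasFDerivAt
  have h2 : HasDerivAt (fun t : ℝ => p + t • v) v 0 := by
    simpa using ((hasDerivAt_id (0 : ℝ)).smul_const v).const_add p
  rw [inner_gradient]
  exact h1.comp_hasDerivAt (0 : ℝ) h2

lemma tendsto_ray (p v : Space D) : Tendsto (fun t : ℝ => p + t • v) (𝓝[>] 0) (𝓝 p) := by
  have : Continuous fun t : ℝ => p + t • v := by fun_prop
  exact (this.tendsto' 0 p (by simp)).mono_left nhdsWithin_le_nhds

lemma eventually_mem (h : IsDefiningFunction A ρ p) {v : Space D} (hv : ⟪∇ ρ p, v⟫_ℝ < 0) :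
    ∀ᶠ t in 𝓝[>] (0 : ℝ), p + t • v ∈ A := by
  have h1 := (hasDerivAt_iff_tendsto_slope.1 (h.hasDerivAt_ray v)).mono_left
    (nhdsGT_le_nhdsNE 0)
  filter_upwards [h1.eventually_lt_const hv, (tendsto_ray p v).eventually h.mem_iff,
    self_mem_nhdsWithin] with t ht1 ht2 ht3
  rw [ht2]
  have ht3' : (0 : ℝ) < t := ht3
  rw [slope_def_field] at ht1
  simp only [zero_smul, add_zero, h.eq_zero, sub_zero] at ht1
  by_contra! hcon
  exact absurd ht1 (not_lt.2 (by positivity))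

lemma eventually_notMem (h : IsDefiningFunction A ρ p) {v : Space D} (hv : 0 < ⟪∇ ρ p, v⟫_ℝ) :
    ∀ᶠ t in 𝓝[>] (0 : ℝ), p + t • v ∉ A := by
  have h1 := (hasDerivAt_iff_tendsto_slope.1 (h.hasDerivAt_ray v)).mono_left
    (nhdsGT_le_nhdsNE 0)
  filter_upwards [h1.eventually_const_lt hv, (tendsto_ray p v).eventually h.mem_iff,
    self_mem_nhdsWithin] with t ht1 ht2 ht3
  rw [ht2]
  have ht3' : (0 : ℝ) < t := ht3
  rw [slope_def_field] at ht1
  simp only [zero_smul, add_zero, h.eq_zero, sub_zero] at ht1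
  intro hcon
  exact absurd ht1 (not_lt.2 (div_nonpos_of_nonpos_of_nonneg hcon ht3'.le))

lemma isOuterNormal (h : IsDefiningFunction A ρ p) (hA : Convex ℝ A) (hp : p ∈ A) :
    IsOuterNormal A p (‖∇ ρ p‖⁻¹ • ∇ ρ p) := by
  have hpos := h.gradient_norm_pos
  refine ⟨by rw [norm_smul, norm_inv, norm_norm, inv_mul_cancel₀ hpos.ne'], fun y hy => ?_⟩
  rw [real_inner_smul_left]
  refine mul_nonpos_of_nonneg_of_nonpos (by positivity) ?_
  by_contra! hcon
  have h1 := h.eventually_notMem hcon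
  have h2 : ∀ᶠ t in 𝓝[>] (0 : ℝ), t ≤ 1 :=
    nhdsWithin_le_nhds (eventually_le_nhds (by norm_num))
  obtain ⟨t, ht1, ht2, ht3⟩ := (h1.and (h2.and self_mem_nhdsWithin)).exists
  exact ht1 (hA.add_smul_sub_mem hp hy ⟨le_of_lt ht3, ht2⟩)

lemma outerNormal_unique (h : IsDefiningFunction A ρ p) {n : Space D}
    (hn : IsOuterNormal A p n) : n = ‖∇ ρ p‖⁻¹ • ∇ ρ p := by
  have hpos := h.gradient_norm_pos
  set m := ‖∇ ρ p‖⁻¹ • ∇ ρ p with hm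
  have hm1 : ‖m‖ = 1 := by rw [hm, norm_smul, norm_inv, norm_norm, inv_mul_cancel₀ hpos.ne']
  by_contra hne
  have hlt : ⟪m, n⟫_ℝ < 1 := by
    refine lt_of_le_of_ne ?_ fun h1 => hne ?_
    · simpa [hm1, hn.1] using real_inner_le_norm m n
    · exact ((inner_eq_one_iff_of_norm_eq_one hm1 hn.1).1 h1).symm
  have hd : ⟪∇ ρ p, n - m⟫_ℝ < 0 := by
    have : ∇ ρ p = ‖∇ ρ p‖ • m := by rw [hm, smul_smul, mul_inv_cancel₀ hpos.ne', one_smul]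
    rw [this, real_inner_smul_left, inner_sub_right, real_inner_self_eq_norm_sq, hm1]
    nlinarith
  obtain ⟨t, ht, ht0⟩ := ((h.eventually_mem hd).and self_mem_nhdsWithin).exists
  have h3 := hn.2 _ ht
  rw [add_sub_cancel_left, real_inner_smul_right, inner_sub_right, real_inner_self_eq_norm_sq,
    hn.1, real_inner_comm] at h3
  have ht0' : (0 : ℝ) < t := ht0
  nlinarith

lemma outerNormal_eq (h : IsDefiningFunction A ρ p) (hA : Convex ℝ A) (hp : p ∈ A) :
    outerNormal A p = ‖∇ ρ p‖⁻¹ • ∇ ρ p := by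
  have hex : ∃ n, IsOuterNormal A p n := ⟨_, h.isOuterNormal hA hp⟩
  rw [outerNormal, dif_pos hex]
  exact h.outerNormal_unique hex.choose_spec

lemma outerNormal_eventuallyEq (h : IsDefiningFunction A ρ p) (hA : Convex ℝ A)
    (hc : IsClosed A) :
    outerNormal A =ᶠ[𝓝[frontier A] p] fun q => ‖∇ ρ q‖⁻¹ • ∇ ρ q := by
  filter_upwards [nhdsWithin_le_nhds (h.eventually hc), self_mem_nhdsWithin] with q h1 h2
  exact (h1 h2).outerNormal_eq hA (hc.frontier_subset h2)

/-- Every vector orthogonal to the gradient is tangent to the boundary: moving from `p` by `t w`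
and then by `± ε t ∇ρ` ends outside and inside `A`, so a boundary point lies in between. -/
lemma mem_tangentConeAt (h : IsDefiningFunction A ρ p) {w : Space D} (hc : IsClosed A)
    (hw : ⟪∇ ρ p, w⟫_ℝ = 0) : w ∈ tangentConeAt ℝ (frontier A) p := by
  have key : ∀ k : ℕ, ∃ t : ℝ, 0 < t ∧ t < 1 / ((k : ℝ) + 1) ∧ ∃ s : ℝ,
      |s| ≤ 1 / ((k : ℝ) + 1) ∧ p + t • (w + s • ∇ ρ p) ∈ frontier A := by
    intro k
    set e : ℝ := 1 / ((k : ℝ) + 1) with he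
    have he0 : 0 < e := by positivity
    have hg := h.gradient_norm_pos
    have h1 : 0 < ⟪∇ ρ p, w + e • ∇ ρ p⟫_ℝ := by
      rw [inner_add_right, hw, real_inner_smul_right, real_inner_self_eq_norm_sq]; positivity
    have h2 : ⟪∇ ρ p, w + (-e) • ∇ ρ p⟫_ℝ < 0 := by
      rw [inner_add_right, hw, real_inner_smul_right, real_inner_self_eq_norm_sq]
      have : 0 < e * ‖∇ ρ p‖ ^ 2 := by positivity
      linarith
    have h3 : ∀ᶠ t in 𝓝[>] (0 : ℝ), t < e := nhdsWithin_le_nhds (eventually_lt_nhds he0)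
    obtain ⟨t, ht1, ht2, ht3, ht4⟩ := ((h.eventually_notMem h1).and
      ((h.eventually_mem h2).and (h3.and self_mem_nhdsWithin))).exists
    refine ⟨t, ht4, ht3, ?_⟩
    by_contra! hcon
    have hpre : IsPreconnected ((fun s : ℝ => p + t • (w + s • ∇ ρ p)) '' Icc (-e) e) :=
      isPreconnected_Icc.image _ (by fun_prop)
    have hsub := hpre.subset_left_of_subset_union (u := interior A) (v := Aᶜ) isOpen_interior
      hc.isOpen_compl (disjoint_compl_right.mono_left interior_subset) ?_ ?_
    · exact ht1 (interior_subset (hsub ⟨e, by simp [he0.le], rfl⟩))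
    · rintro _ ⟨s, hs, rfl⟩
      by_cases hmem : p + t • (w + s • ∇ ρ p) ∈ A
      · left
        by_contra hni
        exact hcon s (abs_le.2 hs) (hc.frontier_eq ▸ ⟨hmem, hni⟩)
      · exact Or.inr hmem
    · refine ⟨_, ⟨-e, by simp [he0.le], rfl⟩, ?_⟩
      by_contra hni
      exact hcon (-e) (by rw [abs_neg, abs_of_pos he0]) (hc.frontier_eq ▸ ⟨ht2, hni⟩)
  choose t ht0 ht1 s hs hf using key
  have hlim : Tendsto (fun k : ℕ => 1 / ((k : ℝ) + 1)) atTop (𝓝 0) :=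
    tendsto_one_div_add_atTop_nhds_zero_nat
  have hs0 : Tendsto s atTop (𝓝 0) := squeeze_zero_norm hs hlim
  have ht : Tendsto t atTop (𝓝 0) := squeeze_zero (fun k => (ht0 k).le) (fun k => (ht1 k).le) hlim
  have hw' : Tendsto (fun k => w + s k • ∇ ρ p) atTop (𝓝 w) := by
    simpa using (hs0.smul_const (∇ ρ p)).const_add w
  refine mem_tangentConeAt_of_seq atTop (fun k => (t k)⁻¹) (fun k => t k • (w + s k • ∇ ρ p))
    ?_ (Eventually.of_forall hf) ?_
  · simpa using ht.smul hw'
  · refine hw'.congr fun k => ?_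
    rw [smul_smul, inv_mul_cancel₀ (ht0 k).ne', one_smul]

/-- The shape operator of the boundary is the Hessian of a defining function, divided by the norm
of its gradient. -/
lemma normalCurvature_eq (h : IsDefiningFunction A ρ p) (hA : Convex ℝ A) (hc : IsClosed A)
    (hp : p ∈ A) {w : Space D} (hw : ⟪outerNormal A p, w⟫_ℝ = 0) :
    normalCurvature A p w = ‖∇ ρ p‖⁻¹ * ⟪fderiv ℝ (∇ ρ) p w, w⟫_ℝ ∧
      ∃ L : Space D →L[ℝ] Space D, HasFDerivWithinAt (outerNormal A) L (frontier A) p ∧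
        normalCurvature A p w = ⟪L w, w⟫_ℝ := by
  have hg := h.gradient_norm_pos
  have hw' : ⟪∇ ρ p, w⟫_ℝ = 0 := by
    rw [h.outerNormal_eq hA hp, real_inner_smul_left] at hw
    exact (mul_eq_zero.1 hw).resolve_left (inv_ne_zero hg.ne')
  have hG := ((contDiffAt_gradient h.contDiffAt).differentiableAt (by norm_num))
  have hc' : DifferentiableAt ℝ (fun q => ‖∇ ρ q‖⁻¹) p := (hG.norm ℝ h.gradient_ne).inv hg.ne'
  have hN := hc'.hasFDerivAt.smul hG.hasFDerivAt
  have hO := hN.hasFDerivWithinAt (s := frontier A) |>.congr_of_eventuallyEq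
    (h.outerNormal_eventuallyEq hA hc) (h.outerNormal_eq hA hp)
  have heq := hO.differentiableWithinAt.hasFDerivWithinAt.unique_on hO (h.mem_tangentConeAt hc hw')
  have hval : normalCurvature A p w = ‖∇ ρ p‖⁻¹ * ⟪fderiv ℝ (∇ ρ) p w, w⟫_ℝ := by
    rw [normalCurvature, heq]
    simp [inner_add_left, real_inner_smul_left, hw']
  exact ⟨hval, _, hO, by rw [normalCurvature, heq]⟩

end IsDefiningFunction

end OpenBilliard

namespace OpenBilliard

namespace IsDefiningFunction

variable {D : ℕ} {A : Set (Space D)} {ρ : Space D → ℝ} {p : Space D}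

/-- Second order Taylor expansion of a defining function, uniform in the base point. -/
lemma taylor (h : IsDefiningFunction A ρ p) {ε : ℝ} (hε : 0 < ε) :
    ∃ δ > 0, ∀ x ∈ Metric.ball p δ, ∀ y ∈ Metric.ball p δ,
      |ρ y - ρ x - ⟪∇ ρ x, y - x⟫_ℝ - 1 / 2 * ⟪fderiv ℝ (∇ ρ) x (y - x), y - x⟫_ℝ|
        ≤ ε * ‖y - x‖ ^ 2 := by
  have hG := contDiffAt_gradient h.contDiffAt
  have hS := (hG.hasStrictFDerivAt (by norm_num)).isLittleO
  have h1 := hS.bound (c := ε / 2) (by positivity)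
  rw [nhds_prod_eq] at h1
  obtain ⟨δ₁, hδ₁, hb₁⟩ := (Metric.nhds_basis_ball.prod_self.eventually_iff).1 h1
  have hcont : ContinuousAt (fderiv ℝ (∇ ρ)) p :=
    (hG.fderiv_right (m := 0) (by norm_num)).continuousAt
  obtain ⟨δ₂, hδ₂, hb₂⟩ := Metric.continuousAt_iff.1 hcont (ε / 2) (by positivity)
  have hdiff : ∀ᶠ y in 𝓝 p, DifferentiableAt ℝ ρ y := by
    filter_upwards [h.contDiffAt.eventually (by norm_num)] with y hy
    exact hy.differentiableAt (by norm_num)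
  obtain ⟨δ₃, hδ₃, hb₃⟩ := Metric.eventually_nhds_iff_ball.1 hdiff
  refine ⟨min δ₁ (min δ₂ δ₃), by positivity, fun x hx y hy => ?_⟩
  set v := y - x with hv
  have hx1 : x ∈ Metric.ball p δ₁ := Metric.ball_subset_ball (min_le_left _ _) hx
  have hx2 : x ∈ Metric.ball p δ₂ :=
    Metric.ball_subset_ball ((min_le_right _ _).trans (min_le_left _ _)) hx
  have hseg : ∀ t ∈ Icc (0 : ℝ) 1, x + t • v ∈ Metric.ball p (min δ₁ (min δ₂ δ₃)) :=
    fun t ht => (convex_ball _ _).add_smul_sub_mem hx hy ht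
  set B := fderiv ℝ (∇ ρ) p with hB
  have hmv := norm_image_sub_le_of_norm_deriv_le_segment_01'
    (f := fun t : ℝ => ρ (x + t • v) - t * ⟪∇ ρ x, v⟫_ℝ - t ^ 2 / 2 * ⟪B v, v⟫_ℝ)
    (f' := fun t => ⟪∇ ρ (x + t • v), v⟫_ℝ - ⟪∇ ρ x, v⟫_ℝ - t * ⟪B v, v⟫_ℝ)
    (C := ε / 2 * ‖v‖ ^ 2) ?_ ?_
  · have hBx : |⟪fderiv ℝ (∇ ρ) x v, v⟫_ℝ - ⟪B v, v⟫_ℝ| ≤ ε / 2 * ‖v‖ ^ 2 := by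
      rw [← inner_sub_left, ← sub_apply]
      have := hb₂ (Metric.mem_ball.1 hx2)
      rw [dist_eq_norm] at this
      calc _ ≤ ‖(fderiv ℝ (∇ ρ) x - B) v‖ * ‖v‖ := abs_real_inner_le_norm _ _
        _ ≤ (ε / 2 * ‖v‖) * ‖v‖ := by
          gcongr
          exact (ContinuousLinearMap.le_opNorm _ _).trans (by gcongr)
        _ = _ := by ring
    have hxy : x + v = y := by rw [hv]; abel
    simp only [one_smul, zero_smul, add_zero, hxy] at hmv
    rw [Real.norm_eq_abs] at hmv
    rw [abs_le] at hmv hBx ⊢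
    constructor <;> nlinarith [hmv.1, hmv.2, hBx.1, hBx.2]
  · intro t ht
    refine HasDerivAt.hasDerivWithinAt ?_
    have hd : HasFDerivAt ρ (fderiv ℝ ρ (x + t • v)) (x + t • v) :=
      (hb₃ _ (Metric.ball_subset_ball ((min_le_right _ _).trans (min_le_right _ _))
        (hseg t ht))).hasFDerivAt
    have h2 : HasDerivAt (fun t : ℝ => x + t • v) v t := by
      simpa using ((hasDerivAt_id t).smul_const v).const_add x
    have h3 := hd.comp_hasDerivAt t h2
    rw [inner_gradient ρ (x + t • v)]
    have h4 := ((hasDerivAt_id t).mul_const ⟪∇ ρ x, v⟫_ℝ)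
    have h5 := (((hasDerivAt_id t).pow 2).div_const 2).mul_const ⟪B v, v⟫_ℝ
    exact ((h3.sub h4).sub h5).congr_deriv (by simp)
  · intro t ht
    have htI : t ∈ Icc (0 : ℝ) 1 := ⟨ht.1, ht.2.le⟩
    have ht1 : x + t • v ∈ Metric.ball p δ₁ :=
      Metric.ball_subset_ball (min_le_left _ _) (hseg t htI)
    have h6 := hb₁ (show ((x + t • v, x) : Space D × Space D) ∈ _ from Set.mk_mem_prod ht1 hx1)
    simp only [add_sub_cancel_left] at h6
    have h7 : ⟪∇ ρ (x + t • v), v⟫_ℝ - ⟪∇ ρ x, v⟫_ℝ - t * ⟪B v, v⟫_ℝ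
        = ⟪∇ ρ (x + t • v) - ∇ ρ x - B (t • v), v⟫_ℝ := by
      rw [map_smul, inner_sub_left, inner_sub_left, real_inner_smul_left]
    rw [h7]
    have h8 : ‖t • v‖ ≤ ‖v‖ := by
      rw [norm_smul, Real.norm_eq_abs, abs_of_nonneg ht.1]
      exact mul_le_of_le_one_left (norm_nonneg _) ht.2.le
    have h9 : ε / 2 * ‖t • v‖ ≤ ε / 2 * ‖v‖ := mul_le_mul_of_nonneg_left h8 (by positivity)
    refine (norm_inner_le_norm _ _).trans ?_
    refine (mul_le_mul_of_nonneg_right (h6.trans h9) (norm_nonneg _)).trans_eq ?_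
    ring

end IsDefiningFunction

end OpenBilliard

namespace OpenBilliard

/-! ### Strictly convex bodies -/

/-- A compact strictly convex set with `C²` boundary. -/
structure IsSmoothBody {D : ℕ} (A : Set (Space D)) : Prop where
  compact : IsCompact A
  strictConvex : StrictConvex ℝ A
  c2Boundary : HasC2Boundary A

/-- A relation between nearby points that holds locally on a compact set holds uniformly. -/
lemma exists_uniform_radius {X : Type*} [PseudoMetricSpace X] {S : Set X} (hS : IsCompact S)
    (R : X → X → Prop)
    (h : ∀ p₀ ∈ S, ∃ δ > 0, ∀ p ∈ S, ∀ q, dist p p₀ < δ → dist q p₀ < δ → R p q) :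
    ∃ δ > 0, ∀ p ∈ S, ∀ q, dist q p < δ → R p q := by
  choose! r hr hR using h
  obtain ⟨δ, hδ, hb⟩ := lebesgue_number_lemma_of_metric (c := fun p : S => Metric.ball p.1 (r p.1))
    hS (fun p => Metric.isOpen_ball)
    (fun p hp => mem_iUnion.2 ⟨⟨p, hp⟩, Metric.mem_ball_self (hr p hp)⟩)
  refine ⟨δ, hδ, fun p hp q hq => ?_⟩
  obtain ⟨⟨p₀, hp₀⟩, hsub⟩ := hb p hp
  exact hR p₀ hp₀ p hp q (hsub (Metric.mem_ball_self hδ)) (hsub hq)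

/-- A lower bound for a quadratic form on a hyperplane almost bounds it on vectors that are almost
in the hyperplane. -/
lemma quadratic_lower_bound {E : Type*} [NormedAddCommGroup E] [InnerProductSpace ℝ E]
    (B : E →L[ℝ] E) {n : E} (hn : ‖n‖ = 1) {M κ : ℝ} (hM : ‖B‖ ≤ M)
    (hκ : ∀ w, ⟪n, w⟫_ℝ = 0 → κ * ‖w‖ ^ 2 ≤ ⟪B w, w⟫_ℝ) (v : E) :
    κ * ‖v‖ ^ 2 - (2 * M + |κ|) * |⟪n, v⟫_ℝ| * ‖v‖ ≤ ⟪B v, v⟫_ℝ := by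
  set s := ⟪n, v⟫_ℝ with hs
  set t := v - s • n with ht
  have hnn : ⟪n, n⟫_ℝ = 1 := by rw [real_inner_self_eq_norm_sq, hn]; norm_num
  have hnt : ⟪n, t⟫_ℝ = 0 := by
    rw [ht, inner_sub_right, real_inner_smul_right, hnn, mul_one, sub_self]
  have hv : v = t + s • n := by rw [ht]; abel
  have hsq : ‖v‖ ^ 2 = ‖t‖ ^ 2 + s ^ 2 := by
    rw [← real_inner_self_eq_norm_sq, ← real_inner_self_eq_norm_sq, hv]
    simp only [inner_add_left, inner_add_right, real_inner_smul_left, real_inner_smul_right, hnn,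
      hnt, real_inner_comm n t]
    ring
  have htv : ‖t‖ ≤ ‖v‖ := by
    apply le_of_sq_le_sq _ (norm_nonneg _)
    nlinarith [sq_nonneg s]
  have hsv : |s| ≤ ‖v‖ := by
    have := abs_real_inner_le_norm n v
    rwa [hn, one_mul] at this
  have hM0 : 0 ≤ M := (norm_nonneg _).trans hM
  have hBv : ∀ a b : E, |⟪B a, b⟫_ℝ| ≤ M * ‖a‖ * ‖b‖ := fun a b =>
    (abs_real_inner_le_norm _ _).trans
      (mul_le_mul_of_nonneg_right ((B.le_opNorm a).trans (by gcongr)) (norm_nonneg _))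
  have h1 := hBv n v
  have h2 := hBv t n
  rw [hn] at h1 h2
  have hexp : ⟪B v, v⟫_ℝ = ⟪B t, t⟫_ℝ + s * ⟪B n, v⟫_ℝ + s * ⟪B t, n⟫_ℝ := by
    conv_lhs => rw [hv, map_add, map_smul, inner_add_left, real_inner_smul_left, ← hv]
    conv_lhs => enter [1]; rw [hv]
    rw [inner_add_right, real_inner_smul_right]
    ring
  have h3 : |s * ⟪B n, v⟫_ℝ| ≤ |s| * (M * ‖v‖) := by
    rw [abs_mul]; gcongr; linarith
  have h4 : |s * ⟪B t, n⟫_ℝ| ≤ |s| * (M * ‖v‖) := by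
    rw [abs_mul]; gcongr
    exact h2.trans (by rw [mul_one]; gcongr)
  have h5 : κ * s ^ 2 ≤ |κ| * |s| * ‖v‖ := by
    have : s ^ 2 = |s| * |s| := by rw [← sq, sq_abs]
    rw [this, ← mul_assoc]
    calc κ * |s| * |s| ≤ |κ| * |s| * |s| := by gcongr; exact le_abs_self κ
      _ ≤ _ := by gcongr
  have h6 := hκ t hnt
  have h7 : κ * ‖v‖ ^ 2 = κ * ‖t‖ ^ 2 + κ * s ^ 2 := by rw [hsq]; ring
  rw [hexp]
  nlinarith [(abs_le.1 h3).1, (abs_le.1 h4).1]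

lemma quadratic_upper_bound {E : Type*} [NormedAddCommGroup E] [InnerProductSpace ℝ E]
    (B : E →L[ℝ] E) {n : E} (hn : ‖n‖ = 1) {M κ : ℝ} (hM : ‖B‖ ≤ M)
    (hκ : ∀ w, ⟪n, w⟫_ℝ = 0 → ⟪B w, w⟫_ℝ ≤ κ * ‖w‖ ^ 2) (v : E) :
    ⟪B v, v⟫_ℝ ≤ κ * ‖v‖ ^ 2 + (2 * M + |κ|) * |⟪n, v⟫_ℝ| * ‖v‖ := by
  have := quadratic_lower_bound (-B) hn (M := M) (κ := -κ) (by rwa [norm_neg])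
    (fun w hw => by have := hκ w hw; simp only [neg_apply, inner_neg_left]; linarith) v
  simp only [neg_apply, inner_neg_left, abs_neg] at this
  linarith

namespace IsSmoothBody

variable {D : ℕ} {A : Set (Space D)}

lemma exists_definingFunction (hA : IsSmoothBody A) {p : Space D} (hp : p ∈ frontier A) :
    ∃ ρ, IsDefiningFunction A ρ p := by
  obtain ⟨ρ, h1, h2, h3, h4⟩ := hA.c2Boundary p hp
  exact ⟨ρ, h1, h2, h3, h4⟩

lemma mem_of_mem_frontier (hA : IsSmoothBody A) {p : Space D} (hp : p ∈ frontier A) : p ∈ A :=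
  hA.compact.isClosed.frontier_subset hp

lemma isCompact_frontier (hA : IsSmoothBody A) : IsCompact (frontier A) :=
  hA.compact.of_isClosed_subset isClosed_frontier hA.compact.isClosed.frontier_subset

lemma isOuterNormal_outerNormal (hA : IsSmoothBody A) {p : Space D} (hp : p ∈ frontier A) :
    IsOuterNormal A p (outerNormal A p) := by
  obtain ⟨ρ, h⟩ := hA.exists_definingFunction hp
  rw [h.outerNormal_eq hA.strictConvex.convex (hA.mem_of_mem_frontier hp)]
  exact h.isOuterNormal hA.strictConvex.convex (hA.mem_of_mem_frontier hp)

lemma norm_outerNormal (hA : IsSmoothBody A) {p : Space D} (hp : p ∈ frontier A) :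
    ‖outerNormal A p‖ = 1 :=
  (hA.isOuterNormal_outerNormal hp).1

lemma inner_outerNormal_nonneg (hA : IsSmoothBody A) {p q : Space D} (hp : p ∈ frontier A)
    (hq : q ∈ A) : 0 ≤ ⟪outerNormal A p, p - q⟫_ℝ := by
  have := (hA.isOuterNormal_outerNormal hp).2 q hq
  rw [← neg_sub, inner_neg_right] at this
  linarith

lemma eq_outerNormal (hA : IsSmoothBody A) {p n : Space D} (hp : p ∈ frontier A)
    (hn : IsOuterNormal A p n) : n = outerNormal A p := by
  obtain ⟨ρ, h⟩ := hA.exists_definingFunction hp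
  rw [h.outerNormal_eq hA.strictConvex.convex (hA.mem_of_mem_frontier hp)]
  exact h.outerNormal_unique hn

lemma eventually_mem (hA : IsSmoothBody A) {p v : Space D} (hp : p ∈ frontier A)
    (hv : ⟪outerNormal A p, v⟫_ℝ < 0) : ∀ᶠ t in 𝓝[>] (0 : ℝ), p + t • v ∈ A := by
  obtain ⟨ρ, h⟩ := hA.exists_definingFunction hp
  refine h.eventually_mem ?_
  rw [h.outerNormal_eq hA.strictConvex.convex (hA.mem_of_mem_frontier hp),
    real_inner_smul_left] at hv
  exact (pos_iff_neg_of_mul_neg hv).1 (inv_pos.2 h.gradient_norm_pos)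

lemma continuousOn_outerNormal (hA : IsSmoothBody A) :
    ContinuousOn (outerNormal A) (frontier A) := by
  intro p hp
  obtain ⟨ρ, h⟩ := hA.exists_definingFunction hp
  have h1 : ContinuousAt (fun q => ‖∇ ρ q‖⁻¹ • ∇ ρ q) p :=
    (h.continuousAt_gradient.norm.inv₀ h.gradient_norm_pos.ne').smul h.continuousAt_gradient
  exact h1.continuousWithinAt.congr_of_eventuallyEq
    (h.outerNormal_eventuallyEq hA.strictConvex.convex hA.compact.isClosed)
    (h.outerNormal_eq hA.strictConvex.convex (hA.mem_of_mem_frontier hp))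

lemma exists_norm_outerNormal_sub_le (hA : IsSmoothBody A) {ε : ℝ} (hε : 0 < ε) :
    ∃ δ > 0, ∀ p ∈ frontier A, ∀ q ∈ frontier A, ‖p - q‖ < δ →
      ‖outerNormal A p - outerNormal A q‖ ≤ ε := by
  have := hA.isCompact_frontier.uniformContinuousOn_of_continuous hA.continuousOn_outerNormal
  obtain ⟨δ, hδ, h⟩ := Metric.uniformContinuousOn_iff.1 this ε hε
  refine ⟨δ, hδ, fun p hp q hq hpq => ?_⟩
  rw [← dist_eq_norm]
  exact (h p hp q hq (by rwa [dist_eq_norm])).le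

/-- Uniform strict convexity. The midpoint of a chord of length at least `δ` is the centre of a
ball of fixed radius in the body. -/
lemma exists_le_inner_outerNormal (hA : IsSmoothBody A) {δ : ℝ} (hδ : 0 < δ) :
    ∃ η > 0, ∀ p ∈ frontier A, ∀ q ∈ A, δ ≤ ‖p - q‖ → η ≤ ⟪outerNormal A p, p - q⟫_ℝ := by
  set T : Set (Space D × Space D) := (A ×ˢ A) ∩ {z | δ ≤ ‖z.1 - z.2‖} with hT
  have hTc : IsCompact T := (hA.compact.prod hA.compact).inter_right
    (isClosed_le continuous_const (by fun_prop))
  have himg : IsCompact ((fun z : Space D × Space D => midpoint ℝ z.1 z.2) '' T) :=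
    hTc.image (by simp only [midpoint_eq_smul_add]; fun_prop)
  have hsub : (fun z : Space D × Space D => midpoint ℝ z.1 z.2) '' T ⊆ interior A := by
    rintro _ ⟨z, ⟨⟨h1, h2⟩, h3⟩, rfl⟩
    have hne : z.1 ≠ z.2 := by
      intro h
      simp only [mem_ofPred_eq, h, sub_self, norm_zero] at h3
      linarith
    have := hA.strictConvex h1 h2 hne (a := 1 / 2) (b := 1 / 2) (by norm_num) (by norm_num)
      (by norm_num)
    change midpoint ℝ z.1 z.2 ∈ interior A
    rw [midpoint_eq_smul_add, smul_add]
    simpa using this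
  obtain ⟨r, hr, hthick⟩ := himg.exists_thickening_subset_open isOpen_interior hsub
  refine ⟨r, hr, fun p hp q hq hpq => ?_⟩
  have hn := hA.isOuterNormal_outerNormal hp
  set n := outerNormal A p with hn_def
  have hmem : midpoint ℝ p q + (r / 2) • n ∈ A := by
    refine interior_subset (hthick (Metric.mem_thickening_iff.2 ⟨midpoint ℝ p q,
      ⟨(p, q), ⟨⟨hA.mem_of_mem_frontier hp, hq⟩, hpq⟩, rfl⟩, ?_⟩))
    rw [dist_eq_norm, add_sub_cancel_left, norm_smul, hn.1, Real.norm_eq_abs,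
      abs_of_pos (by positivity)]
    linarith
  have h1 := hn.2 _ hmem
  have h2 : midpoint ℝ p q + (r / 2) • n - p = -((1 / 2 : ℝ) • (p - q)) + (r / 2) • n := by
    rw [midpoint_eq_smul_add, invOf_eq_inv]
    module
  rw [h2, inner_add_right, inner_neg_right, real_inner_smul_right, real_inner_smul_right,
    real_inner_self_eq_norm_sq, hn.1] at h1
  linarith

lemma normalCurvature_nonneg (hA : IsSmoothBody A) {p w : Space D} (hp : p ∈ frontier A)
    (hw : IsUnitTangent A p w) : 0 ≤ normalCurvature A p w := by
  obtain ⟨ρ, h⟩ := hA.exists_definingFunction hp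
  have hpA := hA.mem_of_mem_frontier hp
  obtain ⟨-, L, hL, hk⟩ := h.normalCurvature_eq hA.strictConvex.convex hA.compact.isClosed hpA hw.2
  have hw' : ⟪∇ ρ p, w⟫_ℝ = 0 := by
    have := hw.2
    rw [h.outerNormal_eq hA.strictConvex.convex hpA, real_inner_smul_left] at this
    exact (mul_eq_zero.1 this).resolve_left (inv_ne_zero h.gradient_norm_pos.ne')
  obtain ⟨α, l, hl, c, d, hd0, hds, hcd⟩ :=
    exists_fun_of_mem_tangentConeAt (h.mem_tangentConeAt hA.compact.isClosed hw')
  have hlim := hL.lim hd0 hds hcd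
  rw [hk]
  refine ge_of_tendsto (hlim.inner hcd) ?_
  filter_upwards [hds] with a ha
  have h1 := hA.inner_outerNormal_nonneg ha hpA
  have h2 := hA.inner_outerNormal_nonneg hp (hA.mem_of_mem_frontier ha)
  rw [add_sub_cancel_left] at h1
  rw [sub_add_cancel_left, inner_neg_right] at h2
  rw [real_inner_smul_left, real_inner_smul_right, inner_sub_left, ← mul_assoc]
  exact mul_nonneg (mul_self_nonneg _) (by linarith)

/-- The local second order description of the boundary near `p₀`. At each boundary point `p` near
`p₀` there is an operator `B`, bounded independently of `p`, that represents the curvature on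
tangent vectors, such that near `p₀` the body is up to an error `ε ‖y - p‖²` the set
`⟪n, y - p⟫ + ⟪B (y - p), y - p⟫ / 2 ≤ 0`. -/
lemma exists_local_quadratic (hA : IsSmoothBody A) {p₀ : Space D} (hp₀ : p₀ ∈ frontier A) :
    ∃ M : ℝ, 0 < M ∧ ∀ ε > 0, ∃ δ > 0, ∀ p ∈ frontier A, dist p p₀ < δ →
      ∃ B : Space D →L[ℝ] Space D, ‖B‖ ≤ M ∧
        (∀ w, ⟪outerNormal A p, w⟫_ℝ = 0 → normalCurvature A p w = ⟪B w, w⟫_ℝ) ∧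
        ∀ y, dist y p₀ < δ →
          (y ∈ frontier A →
            |⟪outerNormal A p, y - p⟫_ℝ + 1 / 2 * ⟪B (y - p), y - p⟫_ℝ| ≤ ε * ‖y - p‖ ^ 2) ∧
          (⟪outerNormal A p, y - p⟫_ℝ + 1 / 2 * ⟪B (y - p), y - p⟫_ℝ + ε * ‖y - p‖ ^ 2 ≤ 0 →
            y ∈ A) := by
  obtain ⟨ρ, h⟩ := hA.exists_definingFunction hp₀
  have hG := contDiffAt_gradient h.contDiffAt
  have hg0 := h.gradient_norm_pos
  have hcont : ContinuousAt (fderiv ℝ (∇ ρ)) p₀ :=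
    (hG.fderiv_right (m := 0) (by norm_num)).continuousAt
  have hcB : ContinuousAt (fun q => ‖∇ ρ q‖⁻¹ * ‖fderiv ℝ (∇ ρ) q‖) p₀ :=
    (h.continuousAt_gradient.norm.inv₀ hg0.ne').mul hcont.norm
  refine ⟨‖∇ ρ p₀‖⁻¹ * ‖fderiv ℝ (∇ ρ) p₀‖ + 1, by positivity, fun ε hε => ?_⟩
  obtain ⟨δ₁, hδ₁, ht⟩ := h.taylor (ε := ε * (‖∇ ρ p₀‖ / 2)) (by positivity)
  have hev : ∀ᶠ q in 𝓝 p₀, (q ∈ frontier A → IsDefiningFunction A ρ q) ∧ (q ∈ A ↔ ρ q ≤ 0) ∧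
      ‖∇ ρ q‖⁻¹ * ‖fderiv ℝ (∇ ρ) q‖ ≤ ‖∇ ρ p₀‖⁻¹ * ‖fderiv ℝ (∇ ρ) p₀‖ + 1 ∧
      ‖∇ ρ p₀‖ / 2 ≤ ‖∇ ρ q‖ :=
    (h.eventually hA.compact.isClosed).and (h.mem_iff.and
      ((hcB.eventually_le_const (by linarith)).and
        (h.continuousAt_gradient.norm.eventually_const_le (by linarith))))
  obtain ⟨δ₂, hδ₂, hb⟩ := Metric.eventually_nhds_iff.1 hev
  refine ⟨min δ₁ δ₂, by positivity, fun p hp hpd => ?_⟩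
  obtain ⟨hdef, -, hB, hg⟩ := hb (hpd.trans_le (min_le_right _ _))
  have hρ := hdef hp
  have hpA := hA.mem_of_mem_frontier hp
  have hgp := hρ.gradient_norm_pos
  refine ⟨‖∇ ρ p‖⁻¹ • fderiv ℝ (∇ ρ) p, ?_, fun w hw => ?_, fun y hy => ?_⟩
  · rwa [norm_smul, norm_inv, norm_norm]
  · rw [(hρ.normalCurvature_eq hA.strictConvex.convex hA.compact.isClosed hpA hw).1,
      smul_apply, real_inner_smul_left]
  · obtain ⟨hdefy, hyA, -, -⟩ := hb (hy.trans_le (min_le_right _ _))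
    have hT := ht p (hpd.trans_le (min_le_left _ _)) y (hy.trans_le (min_le_left _ _))
    rw [hρ.eq_zero, sub_zero] at hT
    have hn : ⟪outerNormal A p, y - p⟫_ℝ = ‖∇ ρ p‖⁻¹ * ⟪∇ ρ p, y - p⟫_ℝ := by
      rw [hρ.outerNormal_eq hA.strictConvex.convex hpA, real_inner_smul_left]
    have hE : ε * (‖∇ ρ p₀‖ / 2) * ‖y - p‖ ^ 2 ≤ ‖∇ ρ p‖ * (ε * ‖y - p‖ ^ 2) := by
      nlinarith [mul_le_mul_of_nonneg_right hg (by positivity : 0 ≤ ε * ‖y - p‖ ^ 2)]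
    have hfac : ⟪outerNormal A p, y - p⟫_ℝ
        + 1 / 2 * ⟪(‖∇ ρ p‖⁻¹ • fderiv ℝ (∇ ρ) p) (y - p), y - p⟫_ℝ = ‖∇ ρ p‖⁻¹ *
          (⟪∇ ρ p, y - p⟫_ℝ + 1 / 2 * ⟪fderiv ℝ (∇ ρ) p (y - p), y - p⟫_ℝ) := by
      rw [hn, smul_apply, real_inner_smul_left]; ring
    rw [hfac]
    refine ⟨fun hyf => ?_, fun hle => ?_⟩
    · rw [(hdefy hyf).eq_zero] at hT
      rw [abs_mul, abs_of_pos (inv_pos.2 hgp), inv_mul_le_iff₀ hgp]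
      refine le_trans ?_ hE
      rw [abs_le] at hT ⊢
      constructor <;> linarith [hT.1, hT.2]
    · rw [hyA]
      have h1 : ⟪∇ ρ p, y - p⟫_ℝ + 1 / 2 * ⟪fderiv ℝ (∇ ρ) p (y - p), y - p⟫_ℝ
          ≤ -(‖∇ ρ p‖ * (ε * ‖y - p‖ ^ 2)) := by
        have h2 : ‖∇ ρ p‖⁻¹ * (⟪∇ ρ p, y - p⟫_ℝ
            + 1 / 2 * ⟪fderiv ℝ (∇ ρ) p (y - p), y - p⟫_ℝ) ≤ -(ε * ‖y - p‖ ^ 2) := by linarith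
        rw [inv_mul_le_iff₀ hgp] at h2
        linarith
      linarith [(abs_le.1 hT).2]

lemma exists_normalCurvature_le (hA : IsSmoothBody A) :
    ∃ M : ℝ, ∀ p ∈ frontier A, ∀ w, IsUnitTangent A p w → normalCurvature A p w ≤ M := by
  refine hA.isCompact_frontier.induction_on
    (p := fun s => ∃ M : ℝ, ∀ p ∈ s, p ∈ frontier A → ∀ w, IsUnitTangent A p w →
      normalCurvature A p w ≤ M) ⟨0, by simp⟩ ?_ ?_ ?_ |>.imp fun M hM p hp => hM p hp hp
  · rintro s t hst ⟨M, hM⟩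
    exact ⟨M, fun p hp => hM p (hst hp)⟩
  · rintro s t ⟨M, hM⟩ ⟨M', hM'⟩
    refine ⟨max M M', fun p hp hpf w hw => ?_⟩
    rcases hp with hp | hp
    · exact (hM p hp hpf w hw).trans (le_max_left _ _)
    · exact (hM' p hp hpf w hw).trans (le_max_right _ _)
  · intro p₀ hp₀
    obtain ⟨M, -, h⟩ := hA.exists_local_quadratic hp₀
    obtain ⟨δ, hδ, h⟩ := h 1 one_pos
    refine ⟨_, mem_nhdsWithin_of_mem_nhds (Metric.ball_mem_nhds p₀ hδ), M,
      fun p hp hpf w hw => ?_⟩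
    obtain ⟨B, hB, hk, -⟩ := h p hpf hp
    rw [hk w hw.2]
    calc ⟪B w, w⟫_ℝ ≤ ‖B w‖ * ‖w‖ := real_inner_le_norm _ _
      _ ≤ ‖B‖ * ‖w‖ * ‖w‖ := by gcongr; exact B.le_opNorm w
      _ = ‖B‖ := by rw [hw.1]; ring
      _ ≤ M := hB

/-- A lower bound for the curvature on `S` gives quadratic convexity near `S`, up to `ε`. -/
lemma exists_quadratic_convexity (hA : IsSmoothBody A) {S : Set (Space D)} (hS : S ⊆ frontier A)
    {κ ε : ℝ} (hε : 0 < ε) (hκ : ∀ p ∈ S, ∀ w, IsUnitTangent A p w → κ ≤ normalCurvature A p w) :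
    ∃ δ > 0, ∀ p ∈ S, ∀ q ∈ frontier A, ‖p - q‖ < δ →
      (κ - ε) / 2 * ‖p - q‖ ^ 2 ≤ ⟪outerNormal A p, p - q⟫_ℝ := by
  obtain ⟨δ, hδ, h⟩ : ∃ δ > 0, ∀ p ∈ frontier A, ∀ q, dist q p < δ →
      (p ∈ S → q ∈ frontier A →
        (κ - ε) / 2 * ‖p - q‖ ^ 2 ≤ ⟪outerNormal A p, p - q⟫_ℝ) := by
    refine exists_uniform_radius hA.isCompact_frontier
      (fun p q => (p ∈ S → q ∈ frontier A →
        (κ - ε) / 2 * ‖p - q‖ ^ 2 ≤ ⟪outerNormal A p, p - q⟫_ℝ)) fun p₀ hp₀ => ?_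
    obtain ⟨M, hM, h⟩ := hA.exists_local_quadratic hp₀
    obtain ⟨δ, hδ, h⟩ := h (min (ε / 4) 1) (by positivity)
    set C : ℝ := M / 2 + 1 with hC
    have hC0 : 0 < C := by positivity
    set N : ℝ := (2 * M + |κ|) * C with hN
    have hN0 : 0 < N := by positivity
    refine ⟨min δ (ε / (4 * N)), by positivity, fun p hpf q hpd hqd hpS hqf => ?_⟩
    obtain ⟨B, hB, hk, hy⟩ := h p hpf (hpd.trans_le (min_le_left _ _))
    have h1 := (hy q (hqd.trans_le (min_le_left _ _))).1 hqf
    have hn := hA.norm_outerNormal hpf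
    set n := outerNormal A p with hn_def
    have hflip : ⟪n, p - q⟫_ℝ = -⟪n, q - p⟫_ℝ := by rw [← neg_sub, inner_neg_right]
    rw [hflip, ← norm_neg, neg_sub]
    set v := q - p with hv
    have hvn : ‖v‖ ≤ ε / (2 * N) := by
      have : ‖v‖ ≤ dist q p₀ + dist p p₀ := by
        rw [hv, ← dist_eq_norm, dist_comm p p₀]; exact dist_triangle _ _ _
      have h2 := hpd.trans_le (min_le_right _ _)
      have h3 := hqd.trans_le (min_le_right _ _)
      have h4 : ε / (2 * N) = ε / (4 * N) + ε / (4 * N) := by field_simp; norm_num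
      linarith
    have hBv : |⟪B v, v⟫_ℝ| ≤ M * ‖v‖ ^ 2 :=
      (abs_real_inner_le_norm _ _).trans (by
        rw [sq, ← mul_assoc]
        gcongr
        exact (B.le_opNorm v).trans (by gcongr))
    have hs : |⟪n, v⟫_ℝ| ≤ C * ‖v‖ ^ 2 := by
      have := mul_le_mul_of_nonneg_right (min_le_right (ε / 4) 1) (sq_nonneg ‖v‖)
      rw [abs_le] at h1 hBv ⊢
      constructor <;> nlinarith [h1.1, h1.2, hBv.1, hBv.2]
    have hq := quadratic_lower_bound B hn hB (κ := κ) (fun w hw => by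
      rcases eq_or_ne w 0 with rfl | hw0
      · simp
      have hw1 : 0 < ‖w‖ := norm_pos_iff.2 hw0
      have hu : ⟪n, ‖w‖⁻¹ • w⟫_ℝ = 0 := by rw [real_inner_smul_right, hw, mul_zero]
      have h2 := hκ p hpS (‖w‖⁻¹ • w) ⟨norm_smul_inv_norm hw0, hu⟩
      rw [hk _ hu, map_smul, real_inner_smul_left, real_inner_smul_right, ← mul_assoc, ← mul_inv,
        ← sq, inv_mul_eq_div, le_div_iff₀ (by positivity)] at h2
      exact h2) v
    have h5 : (2 * M + |κ|) * |⟪n, v⟫_ℝ| * ‖v‖ ≤ ε / 2 * ‖v‖ ^ 2 := by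
      calc (2 * M + |κ|) * |⟪n, v⟫_ℝ| * ‖v‖ ≤ (2 * M + |κ|) * (C * ‖v‖ ^ 2) * (ε / (2 * N)) := by
            gcongr
        _ = N * (ε / (2 * N)) * ‖v‖ ^ 2 := by rw [hN]; ring
        _ = _ := by field_simp
    have h6 := mul_le_mul_of_nonneg_right (min_le_left (ε / 4) 1) (sq_nonneg ‖v‖)
    nlinarith [(abs_le.1 h1).2]
  exact ⟨δ, hδ, fun p hp q hq hpq =>
    h p (hS hp) q (by rwa [dist_comm, dist_eq_norm]) hp hq⟩

/-- If the curvature on `S` is at most `κ`, balls of radius `(κ + ε)⁻¹` touch the boundary locally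
from inside, at the points of `S`. -/
lemma exists_interior_ball (hA : IsSmoothBody A) {S : Set (Space D)} (hS : S ⊆ frontier A)
    {κ ε : ℝ} (hκ0 : 0 ≤ κ) (hε : 0 < ε)
    (hκ : ∀ p ∈ S, ∀ w, IsUnitTangent A p w → normalCurvature A p w ≤ κ) :
    ∃ δ > 0, ∀ p ∈ S, ∀ m, ‖m‖ = 1 → ‖m - outerNormal A p‖ < δ →
      p + (κ + ε)⁻¹ • (m - outerNormal A p) ∈ A := by
  set r := (κ + ε)⁻¹ with hr
  have hr0 : 0 < r := by positivity
  obtain ⟨δ, hδ, h⟩ : ∃ δ > 0, ∀ p ∈ frontier A, ∀ q, dist q p < δ →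
      (p ∈ S → ∀ m : Space D, ‖m‖ = 1 →
        q = p + r • (m - outerNormal A p) → q ∈ A) := by
    refine exists_uniform_radius hA.isCompact_frontier
      (fun p q => (p ∈ S → ∀ m : Space D, ‖m‖ = 1 →
        q = p + r • (m - outerNormal A p) → q ∈ A)) fun p₀ hp₀ => ?_
    obtain ⟨M, hM, h⟩ := hA.exists_local_quadratic hp₀
    obtain ⟨δ, hδ, h⟩ := h (ε / 4) (by positivity)
    set N : ℝ := (2 * M + |κ|) * (κ + ε) with hN
    have hN0 : 0 < N := by positivity
    refine ⟨min δ (ε / (2 * N)), by positivity, fun p hpf y hpd hyd hpS m hm hym => ?_⟩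
    obtain ⟨B, hB, hk, hy⟩ := h p hpf (hpd.trans_le (min_le_left _ _))
    refine (hy y (hyd.trans_le (min_le_left _ _))).2 ?_
    have hn := hA.norm_outerNormal hpf
    set n := outerNormal A p with hn_def
    set v := y - p with hv
    have hvm : v = r • (m - n) := by rw [hv, hym, add_sub_cancel_left]
    have hvn : ‖v‖ ≤ ε / N := by
      have : ‖v‖ ≤ dist y p₀ + dist p p₀ := by
        rw [hv, ← dist_eq_norm, dist_comm p p₀]; exact dist_triangle _ _ _
      have h2 := hpd.trans_le (min_le_right _ _)
      have h3 := hyd.trans_le (min_le_right _ _)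
      have h4 : ε / N = ε / (2 * N) + ε / (2 * N) := by field_simp; norm_num
      linarith
    have hs : ⟪n, v⟫_ℝ = -((κ + ε) / 2 * ‖v‖ ^ 2) := by
      rw [hvm, real_inner_smul_right, norm_smul, inner_sub_right, real_inner_self_eq_norm_sq,
        mul_pow, norm_sub_sq_real, hm, hn, real_inner_comm m n, Real.norm_eq_abs, sq_abs, hr]
      field_simp
      ring
    have hq := quadratic_upper_bound B hn hB (κ := κ) (fun w hw => by
      rcases eq_or_ne w 0 with rfl | hw0
      · simp
      have hw1 : 0 < ‖w‖ := norm_pos_iff.2 hw0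
      have hu : ⟪n, ‖w‖⁻¹ • w⟫_ℝ = 0 := by rw [real_inner_smul_right, hw, mul_zero]
      have h2 := hκ p hpS (‖w‖⁻¹ • w) ⟨norm_smul_inv_norm hw0, hu⟩
      rw [hk _ hu, map_smul, real_inner_smul_left, real_inner_smul_right, ← mul_assoc, ← mul_inv,
        ← sq, inv_mul_eq_div, div_le_iff₀ (by positivity)] at h2
      exact h2) v
    have h5 : (2 * M + |κ|) * |⟪n, v⟫_ℝ| * ‖v‖ ≤ ε / 2 * ‖v‖ ^ 2 := by
      rw [hs, abs_neg, abs_of_nonneg (by positivity : 0 ≤ (κ + ε) / 2 * ‖v‖ ^ 2)]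
      calc (2 * M + |κ|) * ((κ + ε) / 2 * ‖v‖ ^ 2) * ‖v‖
          ≤ (2 * M + |κ|) * ((κ + ε) / 2 * ‖v‖ ^ 2) * (ε / N) := by gcongr
        _ = N * (ε / N) / 2 * ‖v‖ ^ 2 := by rw [hN]; ring
        _ = _ := by field_simp
    rw [hs]
    nlinarith
  refine ⟨δ / r, by positivity, fun p hp m hm hmn => h p (hS hp) _ ?_ hp m hm rfl⟩
  rw [dist_eq_norm, add_sub_cancel_left, norm_smul, Real.norm_eq_abs, abs_of_pos hr0]
  rwa [lt_div_iff₀' hr0] at hmn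

/-- If the curvature on `S` is at most `κ`, the normal is locally cocoercive on `S`. This is the
Baillon-Haddad argument: the ball that touches at one point lies on the inner side of the
supporting hyperplane at the other point. -/
lemma exists_cocoercive_outerNormal (hA : IsSmoothBody A) {S : Set (Space D)}
    (hS : S ⊆ frontier A) {κ ε : ℝ} (hκ0 : 0 ≤ κ) (hε : 0 < ε)
    (hκ : ∀ p ∈ S, ∀ w, IsUnitTangent A p w → normalCurvature A p w ≤ κ) :
    ∃ δ > 0, ∀ p ∈ S, ∀ q ∈ S, ‖p - q‖ < δ →
      ‖outerNormal A p - outerNormal A q‖ ^ 2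
        ≤ (κ + ε) * ⟪p - q, outerNormal A p - outerNormal A q⟫_ℝ := by
  obtain ⟨δ, hδ, h⟩ := hA.exists_interior_ball hS hκ0 hε hκ
  obtain ⟨δ', hδ', h'⟩ := hA.exists_norm_outerNormal_sub_le (half_pos hδ)
  refine ⟨δ', hδ', fun p hp q hq hpq => ?_⟩
  have hz := h' p (hS hp) q (hS hq) hpq
  have hp1 := h p hp (outerNormal A q) (hA.norm_outerNormal (hS hq))
    (by rw [norm_sub_rev]; linarith)
  have hq1 := h q hq (outerNormal A p) (hA.norm_outerNormal (hS hp)) (by linarith)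
  have h1 := hA.inner_outerNormal_nonneg (hS hq) hp1
  have h2 := hA.inner_outerNormal_nonneg (hS hp) hq1
  have hn := hA.norm_outerNormal (hS hp)
  have hm := hA.norm_outerNormal (hS hq)
  generalize outerNormal A p = n at *
  generalize outerNormal A q = m at *
  rw [← sub_sub, inner_sub_right, real_inner_smul_right, inner_sub_right m m,
    real_inner_self_eq_norm_sq, hm] at h1
  rw [← sub_sub, inner_sub_right, real_inner_smul_right, inner_sub_right n n,
    real_inner_self_eq_norm_sq, hn] at h2
  rw [real_inner_comm, inner_sub_left, norm_sub_sq_real, hn, hm]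
  have h3 : ⟪m, q - p⟫_ℝ = -⟪m, p - q⟫_ℝ := by rw [← neg_sub, inner_neg_right]
  have h4 : ⟪m, n⟫_ℝ = ⟪n, m⟫_ℝ := real_inner_comm _ _
  have hpos : 0 < κ + ε := by positivity
  rw [← div_le_iff₀' hpos, div_eq_inv_mul]
  rw [h3] at h1
  simp only [h4] at h1 h2
  nlinarith

end IsSmoothBody

end OpenBilliard

namespace OpenBilliard

/-! ### Unit directions -/

section UnitDir

variable {D : ℕ}

lemma unitDir_swap (p q : Space D) : unitDir q p = -unitDir p q := by
  rw [unitDir, unitDir, ← smul_neg, neg_sub, norm_sub_rev]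

lemma norm_unitDir {p q : Space D} (h : p ≠ q) : ‖unitDir p q‖ = 1 := by
  have : ‖q - p‖ ≠ 0 := norm_ne_zero_iff.2 (sub_ne_zero.2 h.symm)
  rw [unitDir, norm_smul, norm_inv, norm_norm, inv_mul_cancel₀ this]

lemma norm_smul_unitDir (p q : Space D) : ‖q - p‖ • unitDir p q = q - p := by
  rcases eq_or_ne q p with rfl | h
  · simp
  · rw [unitDir, smul_smul, mul_inv_cancel₀ (norm_ne_zero_iff.2 (sub_ne_zero.2 h)), one_smul]

lemma norm_add_le_first_order {E : Type*} [NormedAddCommGroup E] [InnerProductSpace ℝ E] {y : E}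
    (hy : y ≠ 0) (z : E) : ‖y + z‖ ≤ ‖y‖ + ⟪‖y‖⁻¹ • y, z⟫_ℝ + ‖z‖ ^ 2 / (2 * ‖y‖) := by
  have hp : 0 < ‖y‖ := norm_pos_iff.2 hy
  have h1 : ‖y + z‖ ^ 2 = ‖y‖ ^ 2 + 2 * ⟪y, z⟫_ℝ + ‖z‖ ^ 2 := norm_add_sq_real y z
  have h2 : ‖y‖ + ⟪‖y‖⁻¹ • y, z⟫_ℝ + ‖z‖ ^ 2 / (2 * ‖y‖) = (‖y‖ ^ 2 + ‖y + z‖ ^ 2) / (2 * ‖y‖) := by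
    rw [real_inner_smul_left, h1]; field_simp; ring
  rw [h2, le_div_iff₀ (by positivity)]
  nlinarith [sq_nonneg (‖y‖ - ‖y + z‖)]

/-- First order condition for a point of a convex set that minimizes the sum of the distances to
two given points. -/
lemma inner_unitDir_sub_nonpos {A : Set (Space D)} (hA : Convex ℝ A) {a b x₀ : Space D}
    (hx₀ : x₀ ∈ A) (ha : x₀ ≠ a) (hb : x₀ ≠ b)
    (hmin : ∀ x ∈ A, ‖x₀ - a‖ + ‖b - x₀‖ ≤ ‖x - a‖ + ‖b - x‖) {x : Space D} (hx : x ∈ A) :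
    ⟪unitDir x₀ b - unitDir a x₀, x - x₀⟫_ℝ ≤ 0 := by
  set z := x - x₀ with hz
  set C := ‖z‖ ^ 2 / (2 * ‖x₀ - a‖) + ‖z‖ ^ 2 / (2 * ‖b - x₀‖) with hC
  have hC0 : 0 ≤ C := by positivity
  have key : ∀ t ∈ Ioc (0 : ℝ) 1, ⟪unitDir x₀ b - unitDir a x₀, z⟫_ℝ ≤ t * C := by
    intro t ht
    have h1 := hmin _ (hA.add_smul_sub_mem hx₀ hx ⟨ht.1.le, ht.2⟩)
    have h2 := norm_add_le_first_order (sub_ne_zero.2 ha) (t • z)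
    have h3 := norm_add_le_first_order (sub_ne_zero.2 hb.symm) (-(t • z))
    have e1 : x₀ - a + t • z = x₀ + t • (x - x₀) - a := by rw [hz]; abel
    have e2 : b - x₀ + -(t • z) = b - (x₀ + t • (x - x₀)) := by rw [hz]; abel
    rw [e1, real_inner_smul_right, norm_smul, Real.norm_eq_abs, mul_pow, sq_abs] at h2
    rw [e2, inner_neg_right, real_inner_smul_right, norm_neg, norm_smul, Real.norm_eq_abs,
      mul_pow, sq_abs] at h3
    have h4 : t * ⟪unitDir x₀ b - unitDir a x₀, z⟫_ℝ ≤ t * (t * C) := by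
      rw [inner_sub_left, hC]
      simp only [unitDir]
      have e3 : t ^ 2 * ‖z‖ ^ 2 / (2 * ‖x₀ - a‖) = t * (t * (‖z‖ ^ 2 / (2 * ‖x₀ - a‖))) := by ring
      have e4 : t ^ 2 * ‖z‖ ^ 2 / (2 * ‖b - x₀‖) = t * (t * (‖z‖ ^ 2 / (2 * ‖b - x₀‖))) := by ring
      rw [e3] at h2
      rw [e4] at h3
      linarith
    exact le_of_mul_le_mul_left h4 ht.1
  by_contra! hcon
  have h5 := key (min 1 (⟪unitDir x₀ b - unitDir a x₀, z⟫_ℝ / (2 * (C + 1))))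
    ⟨by positivity, min_le_left _ _⟩
  have h6 := mul_le_mul_of_nonneg_right
    (min_le_right 1 (⟪unitDir x₀ b - unitDir a x₀, z⟫_ℝ / (2 * (C + 1)))) hC0
  have h7 : ⟪unitDir x₀ b - unitDir a x₀, z⟫_ℝ / (2 * (C + 1)) * C
      < ⟪unitDir x₀ b - unitDir a x₀, z⟫_ℝ := by
    rw [div_mul_eq_mul_div, div_lt_iff₀ (by positivity)]
    nlinarith
  linarith

end UnitDir

/-! ### Elementary properties of billiard orbits -/

variable {D u : ℕ} {K : Fin u → Set (Space D)}

/-- Finitely many conditions that hold for small parameters hold for a common parameter. -/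
lemma exists_pos_forall {ι : Type*} [Finite ι] {P : ι → ℝ → Prop}
    (hmono : ∀ i a b, a ≤ b → P i b → P i a) (h : ∀ i, ∃ δ > 0, P i δ) :
    ∃ δ > 0, ∀ i, P i δ := by
  have key : ∀ i, ∀ᶠ δ in 𝓝[>] (0 : ℝ), P i δ := by
    intro i
    obtain ⟨δ, hδ, hP⟩ := h i
    filter_upwards [Ioo_mem_nhdsGT hδ] with x hx
    exact hmono i x δ hx.2.le hP
  obtain ⟨δ, h1, h2⟩ := ((eventually_all.2 key).and self_mem_nhdsWithin).exists
  exact ⟨δ, h2, h1⟩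

namespace IsOpenBilliard

lemma body (hK : IsOpenBilliard K) (i : Fin u) : IsSmoothBody (K i) :=
  ⟨hK.compact i, hK.strictConvex i, hK.c2Boundary i⟩

lemma index_unique (hK : IsOpenBilliard K) {x : Space D} {i j : Fin u} (hi : x ∈ K i)
    (hj : x ∈ K j) : i = j := by
  by_contra h
  exact Set.disjoint_left.1 (hK.disjoint i j h) hi hj

lemma exists_norm_le (hK : IsOpenBilliard K) : ∃ R : ℝ, 0 < R ∧ ∀ i, ∀ x ∈ K i, ‖x‖ ≤ R := by
  have h : IsCompact (⋃ i, K i) := isCompact_iUnion hK.compact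
  obtain ⟨R, hR⟩ := h.isBounded.exists_norm_le
  exact ⟨max R 1, by positivity, fun i x hx =>
    (hR x (mem_iUnion.2 ⟨i, hx⟩)).trans (le_max_left _ _)⟩

/-- Quantitative form of the no-eclipse condition. It includes the case `i = j`. -/
lemma exists_le_norm_sub (hK : IsOpenBilliard K) :
    ∃ e > 0, ∀ i j k, k ≠ i → k ≠ j → ∀ a ∈ K i, ∀ b ∈ K j, ∀ x ∈ segment ℝ a b, ∀ y ∈ K k,
      e ≤ ‖x - y‖ := by
  have key := exists_pos_forall (ι := Fin u × Fin u × Fin u)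
    (P := fun z e => z.2.2 ≠ z.1 → z.2.2 ≠ z.2.1 → ∀ a ∈ K z.1, ∀ b ∈ K z.2.1,
      ∀ x ∈ segment ℝ a b, ∀ y ∈ K z.2.2, e ≤ ‖x - y‖)
    (fun z a b hab hb h1 h2 p hp q hq x hx y hy => hab.trans (hb h1 h2 p hp q hq x hx y hy)) ?_
  · obtain ⟨e, he, h⟩ := key
    exact ⟨e, he, fun i j k => h (i, j, k)⟩
  rintro ⟨i, j, k⟩
  have hdisj : k ≠ i → k ≠ j → Disjoint (convexHull ℝ (K i ∪ K j)) (K k) := by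
    intro h1 h2
    rcases eq_or_ne i j with rfl | hij
    · rw [union_self, (hK.strictConvex i).convex.convexHull_eq]
      exact hK.disjoint i k h1.symm
    · exact hK.noEclipse i j k hij h2.symm h1.symm
  by_cases hk : k ≠ i ∧ k ≠ j
  · set H := (fun z : Space D × Space D × ℝ => AffineMap.lineMap z.1 z.2.1 z.2.2) ''
      (K i ×ˢ K j ×ˢ Icc (0 : ℝ) 1) with hH
    have hc : IsCompact H := ((hK.compact i).prod ((hK.compact j).prod isCompact_Icc)).image
      (by simp only [AffineMap.lineMap_apply_module]; fun_prop)
    have hsub : H ⊆ convexHull ℝ (K i ∪ K j) := by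
      rintro _ ⟨⟨a, b, t⟩, ⟨ha, hb, ht⟩, rfl⟩
      have ha' : a ∈ convexHull ℝ (K i ∪ K j) := subset_convexHull ℝ _ (mem_union_left _ ha)
      have hb' : b ∈ convexHull ℝ (K i ∪ K j) := subset_convexHull ℝ _ (mem_union_right _ hb)
      refine (convex_convexHull ℝ _).segment_subset ha' hb' ?_
      rw [segment_eq_image_lineMap]
      exact ⟨t, ht, rfl⟩
    obtain ⟨r, hr, h⟩ := Metric.exists_pos_forall_lt_edist hc (hK.compact k).isClosed
      ((hdisj hk.1 hk.2).mono_left hsub)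
    refine ⟨r, by exact_mod_cast hr, fun _ _ a ha b hb x hx y hy => ?_⟩
    rw [segment_eq_image_lineMap] at hx
    obtain ⟨t, ht, rfl⟩ := hx
    have := h _ ⟨(a, b, t), ⟨ha, hb, ht⟩, rfl⟩ y hy
    rw [edist_nndist, ENNReal.coe_lt_coe] at this
    rw [← dist_eq_norm, ← coe_nndist]
    exact_mod_cast this.le
  · exact ⟨1, one_pos, fun h1 h2 => absurd ⟨h1, h2⟩ hk⟩

end IsOpenBilliard

namespace IsOrbit

variable {p : ℤ → Space D}

lemma shift (h : IsOrbit K p) (k : ℤ) : IsOrbit K (fun j => p (j + k)) where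
  mem_boundary j := h.mem_boundary _
  free_flight j := by
    have := h.free_flight (j + k)
    rwa [add_right_comm] at this
  reflection j i hj := by
    have := h.reflection (j + k) i hj
    rwa [add_right_comm, add_sub_right_comm] at this

lemma mem_frontier (h : IsOrbit K p) (hK : IsOpenBilliard K) {j : ℤ} {i : Fin u}
    (hj : p j ∈ K i) : p j ∈ frontier (K i) := by
  obtain ⟨i', hi'⟩ := h.mem_boundary j
  rwa [hK.index_unique hj ((hK.body i').mem_of_mem_frontier hi')]

lemma exists_mem (h : IsOrbit K p) (hK : IsOpenBilliard K) (j : ℤ) : ∃ i, p j ∈ K i := by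
  obtain ⟨i, hi⟩ := h.mem_boundary j
  exact ⟨i, (hK.body i).mem_of_mem_frontier hi⟩

lemma index_ne (h : IsOrbit K p) (hK : IsOpenBilliard K) {j : ℤ} {i i' : Fin u}
    (hj : p j ∈ K i) (hj' : p (j + 1) ∈ K i') : i ≠ i' := by
  rintro rfl
  have h1 : midpoint ℝ (p j) (p (j + 1)) ∈ openSegment ℝ (p j) (p (j + 1)) :=
    ⟨1 / 2, 1 / 2, by norm_num, by norm_num, by norm_num, by
      rw [midpoint_eq_smul_add, smul_add]; simp⟩
  exact Set.disjoint_left.1 (h.free_flight j) h1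
    (mem_iUnion.2 ⟨i, (hK.strictConvex i).convex.openSegment_subset hj hj' h1⟩)

lemma ne_succ (h : IsOrbit K p) (hK : IsOpenBilliard K) (j : ℤ) : p j ≠ p (j + 1) := by
  intro heq
  obtain ⟨i, hi⟩ := h.exists_mem hK j
  exact h.index_ne hK hi (heq ▸ hi) rfl

lemma norm_dir (h : IsOrbit K p) (hK : IsOpenBilliard K) (j : ℤ) :
    ‖unitDir (p j) (p (j + 1))‖ = 1 := norm_unitDir (h.ne_succ hK j)

/-- The reflection law in terms of the outgoing velocity. -/
lemma reflect (h : IsOrbit K p) (hK : IsOpenBilliard K) {j : ℤ} {i : Fin u} (hj : p j ∈ K i) :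
    unitDir (p j) (p (j + 1)) = unitDir (p (j - 1)) (p j) +
      (2 * ⟪unitDir (p j) (p (j + 1)), outerNormal (K i) (p j)⟫_ℝ) • outerNormal (K i) (p j) ∧
    ⟪unitDir (p (j - 1)) (p j), outerNormal (K i) (p j)⟫_ℝ =
      -⟪unitDir (p j) (p (j + 1)), outerNormal (K i) (p j)⟫_ℝ := by
  have h1 := h.reflection j i hj
  have hn := (hK.body i).norm_outerNormal (h.mem_frontier hK hj)
  have h2 : ⟪unitDir (p (j - 1)) (p j), outerNormal (K i) (p j)⟫_ℝ =
      -⟪unitDir (p j) (p (j + 1)), outerNormal (K i) (p j)⟫_ℝ := by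
    rw [h1, inner_sub_left, real_inner_smul_left, real_inner_self_eq_norm_sq, hn]
    ring
  refine ⟨?_, h2⟩
  rwa [h2, mul_neg, neg_smul, sub_neg_eq_add] at h1

/-- The time reversal of an orbit. -/
lemma reverse (h : IsOrbit K p) (hK : IsOpenBilliard K) : IsOrbit K (fun j => p (-j)) where
  mem_boundary j := h.mem_boundary _
  free_flight j := by
    have := h.free_flight (-(j + 1))
    rwa [openSegment_symm, show -(j + 1) + 1 = -j by ring] at this
  reflection j i hj := by
    obtain ⟨h1, h2⟩ := h.reflect hK hj
    have e1 : -(j + 1) = -j - 1 := by ring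
    have e2 : -(j - 1) = -j + 1 := by ring
    simp only [e1, e2]
    rw [unitDir_swap (p (-j - 1)) (p (-j)), unitDir_swap (p (-j)) (p (-j + 1)), inner_neg_left,
      mul_neg, neg_smul]
    generalize ⟪unitDir (p (-j)) (p (-j + 1)), outerNormal (K i) (p (-j))⟫_ℝ = c at *
    rw [h1]
    abel

lemma inner_dir_nonneg (h : IsOrbit K p) (hK : IsOpenBilliard K) {j : ℤ} {i : Fin u}
    (hj : p j ∈ K i) : 0 ≤ ⟪unitDir (p j) (p (j + 1)), outerNormal (K i) (p j)⟫_ℝ := by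
  by_contra! hneg
  rw [real_inner_comm] at hneg
  have h1 := (hK.body i).eventually_mem (h.mem_frontier hK hj) hneg
  have hpos : 0 < ‖p (j + 1) - p j‖ := norm_pos_iff.2 (sub_ne_zero.2 (h.ne_succ hK j).symm)
  obtain ⟨t, ht, ht0, ht1⟩ := (h1.and (Ioo_mem_nhdsGT hpos)).exists
  refine Set.disjoint_left.1 (h.free_flight j) ?_ (mem_iUnion.2 ⟨i, ht⟩)
  rw [openSegment_eq_image']
  refine ⟨t / ‖p (j + 1) - p j‖, ⟨by positivity, by rwa [div_lt_one hpos]⟩, ?_⟩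
  simp only [unitDir, smul_smul, div_eq_mul_inv]

lemma mem_reflectionPoints (h : IsOrbit K p) (hK : IsOpenBilliard K) {j : ℤ} {i : Fin u}
    (hj : p j ∈ K i) : p j ∈ reflectionPoints K i := by
  refine ⟨hj, (p j, unitDir (p j) (p (j + 1))), ⟨⟨fun k => p (k + j), h.shift j, ⟨0, by simp, ?_⟩,
    ?_⟩, i, h.mem_frontier hK hj⟩, rfl⟩
  · simp
  · simp [add_comm]

end IsOrbit

/-- Orbits leave the obstacles at angles to the tangent plane that are bounded from below. -/
lemma IsOpenBilliard.exists_le_inner_dir (hK : IsOpenBilliard K) :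
    ∃ c > 0, ∀ p, IsOrbit K p → ∀ j i, p j ∈ K i →
      c ≤ ⟪unitDir (p j) (p (j + 1)), outerNormal (K i) (p j)⟫_ℝ := by
  obtain ⟨R, hR, hb⟩ := hK.exists_norm_le
  obtain ⟨e, he, hecl⟩ := hK.exists_le_norm_sub
  refine ⟨e / (4 * R), by positivity, fun p hp j i hj => ?_⟩
  obtain ⟨a, ha⟩ := hp.exists_mem hK (j - 1)
  obtain ⟨b, hb'⟩ := hp.exists_mem hK (j + 1)
  have hai : i ≠ a := (hp.index_ne hK ha (by simpa using hj)).symm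
  have hbi : i ≠ b := hp.index_ne hK hj hb'
  have hne := hp.ne_succ hK j
  have hne' : p (j - 1) ≠ p j := by simpa using hp.ne_succ hK (j - 1)
  have hc := hp.inner_dir_nonneg hK hj
  obtain ⟨h1, -⟩ := hp.reflect hK hj
  have hn := (hK.body i).norm_outerNormal (hp.mem_frontier hK hj)
  set c := ⟪unitDir (p j) (p (j + 1)), outerNormal (K i) (p j)⟫_ℝ
  set τ := ‖p (j + 1) - p j‖ with hτ
  set σ := ‖p j - p (j - 1)‖ with hσ
  have hτ0 : 0 < τ := norm_pos_iff.2 (sub_ne_zero.2 hne.symm)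
  have hσ0 : 0 < σ := norm_pos_iff.2 (sub_ne_zero.2 hne'.symm)
  -- the chord from `p (j - 1)` to `p (j + 1)` passes `p j` at distance proportional to `c`
  have hx : (τ / (τ + σ)) • p (j - 1) + (σ / (τ + σ)) • p (j + 1)
      ∈ segment ℝ (p (j - 1)) (p (j + 1)) :=
    ⟨_, _, by positivity, by positivity, by field_simp, rfl⟩
  have h2 := hecl a b i hai hbi _ ha _ hb' _ hx _ hj
  have h3 : (τ / (τ + σ)) • p (j - 1) + (σ / (τ + σ)) • p (j + 1) - p j
      = (τ * σ / (τ + σ) * (2 * c)) • outerNormal (K i) (p j) := by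
    have e1 : τ • unitDir (p j) (p (j + 1)) = p (j + 1) - p j := norm_smul_unitDir _ _
    have e2 : σ • unitDir (p (j - 1)) (p j) = p j - p (j - 1) := norm_smul_unitDir _ _
    have e3 : (2 * c) • outerNormal (K i) (p j)
        = unitDir (p j) (p (j + 1)) - unitDir (p (j - 1)) (p j) := by
      rw [eq_sub_iff_add_eq, add_comm]; exact h1.symm
    rw [mul_smul, e3, smul_sub]
    have e4 : (τ * σ / (τ + σ)) • unitDir (p j) (p (j + 1)) = (σ / (τ + σ)) • (p (j + 1) - p j) := by
      rw [← e1, smul_smul]; congr 1; ring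
    have e5 : (τ * σ / (τ + σ)) • unitDir (p (j - 1)) (p j) = (τ / (τ + σ)) • (p j - p (j - 1)) := by
      rw [← e2, smul_smul]; congr 1; ring
    have e6 : p j = (τ / (τ + σ)) • p j + (σ / (τ + σ)) • p j := by
      rw [← add_smul, ← add_div, div_self (by positivity), one_smul]
    rw [e4, e5, smul_sub, smul_sub]
    nth_rw 1 [e6]
    abel
  rw [h3, norm_smul, hn, mul_one, Real.norm_eq_abs, abs_of_nonneg (by positivity)] at h2
  have h4 : τ * σ / (τ + σ) ≤ 2 * R := by
    have h5 : τ ≤ 2 * R := by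
      have := norm_sub_le (p (j + 1)) (p j)
      linarith [hb _ _ hj, hb _ _ hb']
    rw [div_le_iff₀ (by positivity)]
    nlinarith
  rw [div_le_iff₀ (by positivity)]
  calc e ≤ τ * σ / (τ + σ) * (2 * c) := h2
    _ ≤ 2 * R * (2 * c) := by gcongr
    _ = c * (4 * R) := by ring

end OpenBilliard

namespace OpenBilliard

/-! ### Periodic orbits -/

variable {D u : ℕ} {K : Fin u → Set (Space D)}

/-- Moving one vertex of a closed polygon of minimal length inside its obstacle does not shorten the
two edges at this vertex. -/
lemma minimal_polygon_vertex {N : ℕ} [NeZero N] (hN : (1 : ZMod N) ≠ 0) {α : ZMod N → Fin u}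
    {p : ZMod N → Space D} (hp : ∀ j, p j ∈ K (α j))
    (hmin : ∀ q : ZMod N → Space D, (∀ j, q j ∈ K (α j)) →
      ∑ j, ‖p (j + 1) - p j‖ ≤ ∑ j, ‖q (j + 1) - q j‖) (j : ZMod N) {x : Space D}
    (hx : x ∈ K (α j)) :
    ‖p j - p (j - 1)‖ + ‖p (j + 1) - p j‖ ≤ ‖x - p (j - 1)‖ + ‖p (j + 1) - x‖ := by
  classical
  have h1 := hmin (Function.update p j x) (fun i => by
    rcases eq_or_ne i j with rfl | h
    · simpa using hx
    · simpa [h] using hp i)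
  rw [← sub_nonneg, ← Finset.sum_sub_distrib, Finset.sum_eq_add (j - 1) j] at h1
  · have e1 : j - 1 ≠ j := by simpa using hN
    have e2 : j + 1 ≠ j := by simpa using hN
    simp only [sub_add_cancel, Function.update_self, Function.update_of_ne e1,
      Function.update_of_ne e2] at h1
    linarith
  · simpa using hN
  · rintro i - ⟨h2, h3⟩
    have h4 : i + 1 ≠ j := fun h => h2 (by rw [← h, add_sub_cancel_right])
    rw [Function.update_of_ne h3, Function.update_of_ne h4, sub_self]
  · simp
  · simp

/-- Every cyclic code without repetitions of neighbours is realized by a periodic orbit: a closed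
polygon of minimal length with vertices in the prescribed obstacles. -/
theorem IsOpenBilliard.exists_periodic_orbit (hK : IsOpenBilliard K) {N : ℕ} [NeZero N]
    (α : ZMod N → Fin u) (hα : ∀ j, α j ≠ α (j + 1)) :
    ∃ p : ZMod N → Space D, IsOrbit K (fun j : ℤ => p j) ∧ ∀ j, p j ∈ K (α j) := by
  have hN : (1 : ZMod N) ≠ 0 := by
    intro h
    exact hα 0 (by rw [h, add_zero])
  obtain ⟨e, he, hecl⟩ := hK.exists_le_norm_sub
  have hcomp : IsCompact (Set.univ.pi fun j => K (α j)) := isCompact_univ_pi fun j => hK.compact _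
  obtain ⟨p, hpmem, hpmin⟩ := hcomp.exists_isMinOn
    (f := fun q : ZMod N → Space D => ∑ j, ‖q (j + 1) - q j‖)
    (univ_pi_nonempty_iff.2 fun j => hK.nonempty _) (by fun_prop)
  have hp : ∀ j, p j ∈ K (α j) := fun j => hpmem j (mem_univ j)
  have hmin : ∀ q : ZMod N → Space D, (∀ j, q j ∈ K (α j)) →
      ∑ j, ‖p (j + 1) - p j‖ ≤ ∑ j, ‖q (j + 1) - q j‖ := fun q hq => hpmin fun j _ => hq j
  have hα' : ∀ j, α j ≠ α (j - 1) := fun j => by simpa using (hα (j - 1)).symm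
  have hne : ∀ j, p j ≠ p (j + 1) := fun j h =>
    hα j (hK.index_unique (hp j) (h ▸ hp (j + 1)))
  have hne' : ∀ j, p (j - 1) ≠ p j := fun j => by simpa using hne (j - 1)
  have hvar : ∀ j, ∀ x ∈ K (α j),
      ⟪unitDir (p j) (p (j + 1)) - unitDir (p (j - 1)) (p j), x - p j⟫_ℝ ≤ 0 := fun j x hx =>
    inner_unitDir_sub_nonpos (hK.strictConvex _).convex (hp j) (hne' j).symm (hne j)
      (fun y hy => minimal_polygon_vertex hN hp hmin j hy) hx
  -- the vertices do not lie on the chord between their neighbours, so the velocity changes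
  have hg : ∀ j, unitDir (p j) (p (j + 1)) - unitDir (p (j - 1)) (p j) ≠ 0 := by
    intro j h0
    have hτ : 0 < ‖p (j + 1) - p j‖ := norm_pos_iff.2 (sub_ne_zero.2 (hne j).symm)
    have hσ : 0 < ‖p j - p (j - 1)‖ := norm_pos_iff.2 (sub_ne_zero.2 (hne' j).symm)
    have h1 : p j ∈ segment ℝ (p (j - 1)) (p (j + 1)) := by
      rw [mem_segment_iff_sameRay, ← norm_smul_unitDir (p (j - 1)) (p j),
        ← norm_smul_unitDir (p j) (p (j + 1)), sub_eq_zero.1 h0]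
      exact (SameRay.sameRay_nonneg_smul_left _ hσ.le).nonneg_smul_right hτ.le
    have := hecl _ _ _ (hα' j) (hα j) _ (hp (j - 1)) _ (hp (j + 1)) _ h1 _ (hp j)
    rw [sub_self, norm_zero] at this
    linarith
  have hnormal : ∀ j, p j ∈ frontier (K (α j)) ∧
      unitDir (p j) (p (j + 1)) - unitDir (p (j - 1)) (p j) =
        ‖unitDir (p j) (p (j + 1)) - unitDir (p (j - 1)) (p j)‖ •
          outerNormal (K (α j)) (p j) := by
    intro j
    have hv := hvar j
    have hg0 := hg j
    set g := unitDir (p j) (p (j + 1)) - unitDir (p (j - 1)) (p j) with hgdef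
    have hgp : 0 < ‖g‖ := norm_pos_iff.2 hg0
    have hf : p j ∈ frontier (K (α j)) := by
      rw [(hK.compact _).isClosed.frontier_eq]
      refine ⟨hp j, fun hint => ?_⟩
      have h1 : ∀ᶠ t in 𝓝[>] (0 : ℝ), p j + t • g ∈ K (α j) :=
        (IsDefiningFunction.tendsto_ray (p j) g).eventually (mem_interior_iff_mem_nhds.1 hint)
      obtain ⟨t, ht, ht0⟩ := (h1.and self_mem_nhdsWithin).exists
      have ht0' : (0 : ℝ) < t := ht0
      have h2 := hv _ ht
      rw [add_sub_cancel_left, real_inner_smul_right, real_inner_self_eq_norm_sq] at h2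
      have : 0 < t * ‖g‖ ^ 2 := by positivity
      linarith
    refine ⟨hf, ?_⟩
    have hn : IsOuterNormal (K (α j)) (p j) (‖g‖⁻¹ • g) := by
      refine ⟨norm_smul_inv_norm hg0, fun y hy => ?_⟩
      rw [real_inner_smul_left]
      exact mul_nonpos_of_nonneg_of_nonpos (by positivity) (hv y hy)
    rw [← (hK.body _).eq_outerNormal hf hn, smul_smul, mul_inv_cancel₀ hgp.ne', one_smul]
  have hrefl : ∀ j, unitDir (p j) (p (j + 1)) = unitDir (p (j - 1)) (p j)
      - (2 * ⟪unitDir (p (j - 1)) (p j), outerNormal (K (α j)) (p j)⟫_ℝ) •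
        outerNormal (K (α j)) (p j) ∧
      0 < ⟪unitDir (p j) (p (j + 1)), outerNormal (K (α j)) (p j)⟫_ℝ ∧
      ⟪unitDir (p (j - 1)) (p j), outerNormal (K (α j)) (p j)⟫_ℝ < 0 := by
    intro j
    obtain ⟨hf, hn⟩ := hnormal j
    have hn1 := (hK.body _).norm_outerNormal hf
    have hv1 := norm_unitDir (hne j)
    have hw1 := norm_unitDir (hne' j)
    have hgp := norm_pos_iff.2 (hg j)
    set v := unitDir (p j) (p (j + 1))
    set w := unitDir (p (j - 1)) (p j)
    set n := outerNormal (K (α j)) (p j)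
    set r := ‖v - w‖
    have hv : v = w + r • n := by rw [← hn]; abel
    have hnn : ⟪n, n⟫_ℝ = 1 := by rw [real_inner_self_eq_norm_sq, hn1]; norm_num
    have h1 : r = -2 * ⟪w, n⟫_ℝ := by
      have h2 : ‖v‖ ^ 2 = ‖w‖ ^ 2 + 2 * ⟪w, r • n⟫_ℝ + ‖r • n‖ ^ 2 := by
        rw [hv, norm_add_sq_real]
      rw [hv1, hw1, real_inner_smul_right, norm_smul, hn1, mul_one, Real.norm_eq_abs, sq_abs] at h2
      have h3 : r * (r + 2 * ⟪w, n⟫_ℝ) = 0 := by linarith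
      have := (mul_eq_zero.1 h3).resolve_left hgp.ne'
      linarith
    refine ⟨?_, ?_, by linarith⟩
    · rw [hv, h1, neg_mul, neg_smul, sub_eq_add_neg]
    · rw [hv, inner_add_left, real_inner_smul_left, hnn]; linarith
  have hcast : ∀ j : ℤ, ((j + 1 : ℤ) : ZMod N) = (j : ZMod N) + 1 ∧
      ((j - 1 : ℤ) : ZMod N) = (j : ZMod N) - 1 := fun j => by push_cast; exact ⟨rfl, rfl⟩
  refine ⟨p, ⟨fun j => ⟨α j, (hnormal j).1⟩, fun j => ?_, fun j i hi => ?_⟩, hp⟩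
  · simp only [hcast]
    generalize (j : ZMod N) = j
    rw [Set.disjoint_left]
    intro x hx hxK
    obtain ⟨k, hk⟩ := mem_iUnion.1 hxK
    have hdir : ∃ s t : ℝ, 0 < s ∧ 0 < t ∧ x - p j = s • unitDir (p j) (p (j + 1)) ∧
        x - p (j + 1) = -(t • unitDir (p j) (p (j + 1))) := by
      have hτ : 0 < ‖p (j + 1) - p j‖ := norm_pos_iff.2 (sub_ne_zero.2 (hne j).symm)
      obtain ⟨a, b, ha, hb, hab, rfl⟩ := hx
      refine ⟨b * ‖p (j + 1) - p j‖, a * ‖p (j + 1) - p j‖, by positivity, by positivity, ?_, ?_⟩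
      · rw [mul_smul, norm_smul_unitDir]
        obtain rfl : a = 1 - b := by linarith
        module
      · rw [mul_smul, norm_smul_unitDir]
        obtain rfl : b = 1 - a := by linarith
        module
    obtain ⟨s, t, hs, ht, hxs, hxt⟩ := hdir
    by_cases h1 : k = α j
    · subst h1
      have h2 := ((hK.body _).isOuterNormal_outerNormal (hnormal j).1).2 x hk
      rw [hxs, real_inner_smul_right, real_inner_comm] at h2
      have := mul_pos hs (hrefl j).2.1
      linarith
    by_cases h2 : k = α (j + 1)
    · subst h2
      have h3 := ((hK.body _).isOuterNormal_outerNormal (hnormal (j + 1)).1).2 x hk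
      have h4 := (hrefl (j + 1)).2.2
      rw [add_sub_cancel_right] at h4
      rw [hxt, inner_neg_right, real_inner_smul_right, real_inner_comm] at h3
      have := mul_neg_of_pos_of_neg ht h4
      linarith
    · have := hecl _ _ _ h1 h2 _ (hp j) _ (hp (j + 1)) x (openSegment_subset_segment _ _ _ hx) x hk
      rw [sub_self, norm_zero] at this
      linarith
  · obtain rfl := hK.index_unique hi (hp j)
    simp only [hcast]
    exact (hrefl j).1

end OpenBilliard

namespace OpenBilliard

/-! ### The geometry of two neighbouring rays -/

section TwoRays

variable {E : Type*} [NormedAddCommGroup E] [InnerProductSpace ℝ E]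

/-- The component of `d` orthogonal to `m`. For two rays with unit directions `v` and `w`, whose
base points differ by `d`, it is taken with `m = v + w`; then free flight acts on it exactly as in
the linearized dynamics, see `transv_flight`. -/
noncomputable def transv (m d : E) : E := d - (⟪d, m⟫_ℝ / ‖m‖ ^ 2) • m

lemma inner_add_sub_of_norm_eq {v w : E} (h : ‖v‖ = ‖w‖) : ⟪v + w, v - w⟫_ℝ = 0 := by
  rw [inner_sub_right, inner_add_left, inner_add_left, real_inner_self_eq_norm_sq,
    real_inner_self_eq_norm_sq, real_inner_comm, h]
  ring

lemma inner_transv {m η : E} (d : E) (h : ⟪m, η⟫_ℝ = 0) : ⟪transv m d, η⟫_ℝ = ⟪d, η⟫_ℝ := by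
  rw [transv, inner_sub_left, real_inner_smul_left, h, mul_zero, sub_zero]

lemma norm_transv_sq (m d : E) : ‖transv m d‖ ^ 2 = ‖d‖ ^ 2 - ⟪d, m⟫_ℝ ^ 2 / ‖m‖ ^ 2 := by
  rcases eq_or_ne m 0 with rfl | hm
  · simp [transv]
  have : ‖m‖ ≠ 0 := norm_ne_zero_iff.2 hm
  rw [transv, norm_sub_sq_real, real_inner_smul_right, norm_smul, mul_pow, Real.norm_eq_abs, sq_abs]
  field_simp
  ring

lemma norm_transv_le (m d : E) : ‖transv m d‖ ≤ ‖d‖ := by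
  refine le_of_sq_le_sq ?_ (norm_nonneg _)
  rw [norm_transv_sq]
  have : 0 ≤ ⟪d, m⟫_ℝ ^ 2 / ‖m‖ ^ 2 := by positivity
  linarith

lemma transv_neg (m d : E) : transv (-m) d = transv m d := by
  simp [transv, neg_div]

lemma norm_add_sq_of_unit {v w : E} (hv : ‖v‖ = 1) (hw : ‖w‖ = 1) :
    ‖v + w‖ ^ 2 = 4 - ‖v - w‖ ^ 2 := by
  rw [norm_add_sq_real, norm_sub_sq_real, hv, hw]; ring

lemma norm_transv_neg (m d : E) : ‖transv m (-d)‖ = ‖transv m d‖ := by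
  rw [← norm_neg, transv, transv, inner_neg_left]
  congr 1
  module

/-- Free flight along two rays, of lengths `τ` and `σ`. -/
lemma transv_flight {v w : E} (h : ‖v‖ = ‖w‖) (d : E) (τ σ : ℝ) :
    transv (v + w) (d + τ • v - σ • w) = transv (v + w) d + ((τ + σ) / 2) • (v - w) := by
  have e : d + τ • v - σ • w = d + ((τ + σ) / 2) • (v - w) + ((τ - σ) / 2) • (v + w) := by module
  rcases eq_or_ne (v + w) 0 with h0 | h0
  · rw [e, h0, transv, transv]; simp
  have h1 : ‖v + w‖ ≠ 0 := norm_ne_zero_iff.2 h0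
  have h2 : ⟪v - w, v + w⟫_ℝ = 0 := by rw [real_inner_comm]; exact inner_add_sub_of_norm_eq h
  have h3 : ⟪d + ((τ + σ) / 2) • (v - w) + ((τ - σ) / 2) • (v + w), v + w⟫_ℝ / ‖v + w‖ ^ 2
      = ⟪d, v + w⟫_ℝ / ‖v + w‖ ^ 2 + (τ - σ) / 2 := by
    rw [inner_add_left, inner_add_left, real_inner_smul_left, real_inner_smul_left, h2,
      real_inner_self_eq_norm_sq]
    field_simp
    ring
  rw [e, transv, transv, h3]
  module

lemma inner_flight {v w : E} (hv : ‖v‖ = 1) (hw : ‖w‖ = 1) (d : E) (τ σ : ℝ) :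
    ⟪d + τ • v - σ • w, v - w⟫_ℝ = ⟪d, v - w⟫_ℝ + (τ + σ) / 2 * ‖v - w‖ ^ 2 := by
  rw [norm_sub_sq_real, hv, hw]
  simp only [inner_add_left, inner_sub_left, inner_sub_right, real_inner_smul_left,
    real_inner_self_eq_norm_sq, hv, hw, real_inner_comm v w]
  ring

/-- Free flight, lower curvature bound: a front of curvature at least `k` has curvature at least
`k / (1 + θ k)` afterwards, and has expanded at least by the factor `1 + θ k`. -/
lemma flight_lower {ξ η : E} {θ k : ℝ} (hθ : 0 ≤ θ) (hk : 0 ≤ k)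
    (h : k * ‖ξ‖ ^ 2 ≤ ⟪ξ, η⟫_ℝ) :
    (1 + θ * k) * ‖ξ‖ ≤ ‖ξ + θ • η‖ ∧
      k / (1 + θ * k) * ‖ξ + θ • η‖ ^ 2 ≤ ⟪ξ + θ • η, η⟫_ℝ := by
  have hcs : ⟪ξ, η⟫_ℝ ≤ ‖ξ‖ * ‖η‖ := real_inner_le_norm _ _
  have hsq : ‖ξ + θ • η‖ ^ 2 = ‖ξ‖ ^ 2 + 2 * θ * ⟪ξ, η⟫_ℝ + θ ^ 2 * ‖η‖ ^ 2 := by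
    rw [norm_add_sq_real, real_inner_smul_right, norm_smul, mul_pow, Real.norm_eq_abs, sq_abs]
    ring
  have hin : ⟪ξ + θ • η, η⟫_ℝ = ⟪ξ, η⟫_ℝ + θ * ‖η‖ ^ 2 := by
    rw [inner_add_left, real_inner_smul_left, real_inner_self_eq_norm_sq]
  have h1 : k * ‖ξ‖ ≤ ‖η‖ := by
    rcases (norm_nonneg ξ).eq_or_lt with h0 | h0
    · rw [← h0, mul_zero]; exact norm_nonneg _
    · exact le_of_mul_le_mul_right (by nlinarith) h0
  have h2 : k * ⟪ξ, η⟫_ℝ ≤ ‖η‖ ^ 2 := by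
    nlinarith [mul_le_mul_of_nonneg_left hcs hk, mul_le_mul_of_nonneg_right h1 (norm_nonneg η)]
  have hpos : 0 < 1 + θ * k := by positivity
  constructor
  · refine le_of_sq_le_sq ?_ (norm_nonneg _)
    rw [hsq, mul_pow]
    have h3 : (k * ‖ξ‖) ^ 2 ≤ ‖η‖ ^ 2 := pow_le_pow_left₀ (by positivity) h1 2
    nlinarith [mul_le_mul_of_nonneg_left h hθ, mul_le_mul_of_nonneg_left h3 (sq_nonneg θ)]
  · rw [div_mul_eq_mul_div, div_le_iff₀ hpos, hsq, hin]
    nlinarith [mul_le_mul_of_nonneg_left h2 hθ]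

/-- Free flight, upper curvature bound. The condition `‖η‖² ≤ k ⟪ξ, η⟫` replaces `B ≤ k` for a
positive symmetric operator with `η = B ξ`. -/
lemma flight_upper {ξ η : E} {θ k : ℝ} (hθ : 0 ≤ θ) (hk : 0 ≤ k)
    (h : ‖η‖ ^ 2 ≤ k * ⟪ξ, η⟫_ℝ) :
    ‖ξ + θ • η‖ ≤ (1 + θ * k) * ‖ξ‖ ∧ ‖η‖ ^ 2 ≤ k / (1 + θ * k) * ⟪ξ + θ • η, η⟫_ℝ := by
  have hcs : ⟪ξ, η⟫_ℝ ≤ ‖ξ‖ * ‖η‖ := real_inner_le_norm _ _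
  have hin : ⟪ξ + θ • η, η⟫_ℝ = ⟪ξ, η⟫_ℝ + θ * ‖η‖ ^ 2 := by
    rw [inner_add_left, real_inner_smul_left, real_inner_self_eq_norm_sq]
  have h1 : ‖η‖ ≤ k * ‖ξ‖ := by
    rcases (norm_nonneg η).eq_or_lt with h0 | h0
    · rw [← h0]; positivity
    · refine le_of_mul_le_mul_right ?_ h0
      nlinarith [mul_le_mul_of_nonneg_left hcs hk]
  have hpos : 0 < 1 + θ * k := by positivity
  constructor
  · calc ‖ξ + θ • η‖ ≤ ‖ξ‖ + ‖θ • η‖ := norm_add_le _ _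
      _ = ‖ξ‖ + θ * ‖η‖ := by rw [norm_smul, Real.norm_eq_abs, abs_of_nonneg hθ]
      _ ≤ ‖ξ‖ + θ * (k * ‖ξ‖) := by gcongr
      _ = _ := by ring
  · rw [div_mul_eq_mul_div, le_div_iff₀ hpos, hin]
    nlinarith

/-- Bessel's inequality for two orthogonal vectors, cleared of denominators. -/
lemma inner_sq_mul_add_le {a b : E} (hab : ⟪a, b⟫_ℝ = 0) (w : E) :
    ⟪w, a⟫_ℝ ^ 2 * ‖b‖ ^ 2 + ⟪w, b⟫_ℝ ^ 2 * ‖a‖ ^ 2 ≤ ‖a‖ ^ 2 * ‖b‖ ^ 2 * ‖w‖ ^ 2 := by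
  rcases eq_or_ne a 0 with rfl | ha
  · simp
  rcases eq_or_ne b 0 with rfl | hb
  · simp
  have hP : 0 < ‖a‖ ^ 2 * ‖b‖ ^ 2 := by positivity
  have hy := sq_nonneg ‖(‖a‖ ^ 2 * ‖b‖ ^ 2) • w - (⟪w, a⟫_ℝ * ‖b‖ ^ 2) • a
    - (⟪w, b⟫_ℝ * ‖a‖ ^ 2) • b‖
  rw [← real_inner_self_eq_norm_sq] at hy
  simp only [inner_sub_left, inner_sub_right, real_inner_smul_left, real_inner_smul_right,
    hab, real_inner_comm w a, real_inner_comm w b, real_inner_comm a b] at hy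
  simp only [real_inner_self_eq_norm_sq] at hy
  have h2 : 0 ≤ (‖a‖ ^ 2 * ‖b‖ ^ 2) * (‖a‖ ^ 2 * ‖b‖ ^ 2 * ‖w‖ ^ 2
      - (⟪w, a⟫_ℝ ^ 2 * ‖b‖ ^ 2 + ⟪w, b⟫_ℝ ^ 2 * ‖a‖ ^ 2)) := by
    refine hy.trans_eq ?_
    ring
  have := (mul_nonneg_iff_of_pos_left hP).1 h2
  linarith

/-- Two reflections differ at most by twice the distance of the unit normals. -/
lemma norm_proj_sub_proj_le {n m : E} (hn : ‖n‖ = 1) (hm : ‖m‖ = 1) (w : E) :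
    ‖⟪w, n⟫_ℝ • n - ⟪w, m⟫_ℝ • m‖ ≤ ‖n - m‖ * ‖w‖ := by
  have hab : ⟪n - m, n + m⟫_ℝ = 0 := by
    rw [real_inner_comm]; exact inner_add_sub_of_norm_eq (hn.trans hm.symm)
  have h := inner_sq_mul_add_le hab w
  have hb : ‖n + m‖ ^ 2 ≤ 4 := by
    rw [norm_add_sq_of_unit hn hm]; nlinarith [sq_nonneg ‖n - m‖]
  have e : ⟪w, n⟫_ℝ • n - ⟪w, m⟫_ℝ • m
      = (⟪w, n - m⟫_ℝ / 2) • (n + m) + (⟪w, n + m⟫_ℝ / 2) • (n - m) := by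
    rw [inner_sub_right, inner_add_right]; module
  refine le_of_sq_le_sq ?_ (by positivity)
  have hba : ⟪n + m, n - m⟫_ℝ = 0 := inner_add_sub_of_norm_eq (hn.trans hm.symm)
  rw [e, norm_add_sq_real, norm_smul, norm_smul, real_inner_smul_left, real_inner_smul_right, hba]
  simp only [mul_pow, Real.norm_eq_abs, sq_abs]
  nlinarith [mul_le_mul_of_nonneg_right hb (by positivity : 0 ≤ ‖n - m‖ ^ 2 * ‖w‖ ^ 2)]

/-- Two rays with incoming directions `v₀`, `w₀` and outgoing directions `v`, `w` are reflected at
points of one convex body with unit normals `n`, `m`, at angles to the tangent plane bounded from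
below by `c`. The first reflection point minus the second one is `d`. -/
structure IsReflectedPair (c : ℝ) (d v₀ w₀ v w n m : E) : Prop where
  norm_n : ‖n‖ = 1
  norm_m : ‖m‖ = 1
  norm_v₀ : ‖v₀‖ = 1
  norm_w₀ : ‖w₀‖ = 1
  norm_v : ‖v‖ = 1
  norm_w : ‖w‖ = 1
  eq_v : v = v₀ + (2 * ⟪v, n⟫_ℝ) • n
  eq_w : w = w₀ + (2 * ⟪w, m⟫_ℝ) • m
  inner_v₀ : ⟪v₀, n⟫_ℝ = -⟪v, n⟫_ℝ
  inner_w₀ : ⟪w₀, m⟫_ℝ = -⟪w, m⟫_ℝ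
  le_v : c ≤ ⟪v, n⟫_ℝ
  le_w : c ≤ ⟪w, m⟫_ℝ
  inner_n : 0 ≤ ⟪n, d⟫_ℝ
  inner_m : ⟪m, d⟫_ℝ ≤ 0

namespace IsReflectedPair

variable {c : ℝ} {d v₀ w₀ v w n m : E}

lemma inner_eq (h : IsReflectedPair c d v₀ w₀ v w n m) :
    ⟪d, v - w⟫_ℝ = ⟪d, v₀ - w₀⟫_ℝ + (2 * ⟪v, n⟫_ℝ * ⟪n, d⟫_ℝ - 2 * ⟪w, m⟫_ℝ * ⟪m, d⟫_ℝ) := by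
  have h1 : ⟪d, v⟫_ℝ = ⟪d, v₀⟫_ℝ + 2 * ⟪v, n⟫_ℝ * ⟪n, d⟫_ℝ := by
    conv_lhs => rw [h.eq_v]
    rw [inner_add_right, real_inner_smul_right, real_inner_comm d n]
  have h2 : ⟪d, w⟫_ℝ = ⟪d, w₀⟫_ℝ + 2 * ⟪w, m⟫_ℝ * ⟪m, d⟫_ℝ := by
    conv_lhs => rw [h.eq_w]
    rw [inner_add_right, real_inner_smul_right, real_inner_comm d m]
  rw [inner_sub_right, inner_sub_right, h1, h2]
  ring

lemma norm_sub_le (h : IsReflectedPair c d v₀ w₀ v w n m) :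
    ‖v - w‖ ≤ ‖v₀ - w₀‖ + 2 * ‖n - m‖ := by
  have hv : v = v₀ - (2 * ⟪v₀, n⟫_ℝ) • n := by
    rw [h.inner_v₀, mul_neg, neg_smul, sub_neg_eq_add]; exact h.eq_v
  have hw : w = w₀ - (2 * ⟪w₀, m⟫_ℝ) • m := by
    rw [h.inner_w₀, mul_neg, neg_smul, sub_neg_eq_add]; exact h.eq_w
  have e : v - w = ((v₀ - w₀) - (2 * ⟪v₀ - w₀, n⟫_ℝ) • n)
      - (2 : ℝ) • (⟪w₀, n⟫_ℝ • n - ⟪w₀, m⟫_ℝ • m) := by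
    rw [inner_sub_left]
    nth_rw 1 [hv, hw]
    module
  have h1 : ‖(v₀ - w₀) - (2 * ⟪v₀ - w₀, n⟫_ℝ) • n‖ = ‖v₀ - w₀‖ := by
    rw [← sq_eq_sq₀ (norm_nonneg _) (norm_nonneg _), norm_sub_sq_real, real_inner_smul_right,
      norm_smul, h.norm_n, mul_one, Real.norm_eq_abs, sq_abs]
    ring
  have h2 := norm_proj_sub_proj_le h.norm_n h.norm_m w₀
  rw [h.norm_w₀, mul_one] at h2
  have h3 : ‖v - w‖ ≤ ‖(v₀ - w₀) - (2 * ⟪v₀ - w₀, n⟫_ℝ) • n‖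
      + ‖(2 : ℝ) • (⟪w₀, n⟫_ℝ • n - ⟪w₀, m⟫_ℝ • m)‖ := by
    rw [e]
    exact _root_.norm_sub_le _ _
  calc ‖v - w‖ ≤ _ := h3
    _ = ‖v₀ - w₀‖ + 2 * ‖⟪w₀, n⟫_ℝ • n - ⟪w₀, m⟫_ℝ • m‖ := by
      rw [h1, norm_smul]; norm_num
    _ ≤ _ := by gcongr

/-- Reversing the direction of motion. -/
lemma reverse (h : IsReflectedPair c d v₀ w₀ v w n m) :
    IsReflectedPair c d (-v) (-w) (-v₀) (-w₀) n m where
  norm_n := h.norm_n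
  norm_m := h.norm_m
  norm_v₀ := by rw [norm_neg]; exact h.norm_v
  norm_w₀ := by rw [norm_neg]; exact h.norm_w
  norm_v := by rw [norm_neg]; exact h.norm_v₀
  norm_w := by rw [norm_neg]; exact h.norm_w₀
  eq_v := by
    have h1 := h.eq_v
    rw [inner_neg_left, h.inner_v₀, neg_neg]
    generalize ⟪v, n⟫_ℝ = t at h1 ⊢
    rw [h1]
    abel
  eq_w := by
    have h1 := h.eq_w
    rw [inner_neg_left, h.inner_w₀, neg_neg]
    generalize ⟪w, m⟫_ℝ = t at h1 ⊢
    rw [h1]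
    abel
  inner_v₀ := by rw [inner_neg_left, inner_neg_left, h.inner_v₀, neg_neg]
  inner_w₀ := by rw [inner_neg_left, inner_neg_left, h.inner_w₀, neg_neg]
  le_v := by rw [inner_neg_left, h.inner_v₀, neg_neg]; exact h.le_v
  le_w := by rw [inner_neg_left, h.inner_w₀, neg_neg]; exact h.le_w
  inner_n := h.inner_n
  inner_m := h.inner_m

/-- Exchanging the two rays. -/
lemma swap (h : IsReflectedPair c d v₀ w₀ v w n m) :
    IsReflectedPair c (-d) w₀ v₀ w v m n where
  norm_n := h.norm_m
  norm_m := h.norm_n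
  norm_v₀ := h.norm_w₀
  norm_w₀ := h.norm_v₀
  norm_v := h.norm_w
  norm_w := h.norm_v
  eq_v := h.eq_w
  eq_w := h.eq_v
  inner_v₀ := h.inner_w₀
  inner_w₀ := h.inner_v₀
  le_v := h.le_w
  le_w := h.le_v
  inner_n := by rw [inner_neg_right]; linarith [h.inner_m]
  inner_m := by rw [inner_neg_right]; linarith [h.inner_n]

lemma inner_le_one (h : IsReflectedPair c d v₀ w₀ v w n m) : ⟪v, n⟫_ℝ ≤ 1 ∧ ⟪w, m⟫_ℝ ≤ 1 := by
  have h1 := real_inner_le_norm v n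
  have h2 := real_inner_le_norm w m
  rw [h.norm_v, h.norm_n, mul_one] at h1
  rw [h.norm_w, h.norm_m, mul_one] at h2
  exact ⟨h1, h2⟩

/-- Nearly parallel rays that leave a convex body transversally are separated mainly in the
transversal direction. -/
lemma norm_le_transv (h : IsReflectedPair c d v₀ w₀ v w n m) (hc : 0 < c) (hη : ‖v - w‖ ≤ c) :
    ‖d‖ ≤ (1 + 2 / c) * ‖transv (v + w) d‖ := by
  set t := ⟪d, v + w⟫_ℝ / ‖v + w‖ ^ 2 with ht
  set ξ := transv (v + w) d with hξ
  have hd : d = ξ + t • (v + w) := by rw [hξ, transv]; abel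
  have hsum : ‖v + w‖ ≤ 2 := by
    have := norm_add_le v w
    rw [h.norm_v, h.norm_w] at this; linarith
  have hn1 : c ≤ ⟪n, v + w⟫_ℝ := by
    have e : v + w = (2 : ℝ) • v - (v - w) := by module
    have := real_inner_le_norm n (v - w)
    rw [h.norm_n, one_mul] at this
    rw [e, inner_sub_right, real_inner_smul_right, real_inner_comm]
    linarith [h.le_v]
  have hm1 : c ≤ ⟪m, v + w⟫_ℝ := by
    have e : v + w = (2 : ℝ) • w + (v - w) := by module
    have := abs_real_inner_le_norm m (v - w)
    rw [h.norm_m, one_mul] at this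
    rw [e, inner_add_right, real_inner_smul_right, real_inner_comm]
    linarith [h.le_w, (abs_le.1 this).1]
  have h1 := h.inner_n
  have h2 := h.inner_m
  rw [hd, inner_add_right, real_inner_smul_right] at h1 h2
  have h3 := abs_real_inner_le_norm n ξ
  have h4 := abs_real_inner_le_norm m ξ
  rw [h.norm_n, one_mul] at h3
  rw [h.norm_m, one_mul] at h4
  have htc : |t| ≤ ‖ξ‖ / c := by
    rw [le_div_iff₀ hc]
    rcases le_total 0 t with h0 | h0
    · rw [abs_of_nonneg h0]
      nlinarith [mul_le_mul_of_nonneg_left hm1 h0, (abs_le.1 h4).1]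
    · rw [abs_of_nonpos h0]
      nlinarith [mul_le_mul_of_nonneg_left hn1 (neg_nonneg.2 h0), (abs_le.1 h3).2]
  calc ‖d‖ = ‖ξ + t • (v + w)‖ := by rw [← hd]
    _ ≤ ‖ξ‖ + |t| * ‖v + w‖ := by
      refine (norm_add_le _ _).trans ?_
      rw [norm_smul, Real.norm_eq_abs]
    _ ≤ ‖ξ‖ + ‖ξ‖ / c * 2 := by gcongr
    _ = _ := by ring

/-- The same for the incoming rays. -/
lemma norm_le_transv_incoming (h : IsReflectedPair c d v₀ w₀ v w n m) (hc : 0 < c)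
    (hη : ‖v₀ - w₀‖ ≤ c) : ‖d‖ ≤ (1 + 2 / c) * ‖transv (v₀ + w₀) d‖ := by
  have h1 := h.reverse.norm_le_transv hc (by rwa [← neg_sub', norm_neg])
  rwa [← neg_add, transv_neg] at h1

/-- The transversal distance is almost unchanged by the reflection. -/
lemma abs_norm_transv_sub_le (h : IsReflectedPair c d v₀ w₀ v w n m) (hc : 0 < c) {ε : ℝ}
    (hε : ε ≤ 1) (h₀ : ‖v₀ - w₀‖ ≤ ε) (h₁ : ‖v - w‖ ≤ ε) (hnm : ‖n - m‖ ≤ ε) :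
    |‖transv (v + w) d‖ ^ 2 - ‖transv (v₀ + w₀) d‖ ^ 2| ≤ 3 * ε * ‖d‖ ^ 2 := by
  have hε0 : 0 ≤ ε := (norm_nonneg _).trans h₀
  have hp := norm_add_sq_of_unit h.norm_v h.norm_w
  have hq := norm_add_sq_of_unit h.norm_v₀ h.norm_w₀
  have hX : |⟪d, v + w⟫_ℝ| ≤ 2 * ‖d‖ := by
    refine (abs_real_inner_le_norm _ _).trans ?_
    have := norm_add_le v w
    rw [h.norm_v, h.norm_w] at this
    nlinarith [norm_nonneg d]
  have hY : |⟪d, v₀ + w₀⟫_ℝ| ≤ 2 * ‖d‖ := by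
    refine (abs_real_inner_le_norm _ _).trans ?_
    have := norm_add_le v₀ w₀
    rw [h.norm_v₀, h.norm_w₀] at this
    nlinarith [norm_nonneg d]
  have hXY : |⟪d, v + w⟫_ℝ - ⟪d, v₀ + w₀⟫_ℝ| ≤ 2 * ε * ‖d‖ := by
    have e1 : ⟪d, v + w⟫_ℝ - ⟪d, v₀ + w₀⟫_ℝ = 2 * ⟪v, n⟫_ℝ * ⟪n, d⟫_ℝ + 2 * ⟪w, m⟫_ℝ * ⟪m, d⟫_ℝ := by
      have h1 : ⟪d, v⟫_ℝ = ⟪d, v₀⟫_ℝ + 2 * ⟪v, n⟫_ℝ * ⟪n, d⟫_ℝ := by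
        conv_lhs => rw [h.eq_v]
        rw [inner_add_right, real_inner_smul_right, real_inner_comm d n]
      have h2 : ⟪d, w⟫_ℝ = ⟪d, w₀⟫_ℝ + 2 * ⟪w, m⟫_ℝ * ⟪m, d⟫_ℝ := by
        conv_lhs => rw [h.eq_w]
        rw [inner_add_right, real_inner_smul_right, real_inner_comm d m]
      rw [inner_add_right, inner_add_right, h1, h2]; ring
    have e2 : ⟪n, d⟫_ℝ - ⟪m, d⟫_ℝ ≤ ε * ‖d‖ := by
      rw [← inner_sub_left]
      exact (real_inner_le_norm _ _).trans (by gcongr)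
    obtain ⟨h1, h2⟩ := h.inner_le_one
    have h3 := h.inner_n
    have h4 := h.inner_m
    have h5 := hc.le.trans h.le_v
    have h6 := hc.le.trans h.le_w
    rw [e1, abs_le]
    constructor <;> nlinarith [mul_le_mul_of_nonneg_right h1 h3, mul_nonneg h5 h3,
      mul_le_mul_of_nonneg_right h2 (neg_nonneg.2 h4), mul_nonneg h6 (neg_nonneg.2 h4)]
  rw [norm_transv_sq, norm_transv_sq, hp, hq]
  generalize ⟪d, v + w⟫_ℝ = X at *
  generalize ⟪d, v₀ + w₀⟫_ℝ = Y at *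
  have hsq : ∀ {s x : ℝ}, 0 ≤ s → s ≤ ε → |x| ≤ 2 * ‖d‖ →
      x ^ 2 / 4 ≤ x ^ 2 / (4 - s ^ 2) ∧ x ^ 2 / (4 - s ^ 2) ≤ x ^ 2 / 4 + ε * ‖d‖ ^ 2 := by
    intro s x hs0 hs hx
    have h1 : s ^ 2 ≤ ε := by nlinarith
    have h2 : x ^ 2 ≤ 4 * ‖d‖ ^ 2 := by
      rw [← sq_abs]; nlinarith [abs_nonneg x, norm_nonneg d]
    have h3 : 0 < 4 - s ^ 2 := by linarith
    constructor
    · rw [div_le_div_iff₀ (by norm_num) h3]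
      nlinarith [mul_nonneg (sq_nonneg x) (sq_nonneg s)]
    · rw [div_le_iff₀ h3]
      nlinarith [mul_le_mul_of_nonneg_left h1 (sq_nonneg x),
        mul_le_mul_of_nonneg_left h2 hε0, mul_nonneg hε0 (sq_nonneg ‖d‖), sq_nonneg s,
        mul_nonneg (mul_nonneg hε0 (sq_nonneg ‖d‖)) (by linarith : 0 ≤ 1 - s ^ 2)]
  have a1 := hsq (norm_nonneg _) h₁ hX
  have a2 := hsq (norm_nonneg _) h₀ hY
  have a3 : |X ^ 2 - Y ^ 2| ≤ 8 * ε * ‖d‖ ^ 2 := by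
    have : X ^ 2 - Y ^ 2 = (X + Y) * (X - Y) := by ring
    rw [this, abs_mul]
    calc |X + Y| * |X - Y| ≤ (4 * ‖d‖) * (2 * ε * ‖d‖) := by
          gcongr
          exact (abs_add_le _ _).trans (by linarith)
      _ = _ := by ring
  rw [abs_le] at a3 ⊢
  constructor <;> linarith [a1.1, a1.2, a2.1, a2.2, a3.1, a3.2]

/-- Reflection, upper curvature bound: reflection adds at most `2γ` to the curvature, where `γ` is
the curvature of the body divided by the cosine of the collision angle. -/
lemma upper (h : IsReflectedPair c d v₀ w₀ v w n m) (hc : 0 < c) {k κ γ : ℝ} (hk : 0 ≤ k)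
    (hγ : 0 ≤ γ) (hA : 0 ≤ ⟪d, v₀ - w₀⟫_ℝ) (h₀ : ‖v₀ - w₀‖ ^ 2 ≤ k * ⟪d, v₀ - w₀⟫_ℝ)
    (hnm : ‖n - m‖ ^ 2 ≤ κ * ⟪d, n - m⟫_ℝ) (hv : κ ≤ γ * ⟪v, n⟫_ℝ) (hw : κ ≤ γ * ⟪w, m⟫_ℝ) :
    ‖v - w‖ ^ 2 ≤ (k + 2 * γ) * ⟪d, v - w⟫_ℝ := by
  rw [h.inner_eq]
  set y := 2 * ⟪v, n⟫_ℝ * ⟪n, d⟫_ℝ - 2 * ⟪w, m⟫_ℝ * ⟪m, d⟫_ℝ with hy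
  have h3 := h.inner_n
  have h4 := h.inner_m
  have hy0 : 0 ≤ y := by
    have h5 := mul_nonneg (hc.le.trans h.le_v) h3
    have h6 := mul_nonneg (hc.le.trans h.le_w) (neg_nonneg.2 h4)
    nlinarith
  have hb : (2 * ‖n - m‖) ^ 2 ≤ 2 * γ * y := by
    have e : ⟪d, n - m⟫_ℝ = ⟪n, d⟫_ℝ - ⟪m, d⟫_ℝ := by
      rw [inner_sub_right, real_inner_comm, real_inner_comm d m]
    rw [e] at hnm
    nlinarith [mul_le_mul_of_nonneg_right hv h3,
      mul_le_mul_of_nonneg_right hw (neg_nonneg.2 h4)]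
  have hle := h.norm_sub_le
  set a := ‖v₀ - w₀‖
  set b := 2 * ‖n - m‖ with hb_def
  set x := ⟪d, v₀ - w₀⟫_ℝ
  have ha0 : 0 ≤ a := norm_nonneg _
  have hb0 : 0 ≤ b := by positivity
  have hcross : 2 * (a * b) ≤ k * y + 2 * γ * x := by
    refine le_of_sq_le_sq ?_ (by positivity)
    have h7 : a ^ 2 * b ^ 2 ≤ (k * x) * (2 * γ * y) :=
      mul_le_mul h₀ hb (by positivity) (by positivity)
    nlinarith [sq_nonneg (k * y - 2 * γ * x)]
  calc ‖v - w‖ ^ 2 ≤ (a + b) ^ 2 := pow_le_pow_left₀ (norm_nonneg _) hle 2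
    _ ≤ _ := by nlinarith

end IsReflectedPair

end TwoRays

/-- In the plane, the transversal distance of two rays is the distance of the reflection points
times the cosine of the collision angle, up to a small error. -/
lemma IsReflectedPair.norm_transv_sq_le_of_plane {c ε : ℝ} {d v₀ w₀ v w n m : Space 2}
    (h : IsReflectedPair c d v₀ w₀ v w n m) (hε : ε ≤ 1) (h₁ : ‖v - w‖ ≤ ε)
    (hnm : ‖n - m‖ ≤ ε) :
    ‖transv (v + w) d‖ ^ 2 ≤ (⟪v, n⟫_ℝ ^ 2 + 5 * ε) * ‖d‖ ^ 2 := by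
  have hε0 : 0 ≤ ε := (norm_nonneg _).trans h₁
  have hP := norm_add_sq_of_unit h.norm_v h.norm_w
  have hP3 : 4 - ε ≤ ‖v + w‖ ^ 2 := by rw [hP]; nlinarith [norm_nonneg (v - w)]
  have hP4 : ‖v + w‖ ^ 2 ≤ 4 := by rw [hP]; nlinarith [norm_nonneg (v - w)]
  have hgram : ∀ a b n : Space 2, ‖n‖ = 1 → ‖a‖ ^ 2 * ‖b‖ ^ 2 - ⟪a, b⟫_ℝ ^ 2
      = ‖a‖ ^ 2 * ⟪n, b⟫_ℝ ^ 2 + ⟪n, a⟫_ℝ ^ 2 * ‖b‖ ^ 2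
        - 2 * ⟪n, a⟫_ℝ * ⟪a, b⟫_ℝ * ⟪n, b⟫_ℝ := by
    intro a b n hn
    have hn2 : ⟪n, n⟫_ℝ = 1 := by rw [real_inner_self_eq_norm_sq, hn]; norm_num
    rw [← real_inner_self_eq_norm_sq, ← real_inner_self_eq_norm_sq]
    simp only [PiLp.inner_apply, Fin.sum_univ_two, RCLike.inner_apply, conj_trivial] at hn2 ⊢
    linear_combination (-(a 0 * b 1 - a 1 * b 0) ^ 2) * hn2
  have hg := hgram d (v + w) n h.norm_n
  have hξ : ‖transv (v + w) d‖ ^ 2 * ‖v + w‖ ^ 2 = ‖d‖ ^ 2 * ‖v + w‖ ^ 2 - ⟪d, v + w⟫_ℝ ^ 2 := by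
    rw [norm_transv_sq]
    have : ‖v + w‖ ^ 2 ≠ 0 := by nlinarith
    rw [sub_mul, div_mul_cancel₀ _ this]
  have hs : |⟪n, d⟫_ℝ| ≤ ε * ‖d‖ := by
    rw [abs_of_nonneg h.inner_n]
    have : ⟪n - m, d⟫_ℝ ≤ ε * ‖d‖ := (real_inner_le_norm _ _).trans (by gcongr)
    rw [inner_sub_left] at this
    linarith [h.inner_m]
  have hX : |⟪d, v + w⟫_ℝ| ≤ 2 * ‖d‖ := by
    refine (abs_real_inner_le_norm _ _).trans ?_
    have := norm_add_le v w
    rw [h.norm_v, h.norm_w] at this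
    nlinarith [norm_nonneg d]
  have hc1 := abs_real_inner_le_norm v n
  rw [h.norm_v, h.norm_n, mul_one] at hc1
  have hZ : |⟪n, v + w⟫_ℝ - 2 * ⟪v, n⟫_ℝ| ≤ ε := by
    have e : ⟪n, v + w⟫_ℝ - 2 * ⟪v, n⟫_ℝ = -⟪n, v - w⟫_ℝ := by
      rw [inner_add_right, inner_sub_right, real_inner_comm n v]; ring
    rw [e, abs_neg]
    refine (abs_real_inner_le_norm _ _).trans ?_
    rw [h.norm_n, one_mul]; exact h₁
  have hZ2 : |⟪n, v + w⟫_ℝ| ≤ 2 := by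
    refine (abs_real_inner_le_norm _ _).trans ?_
    have := norm_add_le v w
    rw [h.norm_v, h.norm_w] at this
    rw [h.norm_n]; linarith
  have hZsq : ⟪n, v + w⟫_ℝ ^ 2 ≤ 4 * ⟪v, n⟫_ℝ ^ 2 + 4 * ε := by
    have e : ⟪n, v + w⟫_ℝ ^ 2 - 4 * ⟪v, n⟫_ℝ ^ 2
        = (⟪n, v + w⟫_ℝ - 2 * ⟪v, n⟫_ℝ) * (⟪n, v + w⟫_ℝ + 2 * ⟪v, n⟫_ℝ) := by ring
    have h5 : |⟪n, v + w⟫_ℝ + 2 * ⟪v, n⟫_ℝ| ≤ 4 := by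
      rw [abs_le] at hZ2 hc1 ⊢
      constructor <;> linarith [hZ2.1, hZ2.2, hc1.1, hc1.2]
    have h6 : |⟪n, v + w⟫_ℝ ^ 2 - 4 * ⟪v, n⟫_ℝ ^ 2| ≤ ε * 4 := by
      rw [e, abs_mul]; gcongr
    linarith [(abs_le.1 h6).2]
  have hlast : |2 * ⟪n, d⟫_ℝ * ⟪d, v + w⟫_ℝ * ⟪n, v + w⟫_ℝ| ≤ 8 * ε * ‖d‖ ^ 2 := by
    rw [abs_mul, abs_mul, abs_mul, abs_two]
    calc 2 * |⟪n, d⟫_ℝ| * |⟪d, v + w⟫_ℝ| * |⟪n, v + w⟫_ℝ|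
        ≤ 2 * (ε * ‖d‖) * (2 * ‖d‖) * 2 := by gcongr
      _ = _ := by ring
  have hs2 : ⟪n, d⟫_ℝ ^ 2 ≤ ε * ‖d‖ ^ 2 := by
    rw [← sq_abs]
    calc |⟪n, d⟫_ℝ| ^ 2 ≤ (ε * ‖d‖) ^ 2 := pow_le_pow_left₀ (abs_nonneg _) hs 2
      _ = ε * (ε * ‖d‖ ^ 2) := by ring
      _ ≤ 1 * (ε * ‖d‖ ^ 2) := by gcongr
      _ = _ := one_mul _
  have hle := norm_transv_le (v + w) d
  have hle2 : ‖transv (v + w) d‖ ^ 2 ≤ ‖d‖ ^ 2 := pow_le_pow_left₀ (norm_nonneg _) hle 2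
  nlinarith [mul_le_mul_of_nonneg_left hZsq (sq_nonneg ‖d‖), (abs_le.1 hlast).1,
    mul_le_mul_of_nonneg_left hP4 (sq_nonneg ⟪n, d⟫_ℝ),
    mul_le_mul_of_nonneg_left hP3 (sq_nonneg ‖transv (v + w) d‖),
    mul_le_mul_of_nonneg_left hle2 hε0]

end OpenBilliard

namespace OpenBilliard

/-! ### Pairs of orbits: one flight and one reflection -/

variable {D u : ℕ} {K : Fin u → Set (Space D)}

/-- The velocity of an orbit after the `j`-th reflection. -/
noncomputable def outDir (p : ℤ → Space D) (j : ℤ) : Space D := unitDir (p j) (p (j + 1))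

/-- `⟪p j - q j, v - w⟫` with the outgoing velocities `v`, `w` of the two orbits. It is
non-decreasing in time along reflections on common obstacles. -/
noncomputable def divergence (p q : ℤ → Space D) (j : ℤ) : ℝ :=
  ⟪p j - q j, outDir p j - outDir q j⟫_ℝ

/-- The transversal component of `p j - q j` with respect to the outgoing velocities. -/
noncomputable def transvOut (p q : ℤ → Space D) (j : ℤ) : Space D :=
  transv (outDir p j + outDir q j) (p j - q j)

/-- The transversal component of `p (j + 1) - q (j + 1)` with respect to the incoming
velocities. -/
noncomputable def transvIn (p q : ℤ → Space D) (j : ℤ) : Space D :=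
  transv (outDir p j + outDir q j) (p (j + 1) - q (j + 1))

/-- The average length of the flights of two orbits. -/
noncomputable def meanFlight (p q : ℤ → Space D) (j : ℤ) : ℝ :=
  (‖p (j + 1) - p j‖ + ‖q (j + 1) - q j‖) / 2

lemma norm_unitDir_sub_le {a b a' b' : Space D} (h : a ≠ b) (h' : a' ≠ b') :
    ‖unitDir a b - unitDir a' b'‖ ≤ 2 * (‖a - a'‖ + ‖b - b'‖) / ‖b - a‖ := by
  have hx : 0 < ‖b - a‖ := norm_pos_iff.2 (sub_ne_zero.2 h.symm)
  have hd : ‖(b - a) - (b' - a')‖ ≤ ‖a - a'‖ + ‖b - b'‖ := by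
    have e : (b - a) - (b' - a') = (b - b') - (a - a') := by abel
    rw [e, add_comm]; exact norm_sub_le _ _
  have e : unitDir a b - unitDir a' b'
      = ‖b - a‖⁻¹ • ((b - a) - (b' - a') + (‖b' - a'‖ - ‖b - a‖) • unitDir a' b') := by
    have h1 : b - a = ‖b - a‖ • unitDir a b := (norm_smul_unitDir a b).symm
    have h2 : b' - a' = ‖b' - a'‖ • unitDir a' b' := (norm_smul_unitDir a' b').symm
    rw [eq_inv_smul_iff₀ hx.ne', smul_sub, ← h1, sub_smul, ← h2]
    abel
  rw [e, norm_smul, norm_inv, norm_norm, le_div_iff₀ hx, mul_comm, ← mul_assoc,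
    mul_inv_cancel₀ hx.ne', one_mul]
  have h3 : |‖b' - a'‖ - ‖b - a‖| ≤ ‖(b - a) - (b' - a')‖ := by
    rw [abs_sub_comm]; exact abs_norm_sub_norm_le _ _
  calc _ ≤ ‖(b - a) - (b' - a')‖ + ‖(‖b' - a'‖ - ‖b - a‖) • unitDir a' b'‖ := norm_add_le _ _
    _ = ‖(b - a) - (b' - a')‖ + |‖b' - a'‖ - ‖b - a‖| := by
      rw [norm_smul, norm_unitDir h', mul_one, Real.norm_eq_abs]
    _ ≤ _ := by linarith

namespace IsOrbit

variable {p q : ℤ → Space D}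

lemma norm_outDir (h : IsOrbit K p) (hK : IsOpenBilliard K) (j : ℤ) : ‖outDir p j‖ = 1 :=
  h.norm_dir hK j

lemma sub_succ (p q : ℤ → Space D) (j : ℤ) :
    p (j + 1) - q (j + 1) = p j - q j + ‖p (j + 1) - p j‖ • outDir p j
      - ‖q (j + 1) - q j‖ • outDir q j := by
  rw [outDir, outDir, norm_smul_unitDir, norm_smul_unitDir]; abel

lemma transvIn_eq (hp : IsOrbit K p) (hq : IsOrbit K q) (hK : IsOpenBilliard K) (j : ℤ) :
    transvIn p q j = transvOut p q j + meanFlight p q j • (outDir p j - outDir q j) := by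
  rw [transvIn, sub_succ, transv_flight ((hp.norm_outDir hK j).trans (hq.norm_outDir hK j).symm)]
  rfl

lemma inner_transvOut (hp : IsOrbit K p) (hq : IsOrbit K q) (hK : IsOpenBilliard K) (j : ℤ) :
    ⟪transvOut p q j, outDir p j - outDir q j⟫_ℝ = divergence p q j :=
  inner_transv _ (inner_add_sub_of_norm_eq
    ((hp.norm_outDir hK j).trans (hq.norm_outDir hK j).symm))

lemma inner_transvIn (hp : IsOrbit K p) (hq : IsOrbit K q) (hK : IsOpenBilliard K) (j : ℤ) :
    ⟪transvIn p q j, outDir p j - outDir q j⟫_ℝ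
      = ⟪p (j + 1) - q (j + 1), outDir p j - outDir q j⟫_ℝ :=
  inner_transv _ (inner_add_sub_of_norm_eq
    ((hp.norm_outDir hK j).trans (hq.norm_outDir hK j).symm))

lemma inner_succ_eq (hp : IsOrbit K p) (hq : IsOrbit K q) (hK : IsOpenBilliard K) (j : ℤ) :
    ⟪p (j + 1) - q (j + 1), outDir p j - outDir q j⟫_ℝ
      = divergence p q j + meanFlight p q j * ‖outDir p j - outDir q j‖ ^ 2 := by
  rw [sub_succ, inner_flight (hp.norm_outDir hK j) (hq.norm_outDir hK j)]
  rfl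

lemma meanFlight_nonneg (p q : ℤ → Space D) (j : ℤ) : 0 ≤ meanFlight p q j := by
  unfold meanFlight; positivity

lemma divergence_le (hp : IsOrbit K p) (hq : IsOrbit K q) (hK : IsOpenBilliard K) (j : ℤ) :
    divergence p q j ≤ ‖transvOut p q j‖ * ‖outDir p j - outDir q j‖ := by
  rw [← inner_transvOut hp hq hK]; exact real_inner_le_norm _ _

lemma norm_outDir_sub_le_two (hp : IsOrbit K p) (hq : IsOrbit K q) (hK : IsOpenBilliard K)
    (j : ℤ) : ‖outDir p j - outDir q j‖ ≤ 2 := by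
  refine (norm_sub_le _ _).trans ?_
  rw [hp.norm_outDir hK, hq.norm_outDir hK]; norm_num

lemma isReflectedPair (hp : IsOrbit K p) (hq : IsOrbit K q) (hK : IsOpenBilliard K) {c : ℝ}
    (hc : ∀ p, IsOrbit K p → ∀ j i, p j ∈ K i →
      c ≤ ⟪unitDir (p j) (p (j + 1)), outerNormal (K i) (p j)⟫_ℝ) {j : ℤ} {i : Fin u}
    (hpi : p (j + 1) ∈ K i) (hqi : q (j + 1) ∈ K i) :
    IsReflectedPair c (p (j + 1) - q (j + 1)) (outDir p j) (outDir q j) (outDir p (j + 1))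
      (outDir q (j + 1)) (outerNormal (K i) (p (j + 1))) (outerNormal (K i) (q (j + 1))) := by
  have h1 := hp.reflect hK hpi
  have h2 := hq.reflect hK hqi
  rw [add_sub_cancel_right] at h1 h2
  have hfp := hp.mem_frontier hK hpi
  have hfq := hq.mem_frontier hK hqi
  refine ⟨(hK.body i).norm_outerNormal hfp, (hK.body i).norm_outerNormal hfq,
    hp.norm_outDir hK j, hq.norm_outDir hK j, hp.norm_outDir hK _, hq.norm_outDir hK _,
    h1.1, h2.1, h1.2, h2.2, hc p hp _ _ hpi, hc q hq _ _ hqi,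
    (hK.body i).inner_outerNormal_nonneg hfp hqi, ?_⟩
  have := (hK.body i).inner_outerNormal_nonneg hfq hpi
  rw [← neg_sub, inner_neg_right]
  linarith

lemma exists_le_norm_succ_sub (hK : IsOpenBilliard K) :
    ∃ e > 0, ∀ p, IsOrbit K p → ∀ j, e ≤ ‖p (j + 1) - p j‖ := by
  obtain ⟨e, he, hecl⟩ := hK.exists_le_norm_sub
  refine ⟨e, he, fun p hp j => ?_⟩
  obtain ⟨a, ha⟩ := hp.exists_mem hK j
  obtain ⟨b, hb⟩ := hp.exists_mem hK (j + 1)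
  have hab := hp.index_ne hK ha hb
  rw [norm_sub_rev]
  exact hecl a a b hab.symm hab.symm _ ha _ ha _ (left_mem_segment ℝ _ _) _ hb

/-- If two orbits are close at two consecutive reflections, their velocities before and after the
second one are close, and so are the normals. -/
lemma exists_norm_outDir_sub_le (hK : IsOpenBilliard K) {ε : ℝ} (hε : 0 < ε) :
    ∃ δ > 0, ∀ p q, IsOrbit K p → IsOrbit K q → ∀ j i, p (j + 1) ∈ K i → q (j + 1) ∈ K i →
      ‖p j - q j‖ ≤ δ → ‖p (j + 1) - q (j + 1)‖ ≤ δ →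
      ‖outDir p j - outDir q j‖ ≤ ε ∧ ‖outDir p (j + 1) - outDir q (j + 1)‖ ≤ ε ∧
        ‖outerNormal (K i) (p (j + 1)) - outerNormal (K i) (q (j + 1))‖ ≤ ε := by
  obtain ⟨e, he, hlen⟩ := exists_le_norm_succ_sub hK
  obtain ⟨c, hc, hang⟩ := hK.exists_le_inner_dir
  obtain ⟨δ, hδ, hn⟩ := exists_pos_forall (ι := Fin u)
    (P := fun i δ => ∀ p ∈ frontier (K i), ∀ q ∈ frontier (K i), ‖p - q‖ < δ →
      ‖outerNormal (K i) p - outerNormal (K i) q‖ ≤ ε / 3)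
    (fun i a b hab hb p hp q hq hpq => hb p hp q hq (hpq.trans_le hab))
    (fun i => (hK.body i).exists_norm_outerNormal_sub_le (by positivity))
  refine ⟨min (δ / 2) (ε * e / 12), by positivity, fun p q hp hq j i hpi hqi h0 h1 => ?_⟩
  have h2 := norm_unitDir_sub_le (hp.ne_succ hK j) (hq.ne_succ hK j)
  have h3 : ‖outDir p j - outDir q j‖ ≤ ε / 3 := by
    refine h2.trans ?_
    have h4 := h0.trans (min_le_right _ _)
    have h5 := h1.trans (min_le_right _ _)
    have h6 := hlen p hp j
    rw [div_le_iff₀ (he.trans_le h6)]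
    have h7 : ε / 3 * e ≤ ε / 3 * ‖p (j + 1) - p j‖ := by gcongr
    linarith
  have h4 := hn i _ (hp.mem_frontier hK hpi) _ (hq.mem_frontier hK hqi)
    (by linarith [h1.trans (min_le_left _ _)])
  have h5 := (isReflectedPair hp hq hK hang hpi hqi).norm_sub_le
  exact ⟨by linarith, by linarith, by linarith⟩

/-- One reflection, upper bounds. Here `κ i` bounds the curvature of `∂K i` from above, and `γ`
bounds `κ i` divided by the cosine of the collision angle. -/
lemma exists_reflection_upper (hK : IsOpenBilliard K) {κ : Fin u → ℝ} {γ : ℝ} (hγ : 0 ≤ γ)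
    (hκ0 : ∀ i, 0 ≤ κ i)
    (hκ : ∀ i, ∀ x ∈ reflectionPoints K i, ∀ w, IsUnitTangent (K i) x w →
      normalCurvature (K i) x w ≤ κ i)
    (hκγ : ∀ p, IsOrbit K p → ∀ j i, p j ∈ K i →
      κ i ≤ γ * ⟪outDir p j, outerNormal (K i) (p j)⟫_ℝ) {ε : ℝ} (hε : 0 < ε) :
    ∃ δ > 0, ∀ p q, IsOrbit K p → IsOrbit K q → ∀ j i, p (j + 1) ∈ K i → q (j + 1) ∈ K i →
      ‖p j - q j‖ ≤ δ → ‖p (j + 1) - q (j + 1)‖ ≤ δ → 0 ≤ divergence p q j →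
      (∀ k, 0 ≤ k → ‖outDir p j - outDir q j‖ ^ 2
          ≤ k * ⟪p (j + 1) - q (j + 1), outDir p j - outDir q j⟫_ℝ →
        ‖outDir p (j + 1) - outDir q (j + 1)‖ ^ 2
          ≤ (k + 2 * (γ + ε)) * divergence p q (j + 1)) ∧
      ‖transvOut p q (j + 1)‖ ≤ (1 + ε) * ‖transvIn p q j‖ := by
  obtain ⟨c, hc, hang⟩ := hK.exists_le_inner_dir
  obtain ⟨δ₁, hδ₁, hco⟩ := exists_pos_forall (ι := Fin u)
    (P := fun i δ => ∀ p ∈ reflectionPoints K i, ∀ q ∈ reflectionPoints K i, ‖p - q‖ < δ →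
      ‖outerNormal (K i) p - outerNormal (K i) q‖ ^ 2
        ≤ (κ i + ε * c) * ⟪p - q, outerNormal (K i) p - outerNormal (K i) q⟫_ℝ)
    (fun i a b hab hb p hp q hq hpq => hb p hp q hq (hpq.trans_le hab))
    (fun i => (hK.body i).exists_cocoercive_outerNormal (S := reflectionPoints K i)
      (by
        rintro x ⟨hx, z, ⟨-, k, hk⟩, rfl⟩
        rwa [hK.index_unique hx ((hK.body k).mem_of_mem_frontier hk)])
      (hκ0 i) (by positivity) (hκ i))
  set C : ℝ := (1 + 2 / c) ^ 2 with hC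
  have hC0 : 0 < C := by positivity
  obtain ⟨δ₂, hδ₂, hsm⟩ := exists_norm_outDir_sub_le hK
    (ε := min (min 1 c) (ε / (3 * C))) (by positivity)
  refine ⟨min (δ₁ / 2) δ₂, by positivity, fun p q hp hq j i hpi hqi h0 h1 hA => ?_⟩
  obtain ⟨s1, s2, s3⟩ := hsm p q hp hq j i hpi hqi (h0.trans (min_le_right _ _))
    (h1.trans (min_le_right _ _))
  have hpair := isReflectedPair hp hq hK hang hpi hqi
  have hcoer := hco i _ (hp.mem_reflectionPoints hK hpi) _ (hq.mem_reflectionPoints hK hqi)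
    (by linarith [h1.trans (min_le_left _ _)])
  have hin := inner_succ_eq hp hq hK j
  have hin0 : 0 ≤ ⟪p (j + 1) - q (j + 1), outDir p j - outDir q j⟫_ℝ := by
    rw [hin]
    have := meanFlight_nonneg p q j
    positivity
  refine ⟨fun k hk hle => ?_, ?_⟩
  · refine hpair.upper hc hk (by positivity) hin0 hle hcoer ?_ ?_
    · have := mul_le_mul_of_nonneg_left hpair.le_v hε.le
      rw [add_mul]; linarith [hκγ p hp _ _ hpi]
    · have := mul_le_mul_of_nonneg_left hpair.le_w hε.le
      rw [add_mul]; linarith [hκγ q hq _ _ hqi]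
  · have hd := hpair.norm_le_transv_incoming hc
      (s1.trans ((min_le_left _ _).trans (min_le_right _ _)))
    have hcmp := hpair.abs_norm_transv_sub_le hc
      ((min_le_left _ _).trans (min_le_left _ _)) s1 s2 s3
    have hd2 : ‖p (j + 1) - q (j + 1)‖ ^ 2 ≤ C * ‖transvIn p q j‖ ^ 2 := by
      rw [hC, ← mul_pow]; exact pow_le_pow_left₀ (norm_nonneg _) hd 2
    have hε' : 3 * min (min 1 c) (ε / (3 * C)) * C ≤ ε := by
      have := min_le_right (min 1 c) (ε / (3 * C))
      rw [le_div_iff₀ (by positivity)] at this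
      linarith
    have hm0 : 0 ≤ min (min 1 c) (ε / (3 * C)) := by positivity
    have h5 := (abs_le.1 hcmp).2
    have h6 : ‖transvOut p q (j + 1)‖ ^ 2 ≤ (1 + ε) * ‖transvIn p q j‖ ^ 2 := by
      have h7 : 3 * min (min 1 c) (ε / (3 * C)) * ‖p (j + 1) - q (j + 1)‖ ^ 2
          ≤ ε * ‖transvIn p q j‖ ^ 2 := by
        calc _ ≤ 3 * min (min 1 c) (ε / (3 * C)) * (C * ‖transvIn p q j‖ ^ 2) := by gcongr
          _ = 3 * min (min 1 c) (ε / (3 * C)) * C * ‖transvIn p q j‖ ^ 2 := by ring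
          _ ≤ _ := by gcongr
      have h8 : ‖transvOut p q (j + 1)‖ ^ 2 - ‖transvIn p q j‖ ^ 2
          ≤ 3 * min (min 1 c) (ε / (3 * C)) * ‖p (j + 1) - q (j + 1)‖ ^ 2 := h5
      linarith
    refine le_of_sq_le_sq ?_ (by positivity)
    rw [mul_pow]
    nlinarith [sq_nonneg ‖transvIn p q j‖, mul_nonneg hε.le (sq_nonneg ‖transvIn p q j‖),
      mul_nonneg (mul_nonneg hε.le hε.le) (sq_nonneg ‖transvIn p q j‖)]

lemma le_curvature_of_le_mul_pow {κ γ x : ℝ} {n : ℕ} (hγ : 0 < γ) (hx : 0 < x) (hx1 : x ≤ 1)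
    (h : γ ≤ κ * x ^ n) : γ ≤ κ := by
  have hκ : 0 < κ := by
    by_contra! hneg
    exact absurd (h.trans (mul_nonpos_of_nonpos_of_nonneg hneg (by positivity))) (not_le.2 hγ)
  exact h.trans (mul_le_of_le_one_right hκ.le (pow_le_one₀ hx.le hx1))

/-- Lower bound for the contribution of a reflection to the divergence. Here `x`, `x'` are the
cosines of the collision angles, `N`, `N'` are the heights of the reflection points over each
other's tangent hyperplanes, `Δ` is the squared distance of the reflection points and `S` their
transversal distance. -/
lemma reflection_gain_lower {κ γ ε ε₁ ε₂ C x x' N N' S Δ : ℝ} (hγ : 0 < γ) (hε₁0 : 0 ≤ ε₁)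
    (hε₁γ : ε₁ ≤ γ / 2) (hε₁ε : ε₁ ≤ ε / 4) (hε : 0 < ε) (hε₂0 : 0 ≤ ε₂) (hC : 0 ≤ C)
    (hε₂D : 20 * γ * C * ε₂ ≤ ε) (hε₂C : 10 * ε₂ * C ≤ 2) (hx0 : 0 < x) (hx'0 : 0 < x') (hx1 : x ≤ 1) (hx'1 : x' ≤ 1)
    (hκge : γ ≤ κ) (hcv : (κ - ε₁) / 2 * Δ ≤ N) (hcw : (κ - ε₁) / 2 * Δ ≤ -N')
    (hX : Δ ≤ C * S ^ 2) (hXd : S ^ 2 ≤ Δ)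
    (hcase : (4 * S ^ 2 ≤ (4 * x + 20 * ε₂) * Δ ∧ 4 * S ^ 2 ≤ (4 * x' + 20 * ε₂) * Δ) ∨
      (γ ≤ κ * x ∧ γ ≤ κ * x')) :
    (2 * γ - ε) * S ^ 2 ≤ 2 * x * N - 2 * x' * N' := by
  have hS : 0 ≤ S ^ 2 := sq_nonneg S
  generalize S ^ 2 = Q at *
  have h2 : (x + x') * Δ * (κ - ε₁) ≤ 2 * x * N - 2 * x' * N' := by
    have h3 := mul_le_mul_of_nonneg_left hcv hx0.le
    have h4 := mul_le_mul_of_nonneg_left hcw hx'0.le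
    linarith only [h3, h4]
  refine le_trans ?_ h2
  have hκ1 : 0 ≤ κ - ε₁ := by linarith only [hκge, hε₁γ, hγ]
  rcases hcase with ⟨b1, b2⟩ | ⟨b1, b2⟩
  · have h3 : (2 - 10 * ε₂ * C) * Q ≤ (x + x') * Δ := by
      have := mul_le_mul_of_nonneg_left hX hε₂0
      linarith only [this, b1, b2]
    have h4 := mul_le_mul_of_nonneg_right h3 hκ1
    refine le_trans ?_ h4
    rw [mul_right_comm]
    refine mul_le_mul_of_nonneg_right ?_ hS
    have hu : 0 ≤ ε₂ * C := by positivity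
    have h7 : 0 ≤ 2 - 10 * ε₂ * C := by linarith only [hε₂C]
    calc 2 * γ - ε ≤ (2 - 10 * ε₂ * C) * (γ - ε₁) := by
          have := mul_nonneg hu hε₁0
          linarith only [this, hε₂D, hε₁ε, hε]
      _ ≤ _ := by gcongr
  · have h3 : 2 * γ - ε ≤ (x + x') * (κ - ε₁) := by
      have h5 := mul_le_mul_of_nonneg_right hx1 hε₁0
      have h6 := mul_le_mul_of_nonneg_right hx'1 hε₁0
      linarith only [h5, h6, b1, b2, hε₁ε, hε]
    have h4 : 0 ≤ (x + x') * (κ - ε₁) := mul_nonneg (by linarith only [hx0, hx'0]) hκ1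
    calc (2 * γ - ε) * Q ≤ (x + x') * (κ - ε₁) * Q := by gcongr
      _ ≤ (x + x') * (κ - ε₁) * Δ := by gcongr
      _ = _ := by ring

/-- One reflection, lower bounds. Here `κ i` bounds the curvature of `∂K i` from below, and `γ`
bounds `κ i` times the power `ι` of the cosine of the collision angle. In the plane the rays and
the reflection points span the same line field, so no cosine is lost. -/
lemma exists_reflection_lower (hD : 2 ≤ D) (hK : IsOpenBilliard K) {κ : Fin u → ℝ} {γ : ℝ}
    (hγ : 0 < γ)
    (hκ : ∀ i, ∀ x ∈ reflectionPoints K i, ∀ w, IsUnitTangent (K i) x w →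
      κ i ≤ normalCurvature (K i) x w)
    (hκγ : ∀ p, IsOrbit K p → ∀ j i, p j ∈ K i →
      γ ≤ κ i * ⟪outDir p j, outerNormal (K i) (p j)⟫_ℝ ^ iotaExp D) {ε : ℝ} (hε : 0 < ε)
    (hε1 : ε ≤ 1) :
    ∃ δ > 0, ∀ p q, IsOrbit K p → IsOrbit K q → ∀ j i, p (j + 1) ∈ K i → q (j + 1) ∈ K i →
      ‖p j - q j‖ ≤ δ → ‖p (j + 1) - q (j + 1)‖ ≤ δ →
      (∀ k, 0 ≤ k → k * ‖transvIn p q j‖ ^ 2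
          ≤ ⟪p (j + 1) - q (j + 1), outDir p j - outDir q j⟫_ℝ →
        ((1 - ε) * k + 2 * γ - ε) * ‖transvOut p q (j + 1)‖ ^ 2 ≤ divergence p q (j + 1)) ∧
      (1 - ε) * ‖transvIn p q j‖ ≤ ‖transvOut p q (j + 1)‖ := by
  obtain ⟨c, hc, hang⟩ := hK.exists_le_inner_dir
  set C : ℝ := (1 + 2 / c) ^ 2 with hC
  have hC0 : 0 < C := by positivity
  -- the error in the curvature, and the error in the directions
  set ε₁ : ℝ := min (γ / 2) (ε / 4) with hε₁
  have hε₁0 : 0 < ε₁ := by positivity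
  set ε₂ : ℝ := min (min 1 c) (min (ε / (5 * C)) (ε / (20 * γ * C))) with hε₂
  have hε₂0 : 0 < ε₂ := by positivity
  obtain ⟨δ₁, hδ₁, hco⟩ := exists_pos_forall (ι := Fin u)
    (P := fun i δ => ∀ p ∈ reflectionPoints K i, ∀ q ∈ frontier (K i), ‖p - q‖ < δ →
      (κ i - ε₁) / 2 * ‖p - q‖ ^ 2 ≤ ⟪outerNormal (K i) p, p - q⟫_ℝ)
    (fun i a b hab hb p hp q hq hpq => hb p hp q hq (hpq.trans_le hab))
    (fun i => (hK.body i).exists_quadratic_convexity (S := reflectionPoints K i)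
      (by
        rintro x ⟨hx, z, ⟨-, k, hk⟩, rfl⟩
        rwa [hK.index_unique hx ((hK.body k).mem_of_mem_frontier hk)])
      hε₁0 (hκ i))
  obtain ⟨δ₂, hδ₂, hsm⟩ := exists_norm_outDir_sub_le hK hε₂0
  refine ⟨min (δ₁ / 2) δ₂, by positivity, fun p q hp hq j i hpi hqi h0 h1 => ?_⟩
  obtain ⟨s1, s2, s3⟩ := hsm p q hp hq j i hpi hqi (h0.trans (min_le_right _ _))
    (h1.trans (min_le_right _ _))
  have hpair := isReflectedPair hp hq hK hang hpi hqi
  have hcv := hco i _ (hp.mem_reflectionPoints hK hpi) _ (hq.mem_frontier hK hqi)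
    (by linarith [h1.trans (min_le_left _ _)])
  have hcw := hco i _ (hq.mem_reflectionPoints hK hqi) _ (hp.mem_frontier hK hpi)
    (by rw [norm_sub_rev]; linarith [h1.trans (min_le_left _ _)])
  have hgv := hκγ p hp _ _ hpi
  have hgw := hκγ q hq _ _ hqi
  have hε₂1 : ε₂ ≤ 1 := (min_le_left _ _).trans (min_le_left _ _)
  have hε₂c : ε₂ ≤ c := (min_le_left _ _).trans (min_le_right _ _)
  have hin := hpair.norm_le_transv_incoming hc (s1.trans hε₂c)
  have hout := hpair.norm_le_transv hc (s2.trans hε₂c)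
  have hcmp := abs_le.1 (hpair.abs_norm_transv_sub_le hc hε₂1 s1 s2 s3)
  have hle := norm_transv_le (outDir p (j + 1) + outDir q (j + 1)) (p (j + 1) - q (j + 1))
  have hdiv := hpair.inner_eq
  have hplane : D = 2 → 4 * ‖transvOut p q (j + 1)‖ ^ 2
        ≤ (4 * ⟪outDir p (j + 1), outerNormal (K i) (p (j + 1))⟫_ℝ + 20 * ε₂)
          * ‖p (j + 1) - q (j + 1)‖ ^ 2 ∧
      4 * ‖transvOut p q (j + 1)‖ ^ 2
        ≤ (4 * ⟪outDir q (j + 1), outerNormal (K i) (q (j + 1))⟫_ℝ + 20 * ε₂)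
          * ‖p (j + 1) - q (j + 1)‖ ^ 2 := by
    rintro rfl
    have hx1 := hpair.inner_le_one
    have hb1 := hpair.norm_transv_sq_le_of_plane hε₂1 s2 s3
    have hb2 := hpair.swap.norm_transv_sq_le_of_plane hε₂1 (by rwa [norm_sub_rev])
      (by rwa [norm_sub_rev])
    rw [norm_transv_neg, norm_neg, add_comm (outDir q (j + 1))] at hb2
    have hsq : ∀ x : ℝ, c ≤ x → x ≤ 1 → x ^ 2 ≤ x := fun x h2 h3 => by nlinarith
    have e1 := mul_le_mul_of_nonneg_right (hsq _ hpair.le_v hx1.1)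
      (sq_nonneg ‖p (j + 1) - q (j + 1)‖)
    have e2 := mul_le_mul_of_nonneg_right (hsq _ hpair.le_w hx1.2)
      (sq_nonneg ‖p (j + 1) - q (j + 1)‖)
    change ‖transvOut p q (j + 1)‖ ^ 2 ≤ _ at hb1
    change ‖transvOut p q (j + 1)‖ ^ 2 ≤ _ at hb2
    constructor <;> linarith
  obtain ⟨hx1, hw1⟩ := hpair.inner_le_one
  have hxc := hpair.le_v
  have hwc := hpair.le_w
  have hny : ⟪outerNormal (K i) (q (j + 1)), q (j + 1) - p (j + 1)⟫_ℝ
      = -⟪outerNormal (K i) (q (j + 1)), p (j + 1) - q (j + 1)⟫_ℝ := by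
    rw [← neg_sub, inner_neg_right]
  rw [hny, norm_sub_rev] at hcw
  change divergence p q (j + 1) = _ at hdiv
  change _ ≤ ‖transvOut p q (j + 1)‖ ^ 2 - ‖transvIn p q j‖ ^ 2 ∧
    ‖transvOut p q (j + 1)‖ ^ 2 - ‖transvIn p q j‖ ^ 2 ≤ _ at hcmp
  change ‖transvOut p q (j + 1)‖ ≤ _ at hle
  have hX : ‖p (j + 1) - q (j + 1)‖ ^ 2 ≤ C * ‖transvOut p q (j + 1)‖ ^ 2 := by
    rw [hC, ← mul_pow]; exact pow_le_pow_left₀ (norm_nonneg _) hout 2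
  have hY : ‖p (j + 1) - q (j + 1)‖ ^ 2 ≤ C * ‖transvIn p q j‖ ^ 2 := by
    rw [hC, ← mul_pow]; exact pow_le_pow_left₀ (norm_nonneg _) hin 2
  have hXd : ‖transvOut p q (j + 1)‖ ^ 2 ≤ ‖p (j + 1) - q (j + 1)‖ ^ 2 :=
    pow_le_pow_left₀ (norm_nonneg _) hle 2
  have hε₂C : 5 * ε₂ * C ≤ ε := by
    have : ε₂ ≤ ε / (5 * C) := (min_le_right _ _).trans (min_le_left _ _)
    rw [le_div_iff₀ (by positivity)] at this
    linarith
  have hε₂D : 20 * γ * C * ε₂ ≤ ε := by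
    have : ε₂ ≤ ε / (20 * γ * C) := (min_le_right _ _).trans (min_le_right _ _)
    rw [le_div_iff₀ (by positivity)] at this
    linarith
  have hκ0 := le_curvature_of_le_mul_pow hγ (hc.trans_le hxc) hx1 hgv
  have hcos : D ≠ 2 → γ ≤ κ i * ⟪outDir p (j + 1), outerNormal (K i) (p (j + 1))⟫_ℝ ∧
      γ ≤ κ i * ⟪outDir q (j + 1), outerNormal (K i) (q (j + 1))⟫_ℝ := by
    intro hD2
    simp only [iotaExp, hD2, if_false, pow_one] at hgv hgw
    exact ⟨hgv, hgw⟩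
  have hy := reflection_gain_lower hγ hε₁0.le (min_le_left _ _) (min_le_right _ _) hε hε₂0.le hC0.le
    hε₂D (by linarith only [hε₂C, hε1]) (hc.trans_le hxc) (hc.trans_le hwc) hx1 hw1 hκ0 hcv hcw hX hXd
    (by
      by_cases hD2 : D = 2
      · exact Or.inl (hplane hD2)
      · exact Or.inr (hcos hD2))
  have hS2 : 3 * ε₂ * ‖p (j + 1) - q (j + 1)‖ ^ 2 ≤ ε * ‖transvOut p q (j + 1)‖ ^ 2 := by
    calc _ ≤ 3 * ε₂ * (C * ‖transvOut p q (j + 1)‖ ^ 2) := by gcongr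
      _ = 3 * ε₂ * C * ‖transvOut p q (j + 1)‖ ^ 2 := by ring
      _ ≤ _ := by gcongr; linarith only [hε₂C, mul_nonneg hε₂0.le hC0.le]
  have hT2 : 3 * ε₂ * ‖p (j + 1) - q (j + 1)‖ ^ 2 ≤ ε * ‖transvIn p q j‖ ^ 2 := by
    calc _ ≤ 3 * ε₂ * (C * ‖transvIn p q j‖ ^ 2) := by gcongr
      _ = 3 * ε₂ * C * ‖transvIn p q j‖ ^ 2 := by ring
      _ ≤ _ := by gcongr; linarith only [hε₂C, mul_nonneg hε₂0.le hC0.le]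
  refine ⟨fun k hk hkA => ?_, ?_⟩
  · have h1 : (1 - ε) * ‖transvOut p q (j + 1)‖ ^ 2 ≤ ‖transvIn p q j‖ ^ 2 := by
      rw [sub_mul, one_mul]; linarith only [hcmp.2, hS2]
    have h3 := mul_le_mul_of_nonneg_left h1 hk
    rw [hdiv]
    calc _ = k * ((1 - ε) * ‖transvOut p q (j + 1)‖ ^ 2)
          + (2 * γ - ε) * ‖transvOut p q (j + 1)‖ ^ 2 := by ring
      _ ≤ _ := add_le_add (h3.trans hkA) hy
  · have h3 : (1 - ε) * ‖transvIn p q j‖ ^ 2 ≤ ‖transvOut p q (j + 1)‖ ^ 2 := by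
      rw [sub_mul, one_mul]; linarith only [hcmp.1, hT2]
    refine le_of_sq_le_sq (le_trans ?_ h3) (norm_nonneg _)
    rw [mul_pow]
    refine mul_le_mul_of_nonneg_right ?_ (sq_nonneg _)
    rw [sq]
    exact mul_le_of_le_one_left (by linarith only [hε1]) (by linarith only [hε])

end IsOrbit

end OpenBilliard

namespace OpenBilliard

/-! ### Growth of the distance of two orbits: upper bounds -/

variable {D u : ℕ} {K : Fin u → Set (Space D)}

lemma exists_pos_le_of_continuous {f g : ℝ → ℝ} {a b : ℝ} (hf : Continuous f)
    (hg : Continuous g) (ha : f 0 < a) (hb : g 0 < b) :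
    ∃ ε > 0, ε ≤ 1 ∧ f ε ≤ a ∧ g ε ≤ b := by
  have h1 : ∀ᶠ ε in 𝓝[>] (0 : ℝ), f ε < a :=
    ((hf.tendsto 0).mono_left nhdsWithin_le_nhds).eventually_lt_const ha
  have h2 : ∀ᶠ ε in 𝓝[>] (0 : ℝ), g ε < b :=
    ((hg.tendsto 0).mono_left nhdsWithin_le_nhds).eventually_lt_const hb
  have h3 : ∀ᶠ ε in 𝓝[>] (0 : ℝ), ε ∈ Ioc (0 : ℝ) 1 := Ioc_mem_nhdsGT zero_lt_one
  obtain ⟨ε, h1, h2, h3⟩ := (h1.and (h2.and h3)).exists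
  exact ⟨ε, h3.1, h3.2, h1.le, h2.le⟩

/-- The reflections of `p` and `q` with the numbers `0, …, m` are on the same obstacles. -/
def ShareObstacles (K : Fin u → Set (Space D)) (p q : ℤ → Space D) (m : ℕ) : Prop :=
  ∀ j : ℕ, j ≤ m → ∃ i, p j ∈ K i ∧ q j ∈ K i

lemma ShareObstacles.mono {p q : ℤ → Space D} {m n : ℕ} (h : ShareObstacles K p q m)
    (hn : n ≤ m) : ShareObstacles K p q n := fun j hj => h j (hj.trans hn)

namespace IsOrbit

variable {p q : ℤ → Space D}

/-- Flights and reflections on a common obstacle both increase the divergence. -/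
lemma divergence_add_le (hp : IsOrbit K p) (hq : IsOrbit K q) (hK : IsOpenBilliard K) {j : ℤ}
    {i : Fin u} (hpi : p (j + 1) ∈ K i) (hqi : q (j + 1) ∈ K i) :
    divergence p q j + meanFlight p q j * ‖outDir p j - outDir q j‖ ^ 2
      ≤ divergence p q (j + 1) := by
  obtain ⟨c, hc, hang⟩ := hK.exists_le_inner_dir
  have hpair := isReflectedPair hp hq hK hang hpi hqi
  have h1 := hpair.inner_eq
  rw [inner_succ_eq hp hq hK] at h1
  have h2 := mul_nonneg (hc.le.trans hpair.le_v) hpair.inner_n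
  have h3 := mul_nonneg (hc.le.trans hpair.le_w) (neg_nonneg.2 hpair.inner_m)
  change _ ≤ ⟪_, _⟫_ℝ
  rw [h1]
  linarith

lemma divergence_mono (hp : IsOrbit K p) (hq : IsOrbit K q) (hK : IsOpenBilliard K) {m : ℕ}
    (h : ShareObstacles K p q m) {i j : ℕ} (hij : i ≤ j) (hj : j ≤ m) :
    divergence p q i ≤ divergence p q j := by
  induction j, hij using Nat.le_induction with
  | base => exact le_rfl
  | succ j hij ih =>
    obtain ⟨k, h1, h2⟩ := h (j + 1) hj
    push_cast at h1 h2 ⊢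
    have := divergence_add_le hp hq hK h1 h2
    have h3 := mul_nonneg (meanFlight_nonneg p q j) (sq_nonneg ‖outDir p j - outDir q j‖)
    linarith [ih (by omega)]

lemma norm_transvIn_le (hp : IsOrbit K p) (hq : IsOrbit K q) (hK : IsOpenBilliard K) (j : ℤ) :
    ‖transvIn p q j‖ ≤ ‖transvOut p q j‖ + meanFlight p q j * ‖outDir p j - outDir q j‖ := by
  rw [transvIn_eq hp hq hK]
  refine (norm_add_le _ _).trans ?_
  rw [norm_smul, Real.norm_of_nonneg (meanFlight_nonneg p q j)]

lemma norm_transvOut_le (p q : ℤ → Space D) (j : ℤ) : ‖transvOut p q j‖ ≤ ‖p j - q j‖ :=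
  norm_transv_le _ _

lemma meanFlight_le {d : ℝ} (hd : ∀ p, IsOrbit K p → ∀ j, ‖p (j + 1) - p j‖ ≤ d)
    (hp : IsOrbit K p) (hq : IsOrbit K q) (j : ℤ) : meanFlight p q j ≤ d := by
  unfold meanFlight
  linarith [hd p hp j, hd q hq j]

lemma le_meanFlight {d : ℝ} (hd : ∀ p, IsOrbit K p → ∀ j, d ≤ ‖p (j + 1) - p j‖)
    (hp : IsOrbit K p) (hq : IsOrbit K q) (j : ℤ) : d ≤ meanFlight p q j := by
  unfold meanFlight
  linarith [hd p hp j, hd q hq j]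

/-- Two rays that start on a common obstacle and end on different ones are not close, since by
the no-eclipse condition the end point of the shorter one is not close to the longer one. -/
lemma exists_le_norm_sub_of_ne (hK : IsOpenBilliard K) :
    ∃ δ > 0, ∀ p q, IsOrbit K p → IsOrbit K q → ∀ j i a b, p j ∈ K i → q j ∈ K i →
      p (j + 1) ∈ K a → q (j + 1) ∈ K b → a ≠ b →
      δ ≤ ‖p j - q j‖ + ‖outDir p j - outDir q j‖ := by
  obtain ⟨e, he, hecl⟩ := hK.exists_le_norm_sub
  obtain ⟨R, hR, hbd⟩ := hK.exists_norm_le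
  have main : ∀ p q, IsOrbit K p → IsOrbit K q → ∀ j i a b, p j ∈ K i → q j ∈ K i →
      p (j + 1) ∈ K a → q (j + 1) ∈ K b → a ≠ b → ‖p (j + 1) - p j‖ ≤ ‖q (j + 1) - q j‖ →
      e / (1 + 2 * R) ≤ ‖p j - q j‖ + ‖outDir p j - outDir q j‖ := by
    intro p q hp hq j i a b hpi hqi hpa hqb hab hle
    have hσ : 0 < ‖q (j + 1) - q j‖ := norm_pos_iff.2 (sub_ne_zero.2 (hq.ne_succ hK j).symm)
    set τ := ‖p (j + 1) - p j‖ with hτ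
    set σ := ‖q (j + 1) - q j‖ with hσ'
    have hseg : q j + τ • outDir q j ∈ segment ℝ (q j) (q (j + 1)) := by
      rw [segment_eq_image']
      refine ⟨τ / σ, ⟨by positivity, (div_le_one hσ).2 hle⟩, ?_⟩
      simp only [outDir, unitDir, smul_smul, ← hσ', div_eq_mul_inv]
    have h1 := hecl i b a (hp.index_ne hK hpi hpa).symm hab _ hqi _ hqb _ hseg _ hpa
    have e1 : q j + τ • outDir q j - p (j + 1) = -(p j - q j) - τ • (outDir p j - outDir q j) := by
      have : p (j + 1) = p j + τ • outDir p j := by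
        rw [outDir, hτ, norm_smul_unitDir]; abel
      rw [this]; module
    rw [e1] at h1
    have h2 : ‖-(p j - q j) - τ • (outDir p j - outDir q j)‖
        ≤ ‖p j - q j‖ + τ * ‖outDir p j - outDir q j‖ := by
      refine (norm_sub_le _ _).trans ?_
      rw [norm_neg, norm_smul, Real.norm_of_nonneg (norm_nonneg _)]
    have h3 : τ ≤ 2 * R := by
      refine (norm_sub_le _ _).trans ?_
      linarith [hbd _ _ hpa, hbd _ _ hpi]
    rw [div_le_iff₀ (by positivity)]
    nlinarith [norm_nonneg (p j - q j), norm_nonneg (outDir p j - outDir q j)]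
  refine ⟨e / (1 + 2 * R), by positivity, fun p q hp hq j i a b hpi hqi hpa hqb hab => ?_⟩
  rcases le_total ‖p (j + 1) - p j‖ ‖q (j + 1) - q j‖ with h | h
  · exact main p q hp hq j i a b hpi hqi hpa hqb hab h
  · have := main q p hq hp j i b a hqi hpi hqb hpa hab.symm h
    rwa [norm_sub_rev (q j), norm_sub_rev (outDir q j)] at this

/-- As long as two orbits that do not converge initially stay close together, their distance grows
at most by the factor `Λ` per reflection. The quantity that is controlled is
`‖transvOut‖ * (k + β)`, where `k` bounds the curvature of a front from above. -/
lemma exists_growth_upper (hK : IsOpenBilliard K) {κ : Fin u → ℝ} {γ d Λ β : ℝ} (hγ : 0 ≤ γ)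
    (hκ0 : ∀ i, 0 ≤ κ i)
    (hκ : ∀ i, ∀ x ∈ reflectionPoints K i, ∀ w, IsUnitTangent (K i) x w →
      normalCurvature (K i) x w ≤ κ i)
    (hκγ : ∀ p, IsOrbit K p → ∀ j i, p j ∈ K i →
      κ i ≤ γ * ⟪outDir p j, outerNormal (K i) (p j)⟫_ℝ)
    (hd0 : 0 ≤ d) (hd : ∀ p, IsOrbit K p → ∀ j, ‖p (j + 1) - p j‖ ≤ d) (hβ : 0 < β)
    (h1 : 2 * γ + β < Λ * β) (h2 : d * (2 * γ + β) < Λ - 1) :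
    ∃ δ > 0, ∃ C, 1 ≤ C ∧ ∀ p q, IsOrbit K p → IsOrbit K q → ∀ m : ℕ, ShareObstacles K p q m →
      0 ≤ divergence p q 0 → (∀ j : ℕ, j ≤ m → ‖p j - q j‖ ≤ δ) →
      ‖outDir p m - outDir q m‖ ≤ C * (‖p 0 - q 0‖ + ‖outDir p 0 - outDir q 0‖) * Λ ^ m ∧
      ‖transvOut p q m‖ ≤ C * (‖p 0 - q 0‖ + ‖outDir p 0 - outDir q 0‖) * Λ ^ m := by
  have hΛ : 1 ≤ Λ := by
    have : 0 ≤ d * (2 * γ + β) := by positivity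
    linarith
  obtain ⟨ε, hε, hε1, hε2⟩ : ∃ ε > 0, (1 + ε) * (2 * (γ + ε) + β) ≤ Λ * β ∧
      (1 + ε) * (1 + d * (2 * (γ + ε) + β)) ≤ Λ := by
    obtain ⟨ε, a1, -, a2, a3⟩ := exists_pos_le_of_continuous
      (f := fun ε : ℝ => (1 + ε) * (2 * (γ + ε) + β)) (a := Λ * β)
      (g := fun ε : ℝ => (1 + ε) * (1 + d * (2 * (γ + ε) + β))) (b := Λ)
      (by fun_prop) (by fun_prop) (by linarith) (by linarith)
    exact ⟨ε, a1, a2, a3⟩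
  obtain ⟨δ, hδ, hrefl⟩ := exists_reflection_upper hK hγ hκ0 hκ hκγ hε
  obtain ⟨e, he, hlen⟩ := exists_le_norm_succ_sub hK
  set G := 2 * (γ + ε) + β with hG
  have hG0 : 0 < G := by positivity
  set C₁ := (1 + ε) * (1 + d) * (1 / e + G) with hC₁
  have hC₁0 : 0 < C₁ := by positivity
  refine ⟨δ, hδ, max 1 (max C₁ (C₁ / β)), le_max_left _ _, fun p q hp hq m hm hA hclose => ?_⟩
  set E := ‖p 0 - q 0‖ + ‖outDir p 0 - outDir q 0‖ with hE
  have hE0 : 0 ≤ E := by positivity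
  -- the controlled quantity
  have key : ∀ j : ℕ, j + 1 ≤ m → ∃ k, 0 ≤ k ∧
      ‖outDir p (j + 1) - outDir q (j + 1)‖ ^ 2 ≤ k * divergence p q (j + 1) ∧
      ‖transvOut p q (j + 1)‖ * (k + β) ≤ C₁ * E * Λ ^ (j + 1) := by
    intro j
    induction j with
    | zero =>
      intro hj
      obtain ⟨i, hpi, hqi⟩ := hm 1 hj
      have c0 := hclose 0 (Nat.zero_le _)
      have c1 := hclose 1 hj
      push_cast at hpi hqi c0 c1
      have hin := inner_succ_eq hp hq hK 0
      have hθ := le_meanFlight hlen hp hq 0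
      have hθd := meanFlight_le hd hp hq 0
      obtain ⟨r1, r2⟩ := hrefl p q hp hq 0 i (by simpa using hpi) (by simpa using hqi) c0
        (by simpa using c1) hA
      have hη := norm_nonneg (outDir p 0 - outDir q 0)
      refine ⟨1 / e + 2 * (γ + ε), by positivity, ?_, ?_⟩
      · have := r1 (1 / e) (by positivity) (by
          rw [hin, div_mul_eq_mul_div, one_mul, le_div_iff₀ he]
          nlinarith [sq_nonneg ‖outDir p 0 - outDir q 0‖])
        simpa using this
      · have h3 := norm_transvIn_le hp hq hK 0
        have h4 := norm_transvOut_le p q 0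
        have h5 : ‖transvIn p q 0‖ ≤ (1 + d) * E := by
          have := mul_le_mul_of_nonneg_right hθd hη
          rw [hE]
          nlinarith [norm_nonneg (p 0 - q 0)]
        have h6 : (1 : ℝ) ≤ Λ ^ (0 + 1) := one_le_pow₀ hΛ
        rw [zero_add] at r2
        simp only [Nat.cast_zero, zero_add] at h6 ⊢
        calc ‖transvOut p q 1‖ * (1 / e + 2 * (γ + ε) + β)
            ≤ (1 + ε) * ((1 + d) * E) * (1 / e + G) := by
              rw [add_assoc, ← hG]
              have := r2.trans (mul_le_mul_of_nonneg_left h5 (by positivity))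
              gcongr
          _ = C₁ * E * 1 := by rw [hC₁]; ring
          _ ≤ _ := by gcongr
    | succ j ih =>
      intro hj
      obtain ⟨k, hk, hk1, hk2⟩ := ih (by omega)
      obtain ⟨i, hpi, hqi⟩ := hm (j + 1 + 1) hj
      have c0 := hclose (j + 1) (by omega)
      have c1 := hclose (j + 1 + 1) hj
      have hAj := divergence_mono hp hq hK hm (Nat.zero_le (j + 1)) (by omega)
      push_cast at hpi hqi c0 c1 hAj ⊢
      have hθd := meanFlight_le hd hp hq (j + 1)
      have hθ0 := meanFlight_nonneg p q (j + 1)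
      obtain ⟨r1, r2⟩ := hrefl p q hp hq _ i hpi hqi c0 c1 (hA.trans hAj)
      rw [← inner_transvOut hp hq hK] at hk1
      obtain ⟨f1, f2⟩ := flight_upper hθ0 hk hk1
      rw [← transvIn_eq hp hq hK, inner_transvIn hp hq hK] at f2
      rw [← transvIn_eq hp hq hK] at f1
      set θ := meanFlight p q (j + 1) with hθ
      have hpos : 0 < 1 + θ * k := by positivity
      refine ⟨k / (1 + θ * k) + 2 * (γ + ε), by positivity, r1 _ (by positivity) f2, ?_⟩
      have hX := norm_nonneg (transvOut p q (j + 1))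
      have h3 := r2.trans (mul_le_mul_of_nonneg_left f1 (by positivity))
      have h4 : (1 + ε) * (k * (1 + θ * G) + G) ≤ Λ * (k + β) := by
        have h5 : k * ((1 + ε) * (1 + θ * G)) ≤ k * Λ := by
          refine mul_le_mul_of_nonneg_left (le_trans ?_ hε2) hk
          gcongr
        linarith
      calc ‖transvOut p q (j + 1 + 1)‖ * (k / (1 + θ * k) + 2 * (γ + ε) + β)
          ≤ (1 + ε) * ((1 + θ * k) * ‖transvOut p q (j + 1)‖) * (k / (1 + θ * k) + G) := by
            rw [add_assoc (k / _), ← hG]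
            gcongr
        _ = (1 + ε) * (k * (1 + θ * G) + G) * ‖transvOut p q (j + 1)‖ := by
            field_simp; ring
        _ ≤ Λ * (k + β) * ‖transvOut p q (j + 1)‖ := by gcongr
        _ = Λ * (‖transvOut p q (j + 1)‖ * (k + β)) := by ring
        _ ≤ Λ * (C₁ * E * Λ ^ (j + 1)) := by gcongr
        _ = _ := by ring
  have hC1 : (1 : ℝ) ≤ max 1 (max C₁ (C₁ / β)) := le_max_left _ _
  rcases m with _ | j
  · have h3 := norm_transvOut_le p q 0
    have h4 : E ≤ max 1 (max C₁ (C₁ / β)) * E := le_mul_of_one_le_left hE0 hC1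
    simp only [pow_zero, mul_one, Nat.cast_zero]
    constructor
    · linarith [norm_nonneg (p 0 - q 0)]
    · linarith [norm_nonneg (outDir p 0 - outDir q 0)]
  · obtain ⟨k, hk, hk1, hk2⟩ := key j le_rfl
    have hX := norm_nonneg (transvOut p q (j + 1))
    have hη := norm_nonneg (outDir p (j + 1) - outDir q (j + 1))
    have hP : 0 ≤ E * Λ ^ (j + 1) := by positivity
    push_cast
    have h3 : ‖outDir p (j + 1) - outDir q (j + 1)‖ ≤ k * ‖transvOut p q (j + 1)‖ := by
      rcases hη.eq_or_lt with h0 | h0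
      · rw [← h0]; positivity
      · have h4 := mul_le_mul_of_nonneg_left (divergence_le hp hq hK (j + 1)) hk
        refine le_of_mul_le_mul_right ?_ h0
        linarith [sq ‖outDir p (j + 1) - outDir q (j + 1)‖]
    have h5 : C₁ * (E * Λ ^ (j + 1)) ≤ max 1 (max C₁ (C₁ / β)) * (E * Λ ^ (j + 1)) :=
      mul_le_mul_of_nonneg_right ((le_max_left _ _).trans (le_max_right _ _)) hP
    have h6 : C₁ / β * (E * Λ ^ (j + 1)) ≤ max 1 (max C₁ (C₁ / β)) * (E * Λ ^ (j + 1)) :=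
      mul_le_mul_of_nonneg_right ((le_max_right _ _).trans (le_max_right _ _)) hP
    have h8 : ‖transvOut p q (j + 1)‖ * k ≤ C₁ * E * Λ ^ (j + 1) :=
      (mul_le_mul_of_nonneg_left (le_add_of_nonneg_right hβ.le) hX).trans hk2
    have h9 : ‖transvOut p q (j + 1)‖ * β ≤ C₁ * E * Λ ^ (j + 1) :=
      (mul_le_mul_of_nonneg_left (le_add_of_nonneg_left hk) hX).trans hk2
    have h7 : ‖transvOut p q (j + 1)‖ ≤ C₁ / β * (E * Λ ^ (j + 1)) := by
      rw [div_mul_eq_mul_div, le_div_iff₀ hβ, ← mul_assoc]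
      exact h9
    rw [mul_assoc]
    refine ⟨?_, h7.trans h6⟩
    refine h3.trans (le_trans ?_ h5)
    rw [mul_comm k, ← mul_assoc]
    exact h8

/-- Two orbits that do not converge initially and visit the same obstacles until they separate
after the `m`-th reflection have an initial distance of at least a constant times `Λ⁻ᵐ`. -/
lemma exists_separation_lower (hK : IsOpenBilliard K) {κ : Fin u → ℝ} {γ d Λ β : ℝ} (hγ : 0 ≤ γ)
    (hκ0 : ∀ i, 0 ≤ κ i)
    (hκ : ∀ i, ∀ x ∈ reflectionPoints K i, ∀ w, IsUnitTangent (K i) x w →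
      normalCurvature (K i) x w ≤ κ i)
    (hκγ : ∀ p, IsOrbit K p → ∀ j i, p j ∈ K i →
      κ i ≤ γ * ⟪outDir p j, outerNormal (K i) (p j)⟫_ℝ)
    (hd0 : 0 ≤ d) (hd : ∀ p, IsOrbit K p → ∀ j, ‖p (j + 1) - p j‖ ≤ d) (hβ : 0 < β)
    (h1 : 2 * γ + β < Λ * β) (h2 : d * (2 * γ + β) < Λ - 1) :
    ∃ c > 0, ∀ p q, IsOrbit K p → IsOrbit K q → ∀ m : ℕ, ShareObstacles K p q m →
      (∃ a b, p (m + 1) ∈ K a ∧ q (m + 1) ∈ K b ∧ a ≠ b) → 0 ≤ divergence p q 0 →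
      c ≤ Λ ^ m * (‖p 0 - q 0‖ + ‖outDir p 0 - outDir q 0‖) := by
  have hΛ : 1 ≤ Λ := by
    have : 0 ≤ d * (2 * γ + β) := by positivity
    linarith
  obtain ⟨δ, hδ, C, hC, hgrow⟩ := exists_growth_upper hK hγ hκ0 hκ hκγ hd0 hd hβ h1 h2
  obtain ⟨δ₁, hδ₁, hsep⟩ := exists_le_norm_sub_of_ne hK
  obtain ⟨c, hc, hang⟩ := hK.exists_le_inner_dir
  set M := (1 + 2 / c) * (2 + d) * C with hM
  have hC0 : 0 < C := by linarith
  have hM0 : 0 < M := by positivity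
  have hcc : 1 ≤ 1 + 2 / c := by
    have : 0 < 2 / c := by positivity
    linarith
  have hCM : C ≤ M := by
    have : 1 ≤ (1 + 2 / c) * (2 + d) := one_le_mul_of_one_le_of_one_le hcc (by linarith)
    exact le_mul_of_one_le_left hC0.le this
  refine ⟨min δ (min δ₁ c) / M, by positivity, fun p q hp hq m hm hdiff hA => ?_⟩
  rw [div_le_iff₀ hM0]
  set E := ‖p 0 - q 0‖ + ‖outDir p 0 - outDir q 0‖ with hE
  have hE0 : 0 ≤ E := by positivity
  have hpow : ∀ j : ℕ, j ≤ m → ∀ B, 0 ≤ B → B ≤ M → ∀ t, t ≤ B * E * Λ ^ j → t ≤ Λ ^ m * E * M := by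
    intro j hj B hB hBM t ht
    have h3 : Λ ^ j ≤ Λ ^ m := pow_le_pow_right₀ hΛ hj
    calc t ≤ B * E * Λ ^ j := ht
      _ ≤ M * E * Λ ^ m := by gcongr
      _ = _ := by ring
  by_cases hall : ∀ j : ℕ, j ≤ m → ‖p j - q j‖ ≤ δ
  · obtain ⟨g1, g2⟩ := hgrow p q hp hq m hm hA hall
    rcases le_or_gt ‖outDir p m - outDir q m‖ c with hη | hη
    · obtain ⟨i, hpi, hqi⟩ := hm m le_rfl
      obtain ⟨a, b, ha, hb, hab⟩ := hdiff
      have hs := hsep p q hp hq m i a b hpi hqi ha hb hab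
      have hpair := isReflectedPair hp hq hK hang (j := (m : ℤ) - 1) (by simpa using hpi)
        (by simpa using hqi)
      simp only [sub_add_cancel] at hpair
      have hX : ‖p m - q m‖ ≤ (1 + 2 / c) * ‖transvOut p q m‖ := hpair.norm_le_transv hc hη
      refine (min_le_right _ _).trans ((min_le_left _ _).trans
        (hpow m le_rfl ((1 + 2 / c) * C + C) (by positivity) ?_ δ₁ ?_))
      · rw [hM]
        nlinarith [mul_le_mul_of_nonneg_right hcc hC0.le,
          mul_nonneg (mul_nonneg (zero_le_one.trans hcc) hd0) hC0.le]
      · have := mul_le_mul_of_nonneg_left g2 (zero_le_one.trans hcc)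
        linarith
    · exact (min_le_right _ _).trans ((min_le_right _ _).trans
        (hpow m le_rfl C hC0.le hCM c (hη.le.trans g1)))
  · push Not at hall
    classical
    have hJ := Nat.find_spec hall
    have hmin := fun i => Nat.find_min hall (m := i)
    generalize Nat.find hall = J at hJ hmin
    obtain ⟨hJm, hJδ⟩ := hJ
    rcases J with _ | j
    · refine (min_le_left _ _).trans (hJδ.le.trans ?_)
      refine hpow 0 (Nat.zero_le _) 1 zero_le_one (hC.trans hCM) _ ?_
      simp only [Nat.cast_zero, pow_zero, mul_one, one_mul]
      linarith [norm_nonneg (outDir p 0 - outDir q 0)]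
    · obtain ⟨g1, g2⟩ := hgrow p q hp hq j (hm.mono (by omega)) hA (fun i hi => by
        by_contra! hcon
        exact hmin i (by omega) ⟨by omega, hcon⟩)
      rcases le_or_gt ‖outDir p j - outDir q j‖ c with hη | hη
      · refine (min_le_left _ _).trans (hJδ.le.trans ?_)
        obtain ⟨i, hpi, hqi⟩ := hm (j + 1) hJm
        push_cast at hpi hqi ⊢
        have hpair := isReflectedPair hp hq hK hang hpi hqi
        have hX : ‖p (j + 1) - q (j + 1)‖ ≤ (1 + 2 / c) * ‖transvIn p q j‖ :=
          hpair.norm_le_transv_incoming hc hη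
        have h3 := norm_transvIn_le hp hq hK j
        have h4 := mul_le_mul (meanFlight_le hd hp hq j) g1 (norm_nonneg _) hd0
        refine hpow j (by omega) ((1 + 2 / c) * (1 + d) * C) (by positivity) ?_ _ ?_
        · rw [hM]; gcongr; linarith
        · calc _ ≤ (1 + 2 / c) * (C * E * Λ ^ j + d * (C * E * Λ ^ j)) := by
                refine hX.trans ?_
                gcongr
                linarith
            _ = _ := by ring
      · exact (min_le_right _ _).trans ((min_le_right _ _).trans
          (hpow j (by omega) C hC0.le hCM c (hη.le.trans g1)))

end IsOrbit

end OpenBilliard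

namespace OpenBilliard

/-! ### Growth of the distance of two orbits: lower bounds -/

variable {D u : ℕ} {K : Fin u → Set (Space D)}

namespace IsOrbit

variable {p q : ℤ → Space D}

lemma norm_transvOut_le_transvIn (hp : IsOrbit K p) (hq : IsOrbit K q) (hK : IsOpenBilliard K)
    {j : ℤ} (h : 0 ≤ divergence p q j) : ‖transvOut p q j‖ ≤ ‖transvIn p q j‖ := by
  rw [← inner_transvOut hp hq hK] at h
  have := (flight_lower (meanFlight_nonneg p q j) le_rfl (by simpa using h)).1
  rwa [mul_zero, add_zero, one_mul, ← transvIn_eq hp hq hK] at this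

/-- By uniform strict convexity, the divergence of two orbits that are not close increases by a
definite amount. -/
lemma exists_divergence_add_le (hK : IsOpenBilliard K) {δ : ℝ} (hδ : 0 < δ) :
    ∃ α > 0, ∀ p q, IsOrbit K p → IsOrbit K q → ∀ j i k, p j ∈ K i → q j ∈ K i →
      p (j + 1) ∈ K k → q (j + 1) ∈ K k → 0 ≤ divergence p q j → δ ≤ ‖p j - q j‖ →
      divergence p q j + α ≤ divergence p q (j + 1) := by
  obtain ⟨c, hc, hang⟩ := hK.exists_le_inner_dir
  obtain ⟨e, he, hlen⟩ := exists_le_norm_succ_sub hK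
  have hδ' : 0 < δ / (1 + 2 / c) := by positivity
  obtain ⟨η, hη, hconv⟩ := exists_pos_forall (ι := Fin u)
    (P := fun i η => ∀ x ∈ frontier (K i), ∀ y ∈ K i, δ / (1 + 2 / c) ≤ ‖x - y‖ →
      η ≤ ⟪outerNormal (K i) x, x - y⟫_ℝ)
    (fun i a b hab hb x hx y hy hxy => hab.trans (hb x hx y hy hxy))
    (fun i => (hK.body i).exists_le_inner_outerNormal hδ')
  refine ⟨min (e * c ^ 2) (4 * c * η), by positivity,
    fun p q hp hq j i k hpi hqi hpk hqk hA hd => ?_⟩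
  rcases le_or_gt ‖outDir p j - outDir q j‖ c with hle | hgt
  · have hpair := isReflectedPair hp hq hK hang hpk hqk
    have hprev := isReflectedPair hp hq hK hang (j := j - 1) (by simpa using hpi)
      (by simpa using hqi)
    simp only [sub_add_cancel] at hprev
    have h1 : ‖p j - q j‖ ≤ (1 + 2 / c) * ‖transvOut p q j‖ := hprev.norm_le_transv hc hle
    have h2 : δ / (1 + 2 / c) ≤ ‖p (j + 1) - q (j + 1)‖ := by
      rw [div_le_iff₀ (by positivity), mul_comm]
      refine hd.trans (h1.trans ?_)
      gcongr
      exact (norm_transvOut_le_transvIn hp hq hK hA).trans (norm_transv_le _ _)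
    have h3 := hconv k _ (hp.mem_frontier hK hpk) _ hqk h2
    have h4 := hconv k _ (hq.mem_frontier hK hqk) _ hpk (by rwa [norm_sub_rev])
    rw [← neg_sub, inner_neg_right] at h4
    have h5 := hpair.inner_eq
    rw [inner_succ_eq hp hq hK] at h5
    have h6 := mul_le_mul hpair.le_v h3 hη.le (hc.le.trans hpair.le_v)
    have h7 := mul_le_mul hpair.le_w h4 hη.le (hc.le.trans hpair.le_w)
    have h8 := mul_nonneg (meanFlight_nonneg p q j) (sq_nonneg ‖outDir p j - outDir q j‖)
    have h9 : divergence p q (j + 1) = _ := h5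
    have := min_le_right (e * c ^ 2) (4 * c * η)
    linarith
  · have h1 := divergence_add_le hp hq hK hpk hqk
    have h0 := meanFlight_nonneg p q j
    have h2 : e * c ^ 2 ≤ meanFlight p q j * ‖outDir p j - outDir q j‖ ^ 2 := by
      have := le_meanFlight hlen hp hq j
      gcongr
    have := min_le_left (e * c ^ 2) (4 * c * η)
    linarith

lemma exists_norm_sub_le (hK : IsOpenBilliard K) :
    ∃ R > 0, ∀ p q, IsOrbit K p → IsOrbit K q → ∀ i j, ‖p i - q j‖ ≤ R := by
  obtain ⟨R, hR, hbd⟩ := hK.exists_norm_le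
  refine ⟨2 * R, by positivity, fun p q hp hq i j => (norm_sub_le _ _).trans ?_⟩
  obtain ⟨a, ha⟩ := hp.exists_mem hK i
  obtain ⟨b, hb⟩ := hq.exists_mem hK j
  linarith [hbd _ _ ha, hbd _ _ hb]

/-- Orbits that do not converge initially and visit the same obstacles for a long time are close
together, except in the last part of this time. -/
lemma exists_close_of_shareObstacles (hK : IsOpenBilliard K) {δ : ℝ} (hδ : 0 < δ) :
    ∃ N : ℕ, ∀ p q, IsOrbit K p → IsOrbit K q → ∀ m j : ℕ, ShareObstacles K p q m →
      0 ≤ divergence p q 0 → j + N ≤ m → ‖p j - q j‖ ≤ δ := by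
  obtain ⟨α₁, hα₁, h₁⟩ := exists_divergence_add_le hK hδ
  obtain ⟨α₂, hα₂, h₂⟩ := exists_divergence_add_le hK (half_pos hα₁)
  obtain ⟨R, hR, hbd⟩ := exists_norm_sub_le hK
  obtain ⟨n, hn⟩ := exists_nat_gt (2 * R / α₂)
  refine ⟨n + 1, fun p q hp hq m j hm hA hj => ?_⟩
  by_contra! hgt
  have hA' : ∀ i : ℕ, i ≤ m → 0 ≤ divergence p q i := fun i hi =>
    hA.trans (divergence_mono hp hq hK hm (Nat.zero_le i) hi)
  have hle : ∀ i : ℕ, divergence p q i ≤ ‖p i - q i‖ * 2 := fun i =>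
    (real_inner_le_norm _ _).trans (mul_le_mul_of_nonneg_left
      (norm_outDir_sub_le_two hp hq hK i) (norm_nonneg _))
  have hgrow : ∀ i : ℕ, j + 1 + i ≤ m → α₁ + i * α₂ ≤ divergence p q (j + 1 + i : ℕ) := by
    intro i
    induction i with
    | zero =>
      intro hi
      obtain ⟨a, ha, ha'⟩ := hm j (by omega)
      obtain ⟨b, hb, hb'⟩ := hm (j + 1) hi
      have h3 := hA' j (by omega)
      push_cast at hb hb' ⊢
      have h4 := h₁ p q hp hq j a b ha ha' hb hb' h3 hgt.le
      simp only [add_zero, zero_mul]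
      linarith
    | succ i ih =>
      intro hi
      have h3 := ih (by omega)
      obtain ⟨a, ha, ha'⟩ := hm (j + 1 + i) (by omega)
      obtain ⟨b, hb, hb'⟩ := hm (j + 1 + i + 1) hi
      have h5 : α₁ / 2 ≤ ‖p (j + 1 + i : ℕ) - q (j + 1 + i : ℕ)‖ := by
        have h4 := hle (j + 1 + i)
        have : 0 ≤ i * α₂ := by positivity
        linarith
      have h6 := hA' (j + 1 + i) (by omega)
      rw [← add_assoc]
      rw [Nat.cast_succ] at hb hb' ⊢
      have h7 := h₂ p q hp hq _ a b ha ha' hb hb' h6 h5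
      push_cast at h7 h3 ⊢
      linarith
  have h3 := hgrow n (by omega)
  have h4 := hle (j + 1 + n)
  have h5 := hbd p q hp hq (j + 1 + n : ℕ) (j + 1 + n : ℕ)
  rw [div_lt_iff₀ hα₂] at hn
  linarith

/-- Two orbits that do not converge initially and visit the same obstacles during `m` reflections
have an initial transversal distance of at most a constant times `Λ⁻ᵐ`. The quantity that grows
is `‖transvOut‖ * (k + β)`, where `k` bounds the curvature of a front from below. -/
lemma exists_separation_upper (hD : 2 ≤ D) (hK : IsOpenBilliard K) {κ : Fin u → ℝ}
    {γ d Λ β : ℝ} (hγ : 0 < γ)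
    (hκ : ∀ i, ∀ x ∈ reflectionPoints K i, ∀ w, IsUnitTangent (K i) x w →
      κ i ≤ normalCurvature (K i) x w)
    (hκγ : ∀ p, IsOrbit K p → ∀ j i, p j ∈ K i →
      γ ≤ κ i * ⟪outDir p j, outerNormal (K i) (p j)⟫_ℝ ^ iotaExp D)
    (hd : ∀ p, IsOrbit K p → ∀ j, d ≤ ‖p (j + 1) - p j‖) (hβ : 0 < β)
    (hΛ : 1 ≤ Λ) (h1 : Λ * β < 2 * γ + β) (h2 : Λ - 1 < d * (2 * γ + β)) :
    ∃ C > 0, ∀ p q, IsOrbit K p → IsOrbit K q → ∀ m : ℕ, ShareObstacles K p q m →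
      0 ≤ divergence p q 0 → Λ ^ m * ‖transvOut p q 0‖ ≤ C := by
  obtain ⟨ε, hε, hε1, hε2, hε3⟩ := exists_pos_le_of_continuous
    (f := fun ε : ℝ => Λ * β - (1 - ε) ^ 2 * (2 * γ - ε + β)) (a := 0)
    (g := fun ε : ℝ => Λ - (1 - ε) ^ 2 * (1 + d * (2 * γ - ε + β))) (b := 0)
    (by fun_prop) (by fun_prop) (by linarith) (by linarith)
  set G := 2 * γ - ε + β with hG
  have hβG : β ≤ G := by
    have h3 : β ≤ (1 - ε) ^ 2 * G := by
      have := le_mul_of_one_le_left hβ.le hΛ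
      linarith
    have h4 : 0 < G := pos_of_mul_pos_right (hβ.trans_le h3) (sq_nonneg _)
    exact h3.trans (mul_le_of_le_one_left h4.le (pow_le_one₀ (by linarith) (by linarith)))
  obtain ⟨δ, hδ, hrefl⟩ := exists_reflection_lower hD hK hγ hκ hκγ hε hε1
  obtain ⟨N, hclose⟩ := exists_close_of_shareObstacles hK hδ
  obtain ⟨R, hR, hbd⟩ := exists_norm_sub_le hK
  have key : ∀ p q, IsOrbit K p → IsOrbit K q → ∀ m : ℕ, ShareObstacles K p q m →
      0 ≤ divergence p q 0 → ∀ j : ℕ, j + N ≤ m → ∃ k, 0 ≤ k ∧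
      k * ‖transvOut p q j‖ ^ 2 ≤ divergence p q j ∧
      Λ ^ j * (β * ‖transvOut p q 0‖) ≤ ‖transvOut p q j‖ * (k + β) := by
    intro p q hp hq m hm hA j
    induction j with
    | zero =>
      intro _
      exact ⟨0, le_rfl, by simpa using hA, by simp [mul_comm]⟩
    | succ j ih =>
      intro hj
      obtain ⟨k, hk, hk1, hk2⟩ := ih (by omega)
      have c0 := hclose p q hp hq m j hm hA (by omega)
      have c1 := hclose p q hp hq m (j + 1) hm hA hj
      obtain ⟨i, hpi, hqi⟩ := hm (j + 1) (by omega)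
      push_cast at hpi hqi c1 ⊢
      obtain ⟨r1, r2⟩ := hrefl p q hp hq j i hpi hqi c0 c1
      have hθd := le_meanFlight hd hp hq j
      have hθ0 := meanFlight_nonneg p q j
      rw [← inner_transvOut hp hq hK] at hk1
      obtain ⟨f1, f2⟩ := flight_lower hθ0 hk hk1
      rw [← transvIn_eq hp hq hK, inner_transvIn hp hq hK] at f2
      rw [← transvIn_eq hp hq hK] at f1
      set θ := meanFlight p q j with hθ
      have hpos : 0 < 1 + θ * k := by positivity
      have hk' := r1 (k / (1 + θ * k)) (by positivity) f2
      have hk0 : 0 ≤ (1 - ε) * (k / (1 + θ * k)) :=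
        mul_nonneg (by linarith) (by positivity)
      refine ⟨(1 - ε) * (k / (1 + θ * k)) + 2 * γ - ε, by linarith, hk', ?_⟩
      have hX := norm_nonneg (transvOut p q j)
      have hε' : 0 ≤ 1 - ε := by linarith
      have h4 : Λ * (k + β) ≤ (1 - ε) ^ 2 * (k * (1 + θ * G) + G) := by
        have h5 : k * Λ ≤ k * ((1 - ε) ^ 2 * (1 + θ * G)) := by
          refine mul_le_mul_of_nonneg_left (le_trans (sub_nonpos.1 hε3) ?_) hk
          gcongr
          linarith
        linarith
      have h6 : (1 - ε) ^ 2 * G ≤ (1 - ε) * G := by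
        rw [sq]
        have : (1 - ε) * (1 - ε) ≤ (1 - ε) := mul_le_of_le_one_left hε' (by linarith)
        exact mul_le_mul_of_nonneg_right this (hβ.le.trans hβG)
      calc Λ ^ (j + 1) * (β * ‖transvOut p q 0‖)
          = Λ * (Λ ^ j * (β * ‖transvOut p q 0‖)) := by ring
        _ ≤ Λ * (‖transvOut p q j‖ * (k + β)) := by gcongr
        _ = ‖transvOut p q j‖ * (Λ * (k + β)) := by ring
        _ ≤ ‖transvOut p q j‖ * ((1 - ε) ^ 2 * (k * (1 + θ * G) + G)) := by gcongr
        _ = ‖transvOut p q j‖ * ((1 - ε) ^ 2 * k + (1 - ε) ^ 2 * G * (1 + θ * k)) := by ring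
        _ ≤ ‖transvOut p q j‖ * ((1 - ε) ^ 2 * k + (1 - ε) * G * (1 + θ * k)) := by gcongr
        _ = (1 - ε) * ((1 + θ * k) * ‖transvOut p q j‖)
              * ((1 - ε) * (k / (1 + θ * k)) + G) := by field_simp
        _ ≤ (1 - ε) * ‖transvIn p q j‖ * ((1 - ε) * (k / (1 + θ * k)) + G) := by
            have : 0 ≤ (1 - ε) * (k / (1 + θ * k)) + G := by linarith
            gcongr
        _ ≤ ‖transvOut p q (j + 1)‖ * ((1 - ε) * (k / (1 + θ * k)) + G) := by
            have : 0 ≤ (1 - ε) * (k / (1 + θ * k)) + G := by linarith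
            gcongr
        _ = _ := by rw [hG]; ring
  refine ⟨Λ ^ N * ((2 + R * β) / β + R), by positivity, fun p q hp hq m hm hA => ?_⟩
  have hX0 := (norm_transvOut_le p q 0).trans (hbd p q hp hq 0 0)
  have hc : 0 ≤ (2 + R * β) / β := by positivity
  rcases le_or_gt N m with hNm | hmN
  · obtain ⟨j, rfl⟩ := Nat.exists_eq_add_of_le' hNm
    obtain ⟨k, hk, hk1, hk2⟩ := key p q hp hq _ hm hA j le_rfl
    have h3 : ‖transvOut p q j‖ * k ≤ 2 := by
      rcases (norm_nonneg (transvOut p q j)).eq_or_lt with h0 | h0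
      · rw [← h0]; norm_num
      · refine le_of_mul_le_mul_right ?_ h0
        have h4 := divergence_le hp hq hK j
        have h5 := mul_le_mul_of_nonneg_left (norm_outDir_sub_le_two hp hq hK j) h0.le
        linarith [sq ‖transvOut p q j‖]
    have h6 := (norm_transvOut_le p q j).trans (hbd p q hp hq j j)
    have h7 := mul_le_mul_of_nonneg_right h6 hβ.le
    have h8 : Λ ^ j * ‖transvOut p q 0‖ ≤ (2 + R * β) / β := by
      rw [le_div_iff₀ hβ]
      linarith
    calc Λ ^ (j + N) * ‖transvOut p q 0‖ = Λ ^ N * (Λ ^ j * ‖transvOut p q 0‖) := by ring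
      _ ≤ Λ ^ N * ((2 + R * β) / β + R) := by gcongr; linarith
  · have : Λ ^ m ≤ Λ ^ N := pow_le_pow_right₀ hΛ hmN.le
    gcongr
    linarith

end IsOrbit

end OpenBilliard

namespace OpenBilliard

/-! ### Trajectories that start on a convex front -/

variable {D u : ℕ} {K : Fin u → Set (Space D)}

lemma IsSmoothBody.exists_norm_outerNormal_sub_le_mul {A : Set (Space D)} (hA : IsSmoothBody A) :
    ∃ M > 0, ∀ x ∈ frontier A, ∀ y ∈ frontier A,
      ‖outerNormal A x - outerNormal A y‖ ≤ M * ‖x - y‖ := by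
  obtain ⟨M, hM⟩ := hA.exists_normalCurvature_le
  obtain ⟨δ, hδ, h⟩ := hA.exists_cocoercive_outerNormal subset_rfl (κ := max M 0) (ε := 1)
    (le_max_right _ _) one_pos (fun p hp w hw => (hM p hp w hw).trans (le_max_left _ _))
  have hM0 : 0 ≤ max M 0 := le_max_right _ _
  refine ⟨max M 0 + 1 + 2 / δ, by positivity, fun x hx y hy => ?_⟩
  have h2δ : 0 < 2 / δ := by positivity
  have h0 := norm_nonneg (x - y)
  rcases lt_or_ge ‖x - y‖ δ with hlt | hge
  · have h1 := h x hx y hy hlt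
    have h2 := mul_le_mul_of_nonneg_left (real_inner_le_norm (x - y)
      (outerNormal A x - outerNormal A y)) (by positivity : 0 ≤ max M 0 + 1)
    have h3 : ‖outerNormal A x - outerNormal A y‖ ≤ (max M 0 + 1) * ‖x - y‖ := by
      rcases (norm_nonneg (outerNormal A x - outerNormal A y)).eq_or_lt with h4 | h4
      · rw [← h4]; positivity
      · refine le_of_mul_le_mul_right ?_ h4
        linarith [sq ‖outerNormal A x - outerNormal A y‖]
    exact h3.trans (mul_le_mul_of_nonneg_right (by linarith) h0)
  · have h1 : ‖outerNormal A x - outerNormal A y‖ ≤ 2 := by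
      refine (norm_sub_le _ _).trans ?_
      rw [hA.norm_outerNormal hx, hA.norm_outerNormal hy]; norm_num
    calc _ ≤ 2 / δ * δ := by rwa [div_mul_cancel₀ _ hδ.ne']
      _ ≤ 2 / δ * ‖x - y‖ := by gcongr
      _ ≤ _ := by gcongr; linarith

/-- Two orbits that run through points `x` and `y` of a convex front, on the flights from `p 0` to
`p 1` and from `q 0` to `q 1`; `τ` and `σ` are the distances to `p 1` and `q 1`. After the points
`x` and `y`, the first `n` reflections are on common obstacles, and the next ones are not. -/
structure IsFrontPair (K : Fin u → Set (Space D)) (n : ℕ) (x y : Space D) (p q : ℤ → Space D)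
    (τ σ : ℝ) : Prop where
  left : IsOrbit K p
  right : IsOrbit K q
  left_mem : τ ∈ Icc 0 ‖p 1 - p 0‖
  right_mem : σ ∈ Icc 0 ‖q 1 - q 0‖
  left_eq : p 1 = x + τ • outDir p 0
  right_eq : q 1 = y + σ • outDir q 0
  left_convex : 0 ≤ ⟪outDir p 0, x - y⟫_ℝ
  right_convex : 0 ≤ ⟪outDir q 0, y - x⟫_ℝ
  share : ∀ j : ℕ, j < n → ∃ i, p (j + 1) ∈ K i ∧ q (j + 1) ∈ K i
  separate : ∃ a b, p (n + 1) ∈ K a ∧ q (n + 1) ∈ K b ∧ a ≠ b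

lemma PassesThrough.exists_flight {p : ℤ → Space D} {x : Space D × Space D}
    (h : PassesThrough K p x) :
    ∃ τ ∈ Icc 0 ‖p 1 - p 0‖, p 1 = x.1 + τ • outDir p 0 := by
  obtain ⟨-, ⟨s, hs, hx⟩, -⟩ := h
  refine ⟨(1 - s) * ‖p 1 - p 0‖, ⟨mul_nonneg (by linarith [hs.2]) (norm_nonneg _),
    mul_le_of_le_one_left (norm_nonneg _) (by linarith [hs.1])⟩, ?_⟩
  rw [outDir, zero_add, mul_smul, norm_smul_unitDir, hx, AffineMap.lineMap_apply, vsub_eq_sub,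
    vadd_eq_add]
  module

lemma SeparateAfter.exists_isFrontPair {X : Set (Space D)} {ν : Space D → Space D}
    (hX : IsConvexFront K X ν) {n : ℕ} {x y : Space D × Space D} (hx : x ∈ trappedFront K X ν)
    (hy : y ∈ trappedFront K X ν) (h : SeparateAfter K n x y) :
    ∃ p q τ σ, IsFrontPair K n x.1 y.1 p q τ σ ∧ outDir p 0 = ν x.1 ∧ outDir q 0 = ν y.1 := by
  obtain ⟨α, β, ⟨p, hp, hpα⟩, ⟨q, hq, hqβ⟩, hshare, hsep⟩ := h
  obtain ⟨τ, hτ, hpx⟩ := hp.exists_flight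
  obtain ⟨σ, hσ, hqy⟩ := hq.exists_flight
  have hv : outDir p 0 = ν x.1 := hp.2.2.symm.trans hx.1.2
  have hw : outDir q 0 = ν y.1 := hq.2.2.symm.trans hy.1.2
  have hconv : ∀ a ∈ X, ∀ b ∈ X, 0 ≤ ⟪ν a, a - b⟫_ℝ := by
    intro a ha b hb
    rcases eq_or_ne b a with rfl | hne
    · simp
    · have := hX.strictlyConvex a ha b hb hne
      rw [← neg_sub, inner_neg_right]
      linarith
  refine ⟨p, q, τ, σ, ⟨hp.1, hq.1, hτ, hσ, hpx, hqy, ?_, ?_, ?_, ?_⟩, hv, hw⟩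
  · rw [hv]; exact hconv _ hx.1.1 _ hy.1.1
  · rw [hw]; exact hconv _ hy.1.1 _ hx.1.1
  · exact fun j hj => ⟨α j, hpα j, by rw [hshare j hj]; exact hqβ j⟩
  · exact ⟨α n, β n, hpα n, hqβ n, hsep⟩

namespace IsFrontPair

variable {n : ℕ} {x y : Space D} {p q : ℤ → Space D} {τ σ : ℝ}

lemma symm (h : IsFrontPair K n x y p q τ σ) : IsFrontPair K n y x q p σ τ where
  left := h.right
  right := h.left
  left_mem := h.right_mem
  right_mem := h.left_mem
  left_eq := h.right_eq
  right_eq := h.left_eq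
  left_convex := h.right_convex
  right_convex := h.left_convex
  share j hj := by
    obtain ⟨i, h1, h2⟩ := h.share j hj
    exact ⟨i, h2, h1⟩
  separate := by
    obtain ⟨a, b, h1, h2, h3⟩ := h.separate
    exact ⟨b, a, h2, h1, h3.symm⟩

lemma sub_eq (h : IsFrontPair K n x y p q τ σ) :
    p 1 - q 1 = x - y + τ • outDir p 0 - σ • outDir q 0 := by
  rw [h.left_eq, h.right_eq]; abel

lemma abs_inner_add_le (h : IsFrontPair K n x y p q τ σ) :
    |⟪x - y, outDir p 0 + outDir q 0⟫_ℝ| ≤ ⟪x - y, outDir p 0 - outDir q 0⟫_ℝ := by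
  have h1 := h.left_convex
  have h2 := h.right_convex
  rw [← neg_sub, inner_neg_right] at h2
  rw [inner_add_right, inner_sub_right, real_inner_comm (outDir p 0), real_inner_comm (outDir q 0),
    abs_le]
  constructor <;> linarith

lemma transvIn_eq (h : IsFrontPair K n x y p q τ σ) (hK : IsOpenBilliard K) :
    transvIn p q 0 = transv (outDir p 0 + outDir q 0) (x - y)
      + ((τ + σ) / 2) • (outDir p 0 - outDir q 0) := by
  rw [transvIn, zero_add, h.sub_eq,
    transv_flight ((h.left.norm_outDir hK 0).trans (h.right.norm_outDir hK 0).symm)]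

/-- Convexity of the front makes the transversal distance comparable to the distance. -/
lemma norm_sub_le_transvIn (h : IsFrontPair K n x y p q τ σ) (hK : IsOpenBilliard K)
    (hη : ‖outDir p 0 - outDir q 0‖ ≤ 1) : ‖x - y‖ ≤ 2 * ‖transvIn p q 0‖ := by
  have hv := h.left.norm_outDir hK 0
  have hw := h.right.norm_outDir hK 0
  set ξ := transv (outDir p 0 + outDir q 0) (x - y) with hξ
  have hA := h.abs_inner_add_le
  have hξη : ⟪ξ, outDir p 0 - outDir q 0⟫_ℝ = ⟪x - y, outDir p 0 - outDir q 0⟫_ℝ :=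
    inner_transv _ (inner_add_sub_of_norm_eq (hv.trans hw.symm))
  have hA0 : 0 ≤ ⟪ξ, outDir p 0 - outDir q 0⟫_ℝ := by
    rw [hξη]; exact (abs_nonneg _).trans hA
  have h1 : ‖ξ‖ ≤ ‖transvIn p q 0‖ := by
    have hτσ : 0 ≤ (τ + σ) / 2 := by linarith [h.left_mem.1, h.right_mem.1]
    have := (flight_lower hτσ le_rfl (by simpa using hA0)).1
    rwa [mul_zero, add_zero, one_mul, ← h.transvIn_eq hK] at this
  have h2 : ⟪x - y, outDir p 0 + outDir q 0⟫_ℝ ^ 2 ≤ ‖ξ‖ ^ 2 := by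
    refine sq_le_sq' ?_ ?_
    all_goals
      have h3 := real_inner_le_norm ξ (outDir p 0 - outDir q 0)
      have h4 := mul_le_of_le_one_right (norm_nonneg ξ) hη
      have h5 := abs_le.1 hA
      linarith [h5.1, h5.2]
  have h3 : ‖ξ‖ ^ 2 = ‖x - y‖ ^ 2 - _ := norm_transv_sq _ _
  have h4 : (3 : ℝ) ≤ ‖outDir p 0 + outDir q 0‖ ^ 2 := by
    rw [norm_add_sq_of_unit hv hw]
    have := pow_le_one₀ (n := 2) (norm_nonneg _) hη
    linarith
  have h5 : ⟪x - y, outDir p 0 + outDir q 0⟫_ℝ ^ 2 / ‖outDir p 0 + outDir q 0‖ ^ 2 ≤ ‖ξ‖ ^ 2 :=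
    (div_le_self (sq_nonneg _) (by linarith)).trans h2
  have h6 : ‖x - y‖ ≤ 2 * ‖ξ‖ := by
    refine le_of_sq_le_sq ?_ (by positivity)
    rw [mul_pow]
    linarith [sq_nonneg ‖ξ‖]
  linarith

lemma divergence_nonneg (h : IsFrontPair K n x y p q τ σ) (hK : IsOpenBilliard K) (hn : 0 < n) :
    0 ≤ divergence p q 1 := by
  obtain ⟨i, hpi, hqi⟩ := h.share 0 hn
  simp only [Nat.cast_zero, zero_add] at hpi hqi
  obtain ⟨c, hc, hang⟩ := hK.exists_le_inner_dir
  have hpair := IsOrbit.isReflectedPair h.left h.right hK hang (j := 0) (by simpa using hpi)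
    (by simpa using hqi)
  simp only [zero_add] at hpair
  have h1 := hpair.inner_eq
  have h2 := mul_nonneg (hc.le.trans hpair.le_v) hpair.inner_n
  have h3 := mul_nonneg (hc.le.trans hpair.le_w) (neg_nonneg.2 hpair.inner_m)
  rw [h.sub_eq, inner_flight (h.left.norm_outDir hK 0) (h.right.norm_outDir hK 0), ← h.sub_eq]
    at h1
  have h4 := (abs_nonneg _).trans h.abs_inner_add_le
  have h5 : 0 ≤ (τ + σ) / 2 := by linarith [h.left_mem.1, h.right_mem.1]
  have h6 := mul_nonneg h5 (sq_nonneg ‖outDir p 0 - outDir q 0‖)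
  rw [divergence, h1]
  linarith

lemma shareObstacles (h : IsFrontPair K n x y p q τ σ) {m : ℕ} (hm : m < n) :
    ShareObstacles K (fun j => p (j + 1)) (fun j => q (j + 1)) m :=
  fun j hj => h.share j (by omega)

lemma left_mem_segment (h : IsFrontPair K n x y p q τ σ) : x ∈ segment ℝ (p 0) (p 1) := by
  rcases (norm_nonneg (p 1 - p 0)).eq_or_lt with h0 | h0
  · have h1 := h.left_mem
    rw [← h0, Icc_self, mem_singleton_iff] at h1
    have h2 := h.left_eq
    rw [h1, zero_smul, add_zero] at h2
    rw [h2]; exact right_mem_segment ℝ _ _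
  · rw [segment_symm, segment_eq_image']
    refine ⟨τ / ‖p 1 - p 0‖, ⟨div_nonneg h.left_mem.1 h0.le, (div_le_one h0).2 h.left_mem.2⟩, ?_⟩
    have h1 : x = p 1 - τ • outDir p 0 := by rw [h.left_eq]; abel
    have h2 : p 0 - p 1 = -(‖p 1 - p 0‖ • outDir p 0) := by
      rw [outDir, zero_add, norm_smul_unitDir]; abel
    simp only [h1, h2, smul_neg, smul_smul, div_mul_cancel₀ _ h0.ne']
    abel

lemma exists_norm_sub_le (hK : IsOpenBilliard K) :
    ∃ R > 0, ∀ n x y p q τ σ, IsFrontPair K n x y p q τ σ → ‖x - y‖ ≤ R := by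
  obtain ⟨R, hR, hbd⟩ := hK.exists_norm_le
  have key : ∀ n x y p q τ σ, IsFrontPair K n x y p q τ σ → ‖x‖ ≤ R := by
    intro n x y p q τ σ h
    obtain ⟨a, ha⟩ := h.left.exists_mem hK 0
    obtain ⟨b, hb⟩ := h.left.exists_mem hK 1
    have := (convex_closedBall (0 : Space D) R).segment_subset (by simpa using hbd _ _ ha)
      (by simpa using hbd _ _ hb) h.left_mem_segment
    simpa using this
  refine ⟨2 * R, by positivity, fun n x y p q τ σ h => (norm_sub_le _ _).trans ?_⟩
  linarith [key _ _ _ _ _ _ _ h, key _ _ _ _ _ _ _ h.symm]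

/-- Points of a front whose trajectories visit the same obstacles for a long time are close. -/
lemma exists_upper (hD : 2 ≤ D) (hK : IsOpenBilliard K) {κ : Fin u → ℝ}
    {γ d Λ β : ℝ} (hγ : 0 < γ)
    (hκ : ∀ i, ∀ x ∈ reflectionPoints K i, ∀ w, IsUnitTangent (K i) x w →
      κ i ≤ normalCurvature (K i) x w)
    (hκγ : ∀ p, IsOrbit K p → ∀ j i, p j ∈ K i →
      γ ≤ κ i * ⟪outDir p j, outerNormal (K i) (p j)⟫_ℝ ^ iotaExp D)
    (hd : ∀ p, IsOrbit K p → ∀ j, d ≤ ‖p (j + 1) - p j‖) (hβ : 0 < β)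
    (hΛ : 1 ≤ Λ) (h1 : Λ * β < 2 * γ + β) (h2 : Λ - 1 < d * (2 * γ + β)) :
    ∃ C > 0, ∀ n x y p q τ σ, IsFrontPair K n x y p q τ σ → Λ ^ n * ‖x - y‖ ≤ C := by
  obtain ⟨C, hC, hsep⟩ := IsOrbit.exists_separation_upper hD hK hγ hκ hκγ hd hβ hΛ h1 h2
  obtain ⟨R, hR, hbd⟩ := exists_norm_sub_le hK
  obtain ⟨c, hc, hang⟩ := hK.exists_le_inner_dir
  obtain ⟨δ, hδ, hdir⟩ := IsOrbit.exists_norm_outDir_sub_le hK (ε := min 1 c) (by positivity)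
  obtain ⟨N, hclose⟩ := IsOrbit.exists_close_of_shareObstacles hK hδ
  refine ⟨Λ ^ (N + 2) * R + Λ * (2 * (1 + 2 / c) * C), by positivity,
    fun n x y p q τ σ h => ?_⟩
  have hP : 0 ≤ Λ * (2 * (1 + 2 / c) * C) := by positivity
  have hP' : 0 ≤ Λ ^ (N + 2) * R := by positivity
  rcases lt_or_ge n (N + 2) with hn | hn
  · have h3 : Λ ^ n * ‖x - y‖ ≤ Λ ^ (N + 2) * R :=
      mul_le_mul (pow_le_pow_right₀ hΛ hn.le) (hbd _ _ _ _ _ _ _ h) (norm_nonneg _) (by positivity)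
    linarith
  obtain ⟨m, rfl⟩ : ∃ m, n = m + 1 := ⟨n - 1, by omega⟩
  have hp1 := h.left.shift 1
  have hq1 := h.right.shift 1
  have hsh := h.shareObstacles (Nat.lt_succ_self m)
  have hA : 0 ≤ divergence (fun j => p (j + 1)) (fun j => q (j + 1)) 0 :=
    h.divergence_nonneg hK (by omega)
  have hX : Λ ^ m * ‖transvOut p q 1‖ ≤ C := hsep _ _ hp1 hq1 m hsh hA
  have c1 := hclose _ _ hp1 hq1 m 0 hsh hA (by omega)
  have c2 := hclose _ _ hp1 hq1 m 1 hsh hA (by omega)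
  obtain ⟨i, hpi, hqi⟩ := h.share 0 (by omega)
  simp only [Nat.cast_zero, Nat.cast_one, zero_add] at hpi hqi c1 c2
  -- the velocities before and after the first reflection, by time reversal
  obtain ⟨d1, d0, -⟩ := hdir _ _ (h.left.reverse hK) (h.right.reverse hK) (-2) i
    (by simpa using hpi) (by simpa using hqi) (by simpa using c2) (by simpa using c1)
  have e1 : ∀ r : ℤ → Space D, outDir (fun j => r (-j)) (-2) = -outDir r 1 := fun r => by
    rw [outDir, outDir, ← unitDir_swap]; rfl
  have e0 : ∀ r : ℤ → Space D, outDir (fun j => r (-j)) (-2 + 1) = -outDir r 0 := fun r => by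
    rw [outDir, outDir, ← unitDir_swap]; rfl
  rw [e1, e1, neg_sub_neg, norm_sub_rev] at d1
  rw [e0, e0, neg_sub_neg, norm_sub_rev] at d0
  have hpair := IsOrbit.isReflectedPair h.left h.right hK hang (j := 0) (by simpa using hpi)
    (by simpa using hqi)
  simp only [zero_add] at hpair
  have h3 := h.norm_sub_le_transvIn hK (d0.trans (min_le_left _ _))
  have h4 : ‖transvIn p q 0‖ ≤ ‖p (0 + 1) - q (0 + 1)‖ := norm_transv_le _ _
  have h5 : ‖p 1 - q 1‖ ≤ (1 + 2 / c) * ‖transvOut p q 1‖ :=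
    hpair.norm_le_transv hc (d1.trans (min_le_right _ _))
  rw [zero_add] at h4
  have h6 : ‖x - y‖ ≤ 2 * (1 + 2 / c) * ‖transvOut p q 1‖ := by linarith
  have h7 : Λ ^ (m + 1) * ‖x - y‖ ≤ Λ * (2 * (1 + 2 / c) * C) := by
    calc Λ ^ (m + 1) * ‖x - y‖ ≤ Λ ^ (m + 1) * (2 * (1 + 2 / c) * ‖transvOut p q 1‖) := by gcongr
      _ = Λ * (2 * (1 + 2 / c) * (Λ ^ m * ‖transvOut p q 1‖)) := by ring
      _ ≤ _ := by gcongr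
  linarith

/-- Points of a front whose trajectories have their first reflections on different obstacles are
not close. If the ray from `y` comes from the obstacle that the ray from `x` hits next, this is
because both rays are transversal to this obstacle, in opposite directions. -/
lemma exists_le_of_zero (hK : IsOpenBilliard K) {d L : ℝ} (hd0 : 0 ≤ d)
    (hd : ∀ p, IsOrbit K p → ∀ j, ‖p (j + 1) - p j‖ ≤ d) (hL : 0 ≤ L) :
    ∃ c > 0, ∀ x y p q τ σ, IsFrontPair K 0 x y p q τ σ →
      ‖outDir p 0 - outDir q 0‖ ≤ L * ‖x - y‖ → c ≤ ‖x - y‖ := by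
  obtain ⟨e, he, hecl⟩ := hK.exists_le_norm_sub
  obtain ⟨c, hc, hang⟩ := hK.exists_le_inner_dir
  choose M hM hlip using fun i => (hK.body i).exists_norm_outerNormal_sub_le_mul
  obtain ⟨B, hB⟩ : ∃ B, ∀ i, M i ≤ B := by
    obtain ⟨B, hB⟩ := (Set.finite_range M).bddAbove
    exact ⟨B, fun i => hB (mem_range_self i)⟩
  set c₁ := min (e / (1 + d * L)) (2 * c / (|B| * ((1 + 1 / c) * (1 + d * L)) + L + 1)) with hc₁
  have main : ∀ x y p q τ σ, IsFrontPair K 0 x y p q τ σ →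
      ‖outDir p 0 - outDir q 0‖ ≤ L * ‖x - y‖ → τ ≤ σ → c₁ ≤ ‖x - y‖ := by
    intro x y p q τ σ h hη hτσ
    obtain ⟨a, b, hpa, hqb, hab⟩ := h.separate
    simp only [Nat.cast_zero, zero_add] at hpa hqb
    obtain ⟨k, hqk⟩ := h.right.exists_mem hK 0
    set w := outDir q 0 with hw
    set v := outDir p 0 with hv
    set z := y + τ • w with hz
    have hq0 : q 1 = q 0 + ‖q 1 - q 0‖ • w := by
      rw [hw, outDir, zero_add, norm_smul_unitDir]; abel
    set t := ‖q 1 - q 0‖ - σ + τ with ht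
    have ht0 : 0 ≤ t := by linarith [h.right_mem.2, h.left_mem.1]
    have hzq : z = q 0 + t • w := by
      have : y = q 0 + ‖q 1 - q 0‖ • w - σ • w := by rw [← hq0, h.right_eq]; abel
      rw [hz, this, ht]; module
    have hρ : ‖z - p 1‖ ≤ (1 + d * L) * ‖x - y‖ := by
      have e1 : z - p 1 = -(x - y) - τ • (v - w) := by rw [hz, h.left_eq]; module
      have hτd : τ ≤ d := h.left_mem.2.trans (by simpa using hd p h.left 0)
      rw [e1]
      calc _ ≤ ‖x - y‖ + τ * ‖v - w‖ := by
            refine (norm_sub_le _ _).trans ?_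
            rw [norm_neg, norm_smul, Real.norm_of_nonneg h.left_mem.1]
        _ ≤ ‖x - y‖ + d * (L * ‖x - y‖) := by
            gcongr
        _ = _ := by ring
    by_cases hak : a = k
    · subst hak
      have hfq := h.right.mem_frontier hK hqk
      have hfp := h.left.mem_frontier hK hpa
      have h1 := hang q h.right 0 a hqk
      have h2 := (h.left.reflect hK (j := 1) hpa).2
      have h3 := hang p h.left 1 a hpa
      set n := outerNormal (K a) (q 0) with hn
      set m := outerNormal (K a) (p 1) with hm
      have hnn : ‖n‖ = 1 := (hK.body a).norm_outerNormal hfq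
      have hmn : ‖m‖ = 1 := (hK.body a).norm_outerNormal hfp
      have h4 : 0 ≤ ⟪n, q 0 - p 1⟫_ℝ := (hK.body a).inner_outerNormal_nonneg hfq hpa
      have h5 : c ≤ ⟪w, n⟫_ℝ := h1
      have h6 : ⟪v, m⟫_ℝ ≤ -c := by
        have : ⟪v, m⟫_ℝ = _ := h2
        linarith
      -- the point `z` is close to `q 0`, because it is close to the obstacle
      have h7 : c * t ≤ ‖z - p 1‖ := by
        have e1 : ⟪n, z - p 1⟫_ℝ = ⟪n, q 0 - p 1⟫_ℝ + t * ⟪w, n⟫_ℝ := by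
          rw [hzq, add_sub_right_comm, inner_add_right, real_inner_smul_right, real_inner_comm w]
        have h8 := real_inner_le_norm n (z - p 1)
        rw [hnn, one_mul, e1] at h8
        have := mul_le_mul_of_nonneg_left h5 ht0
        linarith
      have h8 : ‖q 0 - p 1‖ ≤ (1 + 1 / c) * ((1 + d * L) * ‖x - y‖) := by
        have e1 : q 0 - p 1 = (z - p 1) - t • w := by rw [hzq]; abel
        have h9 : t ≤ 1 / c * ‖z - p 1‖ := by
          rw [div_mul_eq_mul_div, one_mul, le_div_iff₀ hc]; linarith
        calc _ ≤ ‖z - p 1‖ + t := by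
              rw [e1]
              refine (norm_sub_le _ _).trans ?_
              rw [norm_smul, h.right.norm_outDir hK, mul_one, Real.norm_of_nonneg ht0]
          _ ≤ (1 + 1 / c) * ‖z - p 1‖ := by linarith
          _ ≤ _ := by gcongr
      have h9 : ‖n - m‖ ≤ |B| * ((1 + 1 / c) * ((1 + d * L) * ‖x - y‖)) :=
        (hlip a _ hfq _ hfp).trans (mul_le_mul ((hB a).trans (le_abs_self B)) h8 (norm_nonneg _)
          (abs_nonneg B))
      have h10 : 2 * c ≤ ‖n - m‖ + ‖v - w‖ := by
        have e1 : ⟪w, n⟫_ℝ - ⟪v, m⟫_ℝ = ⟪w, n - m⟫_ℝ - ⟪v - w, m⟫_ℝ := by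
          rw [inner_sub_left, inner_sub_right]; ring
        have a1 := real_inner_le_norm w (n - m)
        have a2 := (abs_le.1 (abs_real_inner_le_norm (v - w) m)).1
        rw [h.right.norm_outDir hK, one_mul] at a1
        rw [hmn, mul_one] at a2
        linarith
      refine (min_le_right _ _).trans ?_
      rw [div_le_iff₀ (by positivity)]
      have h11 := norm_nonneg (x - y)
      linarith
    · refine (min_le_left _ _).trans ?_
      have hseg : z ∈ segment ℝ (q 0) (q 1) := by
        have hpos : 0 < ‖q 1 - q 0‖ := by
          have := h.right.ne_succ hK 0
          rw [zero_add] at this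
          exact norm_pos_iff.2 (sub_ne_zero.2 this.symm)
        rw [segment_eq_image']
        refine ⟨t / ‖q 1 - q 0‖, ⟨by positivity, (div_le_one hpos).2 (by linarith)⟩, ?_⟩
        have e1 : q 1 - q 0 = ‖q 1 - q 0‖ • w := by nth_rw 1 [hq0]; abel
        simp only [hzq]
        nth_rw 2 [e1]
        rw [smul_smul, div_mul_cancel₀ _ hpos.ne']
      have h1 := hecl k b a hak hab _ hqk _ hqb _ hseg _ hpa
      rw [div_le_iff₀ (by positivity)]
      linarith
  refine ⟨c₁, by positivity, fun x y p q τ σ h hη => ?_⟩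
  rcases le_total τ σ with hle | hle
  · exact main x y p q τ σ h hη hle
  · have := main y x q p σ τ h.symm (by rwa [norm_sub_rev, norm_sub_rev y]) hle
    rwa [norm_sub_rev] at this

/-- Points of a front whose trajectories separate after `n` reflections have at least a distance
of order `Λ⁻ⁿ`. -/
lemma exists_lower (hK : IsOpenBilliard K) {κ : Fin u → ℝ} {γ d Λ β L : ℝ} (hγ : 0 ≤ γ)
    (hκ0 : ∀ i, 0 ≤ κ i)
    (hκ : ∀ i, ∀ x ∈ reflectionPoints K i, ∀ w, IsUnitTangent (K i) x w →
      normalCurvature (K i) x w ≤ κ i)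
    (hκγ : ∀ p, IsOrbit K p → ∀ j i, p j ∈ K i →
      κ i ≤ γ * ⟪outDir p j, outerNormal (K i) (p j)⟫_ℝ)
    (hd0 : 0 ≤ d) (hd : ∀ p, IsOrbit K p → ∀ j, ‖p (j + 1) - p j‖ ≤ d) (hβ : 0 < β)
    (h1 : 2 * γ + β < Λ * β) (h2 : d * (2 * γ + β) < Λ - 1) (hL : 0 ≤ L) :
    ∃ c > 0, ∀ n x y p q τ σ, IsFrontPair K n x y p q τ σ →
      ‖outDir p 0 - outDir q 0‖ ≤ L * ‖x - y‖ → c ≤ Λ ^ n * ‖x - y‖ := by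
  have hΛ : 1 ≤ Λ := by
    have : 0 ≤ d * (2 * γ + β) := by positivity
    linarith
  obtain ⟨c₀, hc₀, hzero⟩ := exists_le_of_zero hK hd0 hd hL
  obtain ⟨c₁, hc₁, hsep⟩ := IsOrbit.exists_separation_lower hK hγ hκ0 hκ hκγ hd0 hd hβ h1 h2
  obtain ⟨c, hc, hang⟩ := hK.exists_le_inner_dir
  choose M hM hlip using fun i => (hK.body i).exists_norm_outerNormal_sub_le_mul
  obtain ⟨B, hB⟩ : ∃ B, ∀ i, M i ≤ B := by
    obtain ⟨B, hB⟩ := (Set.finite_range M).bddAbove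
    exact ⟨B, fun i => hB (mem_range_self i)⟩
  -- the Lipschitz constant of the map from the front to the outgoing phase points
  set Q := (1 + 2 * |B|) * ((1 + 2 / c) * (1 + d * L)) + L with hQ
  have hQ0 : 0 < Q := by positivity
  refine ⟨min c₀ (min (c / (L + 1)) (c₁ / Q)), by positivity, fun n x y p q τ σ h hη => ?_⟩
  rcases n with _ | n
  · rw [pow_zero, one_mul]
    exact (min_le_left _ _).trans (hzero x y p q τ σ h hη)
  refine (min_le_right _ _).trans ?_
  have hpow : ∀ m : ℕ, 1 ≤ Λ ^ m := fun m => one_le_pow₀ hΛ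
  have hxy := norm_nonneg (x - y)
  rcases lt_or_ge c ‖outDir p 0 - outDir q 0‖ with hgt | hle
  · refine (min_le_left _ _).trans ?_
    have h3 : c / (L + 1) ≤ ‖x - y‖ := by
      rw [div_le_iff₀ (by positivity)]; linarith
    exact h3.trans (le_mul_of_one_le_left hxy (hpow _))
  · refine (min_le_right _ _).trans ?_
    obtain ⟨i, hpi, hqi⟩ := h.share 0 (Nat.succ_pos n)
    simp only [Nat.cast_zero, zero_add] at hpi hqi
    have hpair := IsOrbit.isReflectedPair h.left h.right hK hang (j := 0) (by simpa using hpi)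
      (by simpa using hqi)
    simp only [zero_add] at hpair
    have hsp := hsep _ _ (h.left.shift 1) (h.right.shift 1) n (h.shareObstacles n.lt_succ_self)
      (by
        obtain ⟨a, b, ha, hb, hab⟩ := h.separate
        push_cast at ha hb
        exact ⟨a, b, ha, hb, hab⟩)
      (h.divergence_nonneg hK (Nat.succ_pos n))
    have hT : ‖transvIn p q 0‖ ≤ (1 + d * L) * ‖x - y‖ := by
      rw [h.transvIn_eq hK]
      have h3 : (τ + σ) / 2 ≤ d := by
        have a1 := hd p h.left 0
        have a2 := hd q h.right 0
        rw [zero_add] at a1 a2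
        linarith [h.left_mem.2, h.right_mem.2]
      have h4 : 0 ≤ (τ + σ) / 2 := by linarith [h.left_mem.1, h.right_mem.1]
      calc _ ≤ ‖x - y‖ + (τ + σ) / 2 * ‖outDir p 0 - outDir q 0‖ := by
            refine (norm_add_le _ _).trans ?_
            rw [norm_smul, Real.norm_of_nonneg h4]
            gcongr
            exact norm_transv_le _ _
        _ ≤ ‖x - y‖ + d * (L * ‖x - y‖) := by gcongr
        _ = _ := by ring
    have hD1 : ‖p 1 - q 1‖ ≤ (1 + 2 / c) * (1 + d * L) * ‖x - y‖ := by
      have h3 : ‖p 1 - q 1‖ ≤ (1 + 2 / c) * ‖transvIn p q 0‖ := by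
        have := hpair.norm_le_transv_incoming hc hle
        rwa [transvIn, zero_add]
      rw [mul_assoc]
      exact h3.trans (by gcongr)
    have hE1 : ‖outDir p 1 - outDir q 1‖ ≤ L * ‖x - y‖ + 2 * (|B| * ‖p 1 - q 1‖) := by
      have h3 := hpair.norm_sub_le
      have h4 := hlip i _ (h.left.mem_frontier hK hpi) _ (h.right.mem_frontier hK hqi)
      have h5 := mul_le_mul_of_nonneg_right ((hB i).trans (le_abs_self B))
        (norm_nonneg (p 1 - q 1))
      linarith
    have hsum : ‖p 1 - q 1‖ + ‖outDir p 1 - outDir q 1‖ ≤ Q * ‖x - y‖ := by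
      have h3 := mul_le_mul_of_nonneg_left hD1 (by positivity : 0 ≤ 1 + 2 * |B|)
      rw [hQ]
      linarith
    rw [div_le_iff₀ hQ0]
    calc c₁ ≤ Λ ^ n * (‖p 1 - q 1‖ + ‖outDir p 1 - outDir q 1‖) := hsp
      _ ≤ Λ ^ (n + 1) * (Q * ‖x - y‖) := by
          gcongr
          exact n.le_succ
      _ = _ := by ring

end IsFrontPair

end OpenBilliard

namespace OpenBilliard

/-! ### The billiard constants -/

variable {D u : ℕ} {K : Fin u → Set (Space D)}

namespace IsOpenBilliard

/-- Each pair of obstacles carries an orbit of period two. -/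
lemma exists_orbit_two (hK : IsOpenBilliard K) {i j : Fin u} (hij : i ≠ j) :
    ∃ p, IsOrbit K p ∧ p 0 ∈ K i ∧ p 1 ∈ K j ∧ p (-1) = p 1 ∧ p 2 = p 0 := by
  obtain ⟨p, hp, hpα⟩ := hK.exists_periodic_orbit (N := 2)
    (fun k => if k = 0 then i else j) (by
      intro k
      have h1 : (1 : ZMod 2) + 1 = 0 := by decide
      have : k = 0 ∨ k = 1 := by revert k; decide
      rcases this with rfl | rfl
      · simpa using hij
      · simpa [h1] using hij.symm)
  refine ⟨_, hp, by simpa using hpα 0, by simpa using hpα 1, ?_, ?_⟩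
  · have : ((-1 : ℤ) : ZMod 2) = ((1 : ℤ) : ZMod 2) := by decide
    simp only [this]
  · have : ((2 : ℤ) : ZMod 2) = ((0 : ℤ) : ZMod 2) := by decide
    simp only [this]

lemma exists_orbit_three (hK : IsOpenBilliard K) {i j k : Fin u} (hij : i ≠ j) (hjk : j ≠ k)
    (hki : k ≠ i) : ∃ p, IsOrbit K p ∧ p 0 ∈ K i ∧ p 1 ∈ K j ∧ p 2 ∈ K k := by
  obtain ⟨p, hp, hpα⟩ := hK.exists_periodic_orbit (N := 3)
    (fun l => if l = 0 then i else if l = 1 then j else k) (by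
      intro l
      have h1 : (1 : ZMod 3) + 1 = 2 := by decide
      have h2 : (2 : ZMod 3) + 1 = 0 := by decide
      have h3 : (2 : ZMod 3) ≠ 0 := by decide
      have h4 : (2 : ZMod 3) ≠ 1 := by decide
      have h5 : (1 : ZMod 3) ≠ 0 := by decide
      have : l = 0 ∨ l = 1 ∨ l = 2 := by revert l; decide
      rcases this with rfl | rfl | rfl
      · simpa [h5] using hij
      · simpa [h1, h3, h4, h5] using hjk
      · simpa [h2, h3, h4] using hki)
  refine ⟨_, hp, by simpa using hpα 0, by simpa using hpα 1, ?_⟩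
  have h3 : (2 : ZMod 3) ≠ 0 := by decide
  have h4 : (2 : ZMod 3) ≠ 1 := by decide
  simpa [h3, h4] using hpα 2

lemma exists_ne_of_three_le (hu : 3 ≤ u) (i : Fin u) : ∃ j, j ≠ i := by
  have : Nontrivial (Fin u) := Fin.nontrivial_iff_two_le.2 (by omega)
  exact exists_ne i

lemma exists_ne_ne_of_three_le (hu : 3 ≤ u) (i j : Fin u) : ∃ k, k ≠ i ∧ k ≠ j := by
  have h : ({i, j} : Finset (Fin u)).card < Fintype.card (Fin u) := by
    have := Finset.card_le_two (a := i) (b := j)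
    simp only [Fintype.card_fin]; omega
  obtain ⟨k, hk⟩ := Finset.exists_mem_notMem_of_card_lt_card (s := {i, j})
    (t := Finset.univ) (by simpa using h)
  exact ⟨k, by simpa [not_or] using hk.2⟩

lemma reflectionPoints_nonempty (hu : 3 ≤ u) (hK : IsOpenBilliard K) (i : Fin u) :
    (reflectionPoints K i).Nonempty := by
  obtain ⟨j, hj⟩ := exists_ne_of_three_le hu i
  obtain ⟨p, hp, h0, -⟩ := hK.exists_orbit_two hj.symm
  exact ⟨p 0, hp.mem_reflectionPoints hK h0⟩

lemma reflectionPoints_subset_frontier (hK : IsOpenBilliard K) (i : Fin u) :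
    reflectionPoints K i ⊆ frontier (K i) := by
  rintro x ⟨hx, z, ⟨-, k, hk⟩, rfl⟩
  rwa [hK.index_unique hx ((hK.body k).mem_of_mem_frontier hk)]

/-! #### Curvatures -/

lemma exists_unit_orthogonal (hD : 2 ≤ D) (n : Space D) : ∃ w : Space D, ‖w‖ = 1 ∧ ⟪n, w⟫_ℝ = 0 := by
  have h : (ℝ ∙ n)ᗮ ≠ ⊥ := by
    intro hbot
    have h1 := Submodule.finrank_add_finrank_orthogonal (K := ℝ ∙ n)
    have h2 : Module.finrank ℝ (ℝ ∙ n) ≤ 1 := by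
      simpa using finrank_span_le_card (R := ℝ) ({n} : Set (Space D))
    rw [hbot, finrank_bot, finrank_euclideanSpace_fin] at h1
    omega
  obtain ⟨x, hx, hx0⟩ := Submodule.exists_mem_ne_zero_of_ne_bot h
  refine ⟨‖x‖⁻¹ • x, norm_smul_inv_norm hx0, ?_⟩
  rw [real_inner_smul_right, Submodule.mem_orthogonal_singleton_iff_inner_right.1 hx, mul_zero]

lemma curvatures_nonempty (hD : 2 ≤ D) (hu : 3 ≤ u) (hK : IsOpenBilliard K) (i : Fin u) :
    (curvatures K i).Nonempty := by
  obtain ⟨x, hx⟩ := hK.reflectionPoints_nonempty hu i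
  obtain ⟨w, hw, hw0⟩ := exists_unit_orthogonal hD (outerNormal (K i) x)
  exact ⟨_, x, hx, w, ⟨hw, hw0⟩, rfl⟩

lemma nonneg_of_mem_curvatures (hK : IsOpenBilliard K) {i : Fin u} {k : ℝ}
    (hk : k ∈ curvatures K i) : 0 ≤ k := by
  obtain ⟨x, hx, w, hw, rfl⟩ := hk
  exact (hK.body i).normalCurvature_nonneg (hK.reflectionPoints_subset_frontier i hx) hw

lemma kappaMin_le (hK : IsOpenBilliard K) {i : Fin u} {x : Space D} (hx : x ∈ reflectionPoints K i)
    {w : Space D} (hw : IsUnitTangent (K i) x w) : kappaMin K i ≤ normalCurvature (K i) x w :=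
  csInf_le ⟨0, fun _ hk => hK.nonneg_of_mem_curvatures hk⟩ ⟨x, hx, w, hw, rfl⟩

lemma le_kappaMax (hK : IsOpenBilliard K) {i : Fin u} {x : Space D} (hx : x ∈ reflectionPoints K i)
    {w : Space D} (hw : IsUnitTangent (K i) x w) : normalCurvature (K i) x w ≤ kappaMax K i := by
  obtain ⟨M, hM⟩ := (hK.body i).exists_normalCurvature_le
  refine le_csSup ⟨M, ?_⟩ ⟨x, hx, w, hw, rfl⟩
  rintro _ ⟨y, hy, w', hw', rfl⟩
  exact hM y (hK.reflectionPoints_subset_frontier i hy) w' hw'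

lemma kappaMin_nonneg (hK : IsOpenBilliard K) (i : Fin u) : 0 ≤ kappaMin K i :=
  Real.sInf_nonneg fun _ hk => hK.nonneg_of_mem_curvatures hk

lemma kappaMin_le_kappaMax (hD : 2 ≤ D) (hu : 3 ≤ u) (hK : IsOpenBilliard K) (i : Fin u) :
    kappaMin K i ≤ kappaMax K i := by
  obtain ⟨_, x, hx, w, hw, rfl⟩ := hK.curvatures_nonempty hD hu i
  exact (hK.kappaMin_le hx hw).trans (hK.le_kappaMax hx hw)

lemma kappaMax_nonneg (hD : 2 ≤ D) (hu : 3 ≤ u) (hK : IsOpenBilliard K) (i : Fin u) :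
    0 ≤ kappaMax K i :=
  (hK.kappaMin_nonneg i).trans (hK.kappaMin_le_kappaMax hD hu i)

/-! #### Collision angles -/

lemma cos_angle_outDir (hK : IsOpenBilliard K) {p : ℤ → Space D} (hp : IsOrbit K p) {i : Fin u}
    (h0 : p 0 ∈ K i) :
    Real.cos (InnerProductGeometry.angle (unitDir (p 0) (p 1)) (outerNormal (K i) (p 0)))
      = ⟪outDir p 0, outerNormal (K i) (p 0)⟫_ℝ := by
  have h1 : ‖unitDir (p 0) (p 1)‖ = 1 := hp.norm_outDir hK 0
  rw [InnerProductGeometry.cos_angle, h1,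
    (hK.body i).norm_outerNormal (hp.mem_frontier hK h0), mul_one, div_one]
  rfl

lemma cos_angleMax_le (hK : IsOpenBilliard K) {p : ℤ → Space D} (hp : IsOrbit K p) {l : ℤ}
    {i j : Fin u} (h0 : p l ∈ K i) (h1 : p (l + 1) ∈ K j) :
    Real.cos (angleMax K i j) ≤ ⟪outDir p l, outerNormal (K i) (p l)⟫_ℝ := by
  have hp' := hp.shift l
  have h0' : p (0 + l) ∈ K i := by rwa [zero_add]
  have h1' : p (1 + l) ∈ K j := by rwa [add_comm]
  have h2 := hK.cos_angle_outDir hp' h0'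
  have e : outDir (fun k => p (k + l)) 0 = outDir p l := by
    simp only [outDir, zero_add, add_comm (1 : ℤ)]
  rw [e] at h2
  simp only [zero_add] at h2
  rw [← h2]
  have hbdd : BddAbove {φ | ∃ p, IsOrbit K p ∧ p 0 ∈ K i ∧ p 1 ∈ K j ∧
      φ = InnerProductGeometry.angle (unitDir (p 0) (p 1)) (outerNormal (K i) (p 0))} := by
    refine ⟨Real.pi, ?_⟩
    rintro _ ⟨q, -, -, -, rfl⟩
    exact InnerProductGeometry.angle_le_pi _ _
  have hmem : InnerProductGeometry.angle (unitDir (p l) (p (1 + l))) (outerNormal (K i) (p l)) ∈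
      {φ | ∃ p, IsOrbit K p ∧ p 0 ∈ K i ∧ p 1 ∈ K j ∧
      φ = InnerProductGeometry.angle (unitDir (p 0) (p 1)) (outerNormal (K i) (p 0))} :=
    ⟨_, hp', h0', h1', by simp⟩
  refine Real.cos_le_cos_of_nonneg_of_le_pi (InnerProductGeometry.angle_nonneg _ _)
    (csSup_le ⟨_, hmem⟩ ?_) (le_csSup hbdd hmem)
  rintro _ ⟨q, -, -, -, rfl⟩
  exact InnerProductGeometry.angle_le_pi _ _

lemma cos_angleMax_pos (hK : IsOpenBilliard K) {i j : Fin u} (hij : i ≠ j) :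
    0 < Real.cos (angleMax K i j) := by
  obtain ⟨c, hc, hang⟩ := hK.exists_le_inner_dir
  obtain ⟨p, hp, h0, h1, -⟩ := hK.exists_orbit_two hij
  have hle : angleMax K i j ≤ Real.arccos c := by
    refine csSup_le ⟨_, p, hp, h0, h1, rfl⟩ ?_
    rintro _ ⟨q, hq, hq0, hq1, rfl⟩
    have h2 := hang q hq 0 i hq0
    have h3 := hK.cos_angle_outDir hq hq0
    rw [← Real.arccos_cos (InnerProductGeometry.angle_nonneg _ _)
      (InnerProductGeometry.angle_le_pi _ _), h3]
    exact Real.arccos_le_arccos h2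
  have hnonneg : 0 ≤ angleMax K i j := by
    refine Real.sSup_nonneg ?_
    rintro _ ⟨q, -, -, -, rfl⟩
    exact InnerProductGeometry.angle_nonneg _ _
  have := Real.arccos_lt_pi_div_two.2 hc
  exact Real.cos_pos_of_mem_Ioo ⟨by linarith [Real.pi_pos], by linarith⟩

/-! #### Distances -/

lemma exists_mem_distances (hu : 3 ≤ u) (hK : IsOpenBilliard K) (i j : Fin u) :
    (distances K i j).Nonempty := by
  obtain ⟨x, hx⟩ := hK.reflectionPoints_nonempty hu i
  obtain ⟨y, hy⟩ := hK.reflectionPoints_nonempty hu j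
  exact ⟨_, x, hx, y, hy, rfl⟩

lemma distMin_le (K : Fin u → Set (Space D)) {i j : Fin u} {x y : Space D}
    (hx : x ∈ reflectionPoints K i) (hy : y ∈ reflectionPoints K j) : distMin K i j ≤ dist x y := by
  refine csInf_le ⟨0, ?_⟩ ⟨x, hx, y, hy, rfl⟩
  rintro _ ⟨a, -, b, -, rfl⟩
  exact dist_nonneg

lemma le_distMax (hK : IsOpenBilliard K) {i j : Fin u} {x y : Space D}
    (hx : x ∈ reflectionPoints K i) (hy : y ∈ reflectionPoints K j) : dist x y ≤ distMax K i j := by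
  obtain ⟨R, hR, hbd⟩ := hK.exists_norm_le
  refine le_csSup ⟨2 * R, ?_⟩ ⟨x, hx, y, hy, rfl⟩
  rintro _ ⟨a, ha, b, hb, rfl⟩
  rw [dist_eq_norm]
  refine (norm_sub_le _ _).trans ?_
  linarith [hbd i a ha.1, hbd j b hb.1]

lemma finite_pairs (f : Fin u → Fin u → ℝ) : {d | ∃ i j, i ≠ j ∧ d = f i j}.Finite := by
  refine (Set.finite_range fun z : Fin u × Fin u => f z.1 z.2).subset ?_
  rintro _ ⟨i, j, -, rfl⟩
  exact ⟨(i, j), rfl⟩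

lemma dMin_le_distMin (K : Fin u → Set (Space D)) {i j : Fin u} (hij : i ≠ j) :
    dMin K ≤ distMin K i j := csInf_le (finite_pairs _).bddBelow ⟨i, j, hij, rfl⟩

lemma distMax_le_dMax (K : Fin u → Set (Space D)) {i j : Fin u} (hij : i ≠ j) :
    distMax K i j ≤ dMax K := le_csSup (finite_pairs _).bddAbove ⟨i, j, hij, rfl⟩

lemma dMin_pos (hu : 3 ≤ u) (hK : IsOpenBilliard K) : 0 < dMin K := by
  obtain ⟨e, he, hecl⟩ := hK.exists_le_norm_sub
  refine he.trans_le (le_csInf ?_ ?_)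
  · obtain ⟨j, hj⟩ := exists_ne_of_three_le hu (⟨0, by omega⟩ : Fin u)
    exact ⟨_, _, _, hj, rfl⟩
  · rintro _ ⟨i, j, hij, rfl⟩
    refine le_csInf (hK.exists_mem_distances hu i j) ?_
    rintro _ ⟨x, hx, y, hy, rfl⟩
    rw [dist_eq_norm]
    exact hecl i i j hij.symm hij.symm x hx.1 x hx.1 x (left_mem_segment ℝ _ _) y hy.1

lemma dMin_le_norm_sub (hK : IsOpenBilliard K) {p : ℤ → Space D} (hp : IsOrbit K p) (l : ℤ) :
    dMin K ≤ ‖p (l + 1) - p l‖ := by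
  obtain ⟨i, hi⟩ := hp.exists_mem hK l
  obtain ⟨j, hj⟩ := hp.exists_mem hK (l + 1)
  rw [← dist_eq_norm, dist_comm]
  exact (dMin_le_distMin K (hp.index_ne hK hi hj)).trans
    (distMin_le K (hp.mem_reflectionPoints hK hi) (hp.mem_reflectionPoints hK hj))

lemma norm_sub_le_dMax (hK : IsOpenBilliard K) {p : ℤ → Space D} (hp : IsOrbit K p) (l : ℤ) :
    ‖p (l + 1) - p l‖ ≤ dMax K := by
  obtain ⟨i, hi⟩ := hp.exists_mem hK l
  obtain ⟨j, hj⟩ := hp.exists_mem hK (l + 1)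
  rw [← dist_eq_norm, dist_comm]
  exact (hK.le_distMax (hp.mem_reflectionPoints hK hi) (hp.mem_reflectionPoints hK hj)).trans
    (distMax_le_dMax K (hp.index_ne hK hi hj))

/-- If an orbit returns to the previous point, then it hits the boundary perpendicularly. -/
lemma inner_outDir_nonpos_of_return (hK : IsOpenBilliard K) {p : ℤ → Space D} (hp : IsOrbit K p)
    {l : ℤ} {i : Fin u} (hi : p l ∈ K i) (hret : p (l - 1) = p (l + 1)) {y : Space D}
    (hy : y ∈ K i) : ⟪outDir p l, y - p l⟫_ℝ ≤ 0 := by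
  obtain ⟨h1, -⟩ := hp.reflect hK hi
  rw [hret, unitDir_swap (p l) (p (l + 1))] at h1
  change outDir p l = -outDir p l + (2 * ⟪outDir p l, _⟫_ℝ) • _ at h1
  have h2 : outDir p l = ⟪outDir p l, outerNormal (K i) (p l)⟫_ℝ • outerNormal (K i) (p l) := by
    have h3 : (2 : ℝ) • outDir p l
        = (2 : ℝ) • (⟪outDir p l, outerNormal (K i) (p l)⟫_ℝ • outerNormal (K i) (p l)) := by
      rw [smul_smul, two_smul]
      nth_rw 1 [h1]
      abel
    exact smul_right_injective _ two_ne_zero h3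
  have h4 := hp.inner_dir_nonneg hK hi
  have h5 := (hK.body i).inner_outerNormal_nonneg (hp.mem_frontier hK hi) hy
  rw [h2, real_inner_smul_left, ← neg_sub, inner_neg_right]
  have h6 : 0 ≤ ⟪outDir p l, outerNormal (K i) (p l)⟫_ℝ := h4
  have := mul_nonneg h6 h5
  linarith

/-- The distances between reflection points on two obstacles are not all equal: otherwise an
orbit with three different obstacles would have the end points of an orbit of period two among its
reflection points. -/
lemma distMin_lt_distMax (hu : 3 ≤ u) (hK : IsOpenBilliard K) {i j : Fin u} (hij : i ≠ j) :
    distMin K i j < distMax K i j := by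
  by_contra! hle
  have hall : ∀ x ∈ reflectionPoints K i, ∀ y ∈ reflectionPoints K j, ‖x - y‖ = distMin K i j := by
    intro x hx y hy
    rw [← dist_eq_norm]
    exact le_antisymm ((hK.le_distMax hx hy).trans hle) (distMin_le K hx hy)
  obtain ⟨k, hki, hkj⟩ := exists_ne_ne_of_three_le hu i j
  obtain ⟨p, hp, hp0, hp1, hpm, hp2⟩ := hK.exists_orbit_two hij
  obtain ⟨q, hq, hq0, hq1, hq2⟩ := hK.exists_orbit_three hij hkj.symm hki
  -- `p 0` is the only point of its obstacle at this distance from `p 1`, and vice versa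
  have huniq : ∀ a b x : Space D, a ≠ b → ‖x - b‖ = ‖a - b‖ → ⟪unitDir a b, x - a⟫_ℝ ≤ 0 → x = a := by
    intro a b x hab h1 h2
    have e : x - b = (x - a) - ‖b - a‖ • unitDir a b := by rw [norm_smul_unitDir]; abel
    have h3 : ‖x - b‖ ^ 2 = ‖x - a‖ ^ 2 - 2 * (‖b - a‖ * ⟪unitDir a b, x - a⟫_ℝ) + ‖b - a‖ ^ 2 := by
      rw [e, norm_sub_sq_real, real_inner_smul_right, real_inner_comm, norm_smul, norm_norm,
        norm_unitDir hab, mul_one]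
    rw [h1, norm_sub_rev a] at h3
    have h4 := mul_nonneg (norm_nonneg (b - a)) (neg_nonneg.2 h2)
    have h5 : ‖x - a‖ ^ 2 = 0 := le_antisymm (by linarith) (sq_nonneg _)
    exact sub_eq_zero.1 (norm_eq_zero.1 (pow_eq_zero_iff two_ne_zero |>.1 h5))
  have rp0 := hp.mem_reflectionPoints hK hp0
  have rp1 := hp.mem_reflectionPoints hK hp1
  have rq0 := hq.mem_reflectionPoints hK hq0
  have rq1 := hq.mem_reflectionPoints hK hq1
  have hne : p 0 ≠ p 1 := by simpa using hp.ne_succ hK 0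
  have e0 : q 0 = p 0 := by
    refine huniq _ _ _ hne ((hall _ rq0 _ rp1).trans (hall _ rp0 _ rp1).symm) ?_
    exact hK.inner_outDir_nonpos_of_return hp hp0 (by simpa using hpm) hq0
  have e1 : q 1 = p 1 := by
    refine huniq _ _ _ hne.symm ?_ ?_
    · rw [norm_sub_rev, norm_sub_rev (p 1)]
      exact (hall _ rp0 _ rq1).trans (hall _ rp0 _ rp1).symm
    · have := hK.inner_outDir_nonpos_of_return hp (l := 1) hp1 (by simpa using hp2.symm) hq1
      rwa [outDir, one_add_one_eq_two, hp2] at this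
  -- hence `q` returns from `q 1` to `q 0`, and never reaches the third obstacle
  have hdir : outDir q 1 = unitDir (q 1) (q 0) := by
    have h1 := hp.reflect hK hp1
    have h2 := hq.reflection 1 j hq1
    have h3 := hp.reflection 1 j hp1
    simp only [sub_self, one_add_one_eq_two] at h2 h3
    rw [outDir, one_add_one_eq_two, h2, e0, e1, ← h3, hp2]
  have h20 : q 2 ≠ q 0 := fun h => Set.disjoint_left.1 (hK.disjoint k i hki) hq2 (h ▸ hq0)
  have h21 := hq.ne_succ hK 1
  have h10 : q 0 ≠ q 1 := by rw [e0, e1]; exact hne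
  rw [one_add_one_eq_two] at h21
  rw [outDir, one_add_one_eq_two] at hdir
  have hs : 0 < ‖q 2 - q 1‖ := norm_pos_iff.2 (sub_ne_zero.2 h21.symm)
  have ht : 0 < ‖q 0 - q 1‖ := norm_pos_iff.2 (sub_ne_zero.2 h10)
  have hs' : q 2 = q 1 + ‖q 2 - q 1‖ • unitDir (q 1) (q 0) := by
    rw [← hdir, norm_smul_unitDir]; abel
  have ht' : q 0 = q 1 + ‖q 0 - q 1‖ • unitDir (q 1) (q 0) := by
    rw [norm_smul_unitDir]; abel
  have hopen : ∀ s t : ℝ, ∀ w : Space D, 0 < s → s < t →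
      q 1 + s • w ∈ openSegment ℝ (q 1) (q 1 + t • w) := by
    intro s t w h1 h2
    rw [openSegment_eq_image']
    refine ⟨s / t, ⟨div_pos h1 (h1.trans h2), (div_lt_one (h1.trans h2)).2 h2⟩, ?_⟩
    simp only [add_sub_cancel_left, smul_smul, div_mul_cancel₀ _ (h1.trans h2).ne']
  rcases lt_trichotomy ‖q 2 - q 1‖ ‖q 0 - q 1‖ with hlt | heq | hgt
  · have h1 := hopen _ _ (unitDir (q 1) (q 0)) hs hlt
    rw [← hs', ← ht', openSegment_symm] at h1
    exact Set.disjoint_left.1 (hq.free_flight 0) (by simpa using h1) (mem_iUnion.2 ⟨k, hq2⟩)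
  · rw [heq, ← ht'] at hs'
    exact h20 hs'
  · have h1 := hopen _ _ (unitDir (q 1) (q 0)) ht hgt
    rw [← hs', ← ht'] at h1
    exact Set.disjoint_left.1 (hq.free_flight 1) (by simpa using h1) (mem_iUnion.2 ⟨i, hq0⟩)

end IsOpenBilliard

end OpenBilliard

namespace OpenBilliard

/-! #### Rates -/

variable {D u : ℕ} {K : Fin u → Set (Space D)}

lemma gFun_nonneg {γ θ : ℝ} (hγ : 0 ≤ γ) : 0 ≤ gFun γ θ := add_nonneg hγ (Real.sqrt_nonneg _)

lemma mul_sq_le_of_le_gFun {γ θ G : ℝ} (hγ : 0 ≤ γ) (hθ : 0 < θ) (hG : 0 ≤ G)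
    (h : G ≤ gFun γ θ) : θ * G ^ 2 ≤ 2 * γ * (1 + θ * G) := by
  have h0 : 0 ≤ 2 * γ / θ := by positivity
  have h1 : (G - γ) ^ 2 ≤ γ ^ 2 + 2 * γ / θ := by
    rcases le_or_gt γ G with hle | hlt
    · have h2 : G - γ ≤ Real.sqrt (γ ^ 2 + 2 * γ / θ) := by unfold gFun at h; linarith
      exact (Real.le_sqrt (by linarith) (by positivity)).1 h2
    · nlinarith
  have h2 := mul_le_mul_of_nonneg_left h1 hθ.le
  rw [mul_add, mul_div_cancel₀ _ hθ.ne'] at h2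
  linarith

lemma le_mul_sq_of_gFun_le {γ θ G : ℝ} (hθ : 0 < θ)
    (h : gFun γ θ ≤ G) : 2 * γ * (1 + θ * G) ≤ θ * G ^ 2 := by
  have h1 : γ ^ 2 + 2 * γ / θ ≤ (G - γ) ^ 2 := by
    have h2 : Real.sqrt (γ ^ 2 + 2 * γ / θ) ≤ G - γ := by unfold gFun at h; linarith
    exact (Real.sqrt_le_left ((Real.sqrt_nonneg _).trans h2)).1 h2
  have h2 := mul_le_mul_of_nonneg_left h1 hθ.le
  rw [mul_add, mul_div_cancel₀ _ hθ.ne'] at h2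
  linarith

namespace IsOpenBilliard

lemma kappaMax_le_div_cos (hD : 2 ≤ D) (hu : 3 ≤ u) (hK : IsOpenBilliard K) {i j : Fin u}
    (hij : i ≠ j) : kappaMax K i ≤ kappaMax K i / Real.cos (angleMax K i j) := by
  rw [le_div_iff₀ (hK.cos_angleMax_pos hij)]
  exact mul_le_of_le_one_right (hK.kappaMax_nonneg hD hu i) (Real.cos_le_one _)

lemma kappaMin_mul_le (hK : IsOpenBilliard K) {i j : Fin u} (hij : i ≠ j) :
    kappaMin K i * Real.cos (angleMax K i j) ^ iotaExp D ≤ kappaMin K i :=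
  mul_le_of_le_one_right (hK.kappaMin_nonneg i)
    (pow_le_one₀ (hK.cos_angleMax_pos hij).le (Real.cos_le_one _))

lemma kappaMin_mul_nonneg (hK : IsOpenBilliard K) {i j : Fin u} (hij : i ≠ j) :
    0 ≤ kappaMin K i * Real.cos (angleMax K i j) ^ iotaExp D :=
  mul_nonneg (hK.kappaMin_nonneg i) (pow_nonneg (hK.cos_angleMax_pos hij).le _)

lemma distMin_pos (hu : 3 ≤ u) (hK : IsOpenBilliard K) {i j : Fin u} (hij : i ≠ j) :
    0 < distMin K i j := (hK.dMin_pos hu).trans_le (dMin_le_distMin K hij)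

lemma mem_domainD {i j : Fin u} (hij : i ≠ j) {γ θ : ℝ}
    (hγ : γ ∈ Icc (kappaMin K i * Real.cos (angleMax K i j) ^ iotaExp D)
        (kappaMax K i / Real.cos (angleMax K i j)))
    (hθ : θ ∈ Icc (distMin K i j) (distMax K i j)) : (γ, θ) ∈ domainD K := by
  simp only [domainD, mem_iUnion]
  exact ⟨i, j, hij, hγ, hθ⟩

/-- Both corners of the rectangles in `𝔻` that are extremal for `g` belong to `𝔻`. -/
lemma corner_mem_domainD (hD : 2 ≤ D) (hu : 3 ≤ u) (hK : IsOpenBilliard K) {i j : Fin u}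
    (hij : i ≠ j) :
    (kappaMin K i * Real.cos (angleMax K i j) ^ iotaExp D, distMax K i j) ∈ domainD K ∧
      (kappaMax K i / Real.cos (angleMax K i j), distMin K i j) ∈ domainD K := by
  have h1 := (hK.kappaMin_mul_le hij).trans ((hK.kappaMin_le_kappaMax hD hu i).trans
    (hK.kappaMax_le_div_cos hD hu hij))
  have h2 := (hK.distMin_lt_distMax hu hij).le
  exact ⟨mem_domainD hij ⟨le_rfl, h1⟩ ⟨h2, le_rfl⟩, mem_domainD hij ⟨h1, le_rfl⟩ ⟨le_rfl, h2⟩⟩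

lemma nonneg_of_mem_domainD (hK : IsOpenBilliard K) {z : ℝ × ℝ} (hz : z ∈ domainD K) :
    0 ≤ z.1 := by
  simp only [domainD, mem_iUnion] at hz
  obtain ⟨i, j, hij, h1, -⟩ := hz
  exact (hK.kappaMin_mul_nonneg hij).trans h1.1

lemma bddAbove_gFun (hu : 3 ≤ u) (hK : IsOpenBilliard K) :
    BddAbove ((fun z : ℝ × ℝ => gFun z.1 z.2) '' domainD K) := by
  obtain ⟨B, hB⟩ := (finite_pairs fun i j => kappaMax K i / Real.cos (angleMax K i j)).bddAbove
  refine ⟨B + Real.sqrt (B ^ 2 + 2 * B / dMin K), ?_⟩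
  rintro _ ⟨⟨γ, θ⟩, hz, rfl⟩
  have hγ := hK.nonneg_of_mem_domainD hz
  simp only [domainD, mem_iUnion] at hz
  obtain ⟨i, j, hij, h1, h2⟩ := hz
  have h3 : γ ≤ B := h1.2.trans (hB ⟨i, j, hij, rfl⟩)
  have h4 : dMin K ≤ θ := (dMin_le_distMin K hij).trans h2.1
  have h5 := hK.dMin_pos hu
  change γ + Real.sqrt (γ ^ 2 + 2 * γ / θ) ≤ _
  gcongr
  exact mul_nonneg zero_le_two (hγ.trans h3)

lemma gMin_le (hK : IsOpenBilliard K) {z : ℝ × ℝ} (hz : z ∈ domainD K) :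
    gMin K ≤ gFun z.1 z.2 := by
  refine csInf_le ⟨0, ?_⟩ ⟨z, hz, rfl⟩
  rintro _ ⟨y, hy, rfl⟩
  exact gFun_nonneg (hK.nonneg_of_mem_domainD hy)

lemma le_gMax (hu : 3 ≤ u) (hK : IsOpenBilliard K) {z : ℝ × ℝ} (hz : z ∈ domainD K) :
    gFun z.1 z.2 ≤ gMax K := le_csSup (hK.bddAbove_gFun hu) ⟨z, hz, rfl⟩

lemma gMin_le_gMax (hD : 2 ≤ D) (hu : 3 ≤ u) (hK : IsOpenBilliard K) : gMin K ≤ gMax K := by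
  obtain ⟨j, hj⟩ := exists_ne_of_three_le hu (⟨0, by omega⟩ : Fin u)
  have h := (hK.corner_mem_domainD hD hu hj).1
  exact (hK.gMin_le h).trans (hK.le_gMax hu h)

lemma pairs_nonempty (hu : 3 ≤ u) : Nonempty {z : Fin u × Fin u // z.1 ≠ z.2} := by
  obtain ⟨j, hj⟩ := exists_ne_of_three_le hu (⟨0, by omega⟩ : Fin u)
  exact ⟨⟨(j, _), hj⟩⟩

/-- The constants for the lower growth bound with rate `1 + dMin * gMin`. The distance of the
obstacles at which `g` is minimal is greater than `dMin`, which leaves room for the errors of the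
quadratic approximation. -/
lemma exists_rate_lower (hD : 2 ≤ D) (hu : 3 ≤ u) (hK : IsOpenBilliard K) (hG : 0 < gMin K) :
    ∃ γ > 0, ∃ β > 0, (∀ p, IsOrbit K p → ∀ l i, p l ∈ K i →
        γ ≤ kappaMin K i * ⟪outDir p l, outerNormal (K i) (p l)⟫_ℝ ^ iotaExp D) ∧
      (1 + dMin K * gMin K) * β < 2 * γ + β ∧
      1 + dMin K * gMin K - 1 < dMin K * (2 * γ + β) := by
  have := pairs_nonempty hu
  obtain ⟨⟨⟨i, j⟩, hij⟩, hmin⟩ := Finite.exists_min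
    fun z : {z : Fin u × Fin u // z.1 ≠ z.2} =>
      kappaMin K z.1.1 * Real.cos (angleMax K z.1.1 z.1.2) ^ iotaExp D
  change i ≠ j at hij
  set γ := kappaMin K i * Real.cos (angleMax K i j) ^ iotaExp D with hγ
  set G := gMin K
  have hd := hK.dMin_pos hu
  have hγ0 : 0 ≤ γ := hK.kappaMin_mul_nonneg hij
  have hθ := (dMin_le_distMin K hij).trans_lt (hK.distMin_lt_distMax hu hij)
  have h1 := mul_sq_le_of_le_gFun hγ0 (hd.trans hθ) hG.le
    (hK.gMin_le (hK.corner_mem_domainD hD hu hij).1)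
  set θ := distMax K i j
  set d := dMin K
  have hγpos : 0 < γ := by
    rcases hγ0.eq_or_lt with h | h
    · rw [← h] at h1
      have : 0 < θ * G ^ 2 := mul_pos (hd.trans hθ) (by positivity)
      linarith
    · exact h
  have h2 : d * G ^ 2 < 2 * γ * (1 + d * G) := by
    by_contra! hcon
    have h3 := mul_le_mul_of_nonneg_left hcon (hd.trans hθ).le
    have h4 := mul_le_mul_of_nonneg_left h1 hd.le
    have h5 := mul_lt_mul_of_pos_left hθ hγpos
    linarith
  have hdG : 0 < d * G := by positivity
  have h3 : max 0 (G - 2 * γ) < 2 * γ / (d * G) := by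
    refine max_lt (by positivity) ?_
    rw [lt_div_iff₀ hdG]
    linarith
  obtain ⟨β, hβ1, hβ2⟩ := exists_between h3
  have hβ0 : 0 < β := (le_max_left _ _).trans_lt hβ1
  refine ⟨γ, hγpos, β, hβ0, ?_, ?_, ?_⟩
  · intro p hp l a ha
    obtain ⟨b, hb⟩ := hp.exists_mem hK (l + 1)
    have hab := hp.index_ne hK ha hb
    refine (hmin ⟨(a, b), hab⟩).trans ?_
    exact mul_le_mul_of_nonneg_left (pow_le_pow_left₀ (hK.cos_angleMax_pos hab).le
      (hK.cos_angleMax_le hp ha hb) _) (hK.kappaMin_nonneg a)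
  · rw [lt_div_iff₀ hdG] at hβ2
    linarith
  · have h4 := (le_max_right _ _).trans_lt hβ1
    have h5 := mul_lt_mul_of_pos_left (show G < 2 * γ + β by linarith) hd
    linarith

/-- The constants for the upper growth bound with rate `1 + dMax * gMax`. -/
lemma exists_rate_upper (hD : 2 ≤ D) (hu : 3 ≤ u) (hK : IsOpenBilliard K) (hG : 0 < gMax K) :
    ∃ γ, 0 ≤ γ ∧ ∃ β > 0, (∀ p, IsOrbit K p → ∀ l i, p l ∈ K i →
        kappaMax K i ≤ γ * ⟪outDir p l, outerNormal (K i) (p l)⟫_ℝ) ∧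
      2 * γ + β < (1 + dMax K * gMax K) * β ∧
      dMax K * (2 * γ + β) < 1 + dMax K * gMax K - 1 := by
  have := pairs_nonempty hu
  obtain ⟨⟨⟨i, j⟩, hij⟩, hmax⟩ := Finite.exists_max
    fun z : {z : Fin u × Fin u // z.1 ≠ z.2} =>
      kappaMax K z.1.1 / Real.cos (angleMax K z.1.1 z.1.2)
  change i ≠ j at hij
  set γ := kappaMax K i / Real.cos (angleMax K i j) with hγ
  set G := gMax K
  have hγ0 : 0 ≤ γ := div_nonneg (hK.kappaMax_nonneg hD hu i) (hK.cos_angleMax_pos hij).le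
  have hθ0 := hK.distMin_pos hu hij
  have hθ := (hK.distMin_lt_distMax hu hij).trans_le (distMax_le_dMax K hij)
  have h1 := le_mul_sq_of_gFun_le hθ0 (hK.le_gMax hu (hK.corner_mem_domainD hD hu hij).2)
  set θ := distMin K i j
  set d := dMax K
  have hd : 0 < d := hθ0.trans hθ
  have h2 : 2 * γ * (1 + d * G) < d * G ^ 2 := by
    rcases hγ0.eq_or_lt with h | h
    · rw [← h]
      simp only [mul_zero, zero_mul]
      positivity
    · by_contra! hcon
      have h3 := mul_le_mul_of_nonneg_left hcon hθ0.le
      have h4 := mul_le_mul_of_nonneg_left h1 hd.le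
      have h5 := mul_lt_mul_of_pos_left hθ h
      linarith
  have hdG : 0 < d * G := by positivity
  have h3 : 2 * γ / (d * G) < G - 2 * γ := by
    rw [div_lt_iff₀ hdG]
    linarith
  obtain ⟨β, hβ1, hβ2⟩ := exists_between h3
  have hβ0 : 0 < β := (div_nonneg (by positivity) hdG.le).trans_lt hβ1
  refine ⟨γ, hγ0, β, hβ0, ?_, ?_, ?_⟩
  · intro p hp l a ha
    obtain ⟨b, hb⟩ := hp.exists_mem hK (l + 1)
    have hab := hp.index_ne hK ha hb
    have hcos := hK.cos_angleMax_pos hab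
    have h4 := hmax ⟨(a, b), hab⟩
    rw [div_le_iff₀ hcos] at h4
    exact h4.trans (mul_le_mul_of_nonneg_left (hK.cos_angleMax_le hp ha hb) hγ0)
  · rw [div_lt_iff₀ hdG] at hβ1
    linarith
  · have h5 := mul_lt_mul_of_pos_left (show 2 * γ + β < G by linarith) hd
    linarith

end IsOpenBilliard

end OpenBilliard

namespace OpenBilliard

/-! ### Positive curvature on the set of reflection points -/

variable {D u : ℕ} {K : Fin u → Set (Space D)}

/-- Volume bound for the number of separated points in a ball. -/
lemma card_mul_pow_le_of_separated {E : Type*} [NormedAddCommGroup E] [NormedSpace ℝ E]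
    [FiniteDimensional ℝ E] {s : Finset E} {r R : ℝ} (hr : 0 < r) (hR : 0 ≤ R)
    (hs : ∀ x ∈ s, ‖x‖ ≤ R) (hsep : ∀ x ∈ s, ∀ y ∈ s, x ≠ y → 2 * r ≤ ‖x - y‖) :
    s.card * r ^ Module.finrank ℝ E ≤ (R + r) ^ Module.finrank ℝ E := by
  borelize E
  let μ : MeasureTheory.Measure E := MeasureTheory.Measure.addHaar
  have hdisj : Set.Pairwise (s : Set E) (Function.onFun Disjoint fun c => Metric.ball c r) := by
    rintro x hx y hy hxy
    refine Metric.ball_disjoint_ball ?_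
    rw [dist_eq_norm]
    linarith [hsep x hx y hy hxy]
  have hsub : (⋃ x ∈ s, Metric.ball x r) ⊆ Metric.ball (0 : E) (R + r) := by
    refine iUnion₂_subset fun x hx => Metric.ball_subset_ball' ?_
    rw [dist_zero_right]
    linarith [hs x hx]
  have h1 : (s.card : ENNReal) * ENNReal.ofReal (r ^ Module.finrank ℝ E) * μ (Metric.ball 0 1)
      ≤ ENNReal.ofReal ((R + r) ^ Module.finrank ℝ E) * μ (Metric.ball 0 1) :=
    calc _ = μ (⋃ x ∈ s, Metric.ball x r) := by
          rw [MeasureTheory.measure_biUnion_finset hdisj fun c _ => measurableSet_ball]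
          simp only [μ.addHaar_ball_of_pos _ hr]
          simp only [Finset.sum_const, nsmul_eq_mul, mul_assoc]
      _ ≤ μ (Metric.ball (0 : E) (R + r)) := MeasureTheory.measure_mono hsub
      _ = _ := by simp only [μ.addHaar_ball_of_pos _ (show 0 < R + r by positivity)]
  have h2 := (ENNReal.mul_le_mul_iff_left (Metric.measure_ball_pos _ _ zero_lt_one).ne'
    MeasureTheory.measure_ball_lt_top.ne).1 h1
  have h3 := ENNReal.toReal_le_of_le_ofReal (by positivity) h2
  rwa [ENNReal.toReal_mul, ENNReal.toReal_natCast, ENNReal.toReal_ofReal (by positivity)] at h3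

/-- Orbits with a code that is symmetric under time reversal: the obstacle of the reflection with
number `k` depends only on `|k|`. -/
lemma IsOpenBilliard.exists_palindromic_orbit (hK : IsOpenBilliard K) {f : ℕ → Fin u}
    (hf : ∀ k, f k ≠ f (k + 1)) {M : ℕ} (hM : 0 < M) :
    ∃ p, IsOrbit K p ∧ ∀ k : ℕ, k ≤ M → p k ∈ K (f k) ∧ p (-k) ∈ K (f k) := by
  have : NeZero (2 * M) := ⟨by omega⟩
  have hone : (1 : ZMod (2 * M)).val = 1 := by
    rw [ZMod.val_one_eq_one_mod, Nat.mod_eq_of_lt (by omega)]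
  obtain ⟨p, hp, hpf⟩ := hK.exists_periodic_orbit
    (fun j : ZMod (2 * M) => f (min j.val (2 * M - j.val))) (by
      intro j
      have hj := ZMod.val_lt j
      have h1 : min (j + 1).val (2 * M - (j + 1).val) = min j.val (2 * M - j.val) + 1 ∨
          min j.val (2 * M - j.val) = min (j + 1).val (2 * M - (j + 1).val) + 1 := by
        rw [ZMod.val_add, hone]
        rcases lt_or_ge (j.val + 1) (2 * M) with h | h
        · rw [Nat.mod_eq_of_lt h]; omega
        · have : j.val + 1 = 2 * M := by omega
          rw [this, Nat.mod_self]; omega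
      rcases h1 with h | h
      · rw [h]; exact hf _
      · rw [h]; exact (hf _).symm)
  refine ⟨_, hp, fun k hk => ?_⟩
  have hk' : ((k : ℕ) : ZMod (2 * M)).val = k := by
    rw [ZMod.val_natCast, Nat.mod_eq_of_lt (by omega)]
  have h1 := hpf (k : ZMod (2 * M))
  have h2 := hpf (-(k : ZMod (2 * M)))
  have e1 : min k (2 * M - k) = k := by omega
  rw [hk', e1] at h1
  have e2 : min (-(k : ZMod (2 * M))).val (2 * M - (-(k : ZMod (2 * M))).val) = k := by
    rw [ZMod.neg_val]
    split_ifs with h0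
    · rw [← hk', h0, ZMod.val_zero]; simp
    · rw [hk']; omega
  rw [e2] at h2
  exact ⟨by simpa using h1, by simpa using h2⟩

/-- For orbits on a common obstacle, either they do not converge, or the time reversed orbits do
not converge. -/
lemma IsOrbit.divergence_nonneg_or_reverse {p q : ℤ → Space D} (hp : IsOrbit K p)
    (hq : IsOrbit K q) (hK : IsOpenBilliard K) {i : Fin u} (hpi : p 0 ∈ K i) (hqi : q 0 ∈ K i) :
    0 ≤ divergence p q 0 ∨ 0 ≤ divergence (fun j => p (-j)) (fun j => q (-j)) 0 := by
  obtain ⟨c, hc, hang⟩ := hK.exists_le_inner_dir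
  have hpair := isReflectedPair hp hq hK hang (j := -1) (by simpa using hpi) (by simpa using hqi)
  simp only [neg_add_cancel] at hpair
  have h1 := hpair.inner_eq
  have h2 := mul_nonneg (hc.le.trans hpair.le_v) hpair.inner_n
  have h3 := mul_nonneg (hc.le.trans hpair.le_w) (neg_nonneg.2 hpair.inner_m)
  have e : ∀ r : ℤ → Space D, outDir (fun j => r (-j)) 0 = -outDir r (-1) := fun r => by
    rw [outDir, outDir, ← unitDir_swap]; rfl
  rw [divergence, divergence, e, e, neg_zero, neg_sub_neg, ← neg_sub (outDir p (-1)),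
    inner_neg_right, h1]
  rcases le_or_gt ⟪p 0 - q 0, outDir p (-1) - outDir q (-1)⟫_ℝ 0 with h | h
  · right; linarith
  · left; linarith

/-- The codes in the counting argument: they alternate between the obstacle `i` and one of the
obstacles `j`, `k`, chosen according to the membership in `s`. -/
noncomputable def binaryCode (i j k : Fin u) (s : Finset ℕ) (l : ℕ) : Fin u :=
  if l % 2 = 0 then i else if l / 2 ∈ s then j else k

lemma binaryCode_ne_succ {i j k : Fin u} (hij : i ≠ j) (hik : i ≠ k) (s : Finset ℕ) (l : ℕ) :
    binaryCode i j k s l ≠ binaryCode i j k s (l + 1) := by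
  unfold binaryCode
  rcases Nat.mod_two_eq_zero_or_one l with h | h
  · rw [if_pos h, if_neg (by omega)]
    split_ifs
    · exact hij
    · exact hik
  · rw [if_neg (by omega), if_pos (show (l + 1) % 2 = 0 by omega)]
    split_ifs
    · exact hij.symm
    · exact hik.symm

lemma exists_binaryCode_ne {i j k : Fin u} (hjk : j ≠ k) {s t : Finset ℕ} {T : ℕ}
    (hs : s ⊆ Finset.range T) (ht : t ⊆ Finset.range T) (hst : s ≠ t) :
    ∃ m, m + 1 ≤ 2 * T ∧ (∀ l ≤ m, binaryCode i j k s l = binaryCode i j k t l) ∧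
      binaryCode i j k s (m + 1) ≠ binaryCode i j k t (m + 1) := by
  have hex : ∃ l, binaryCode i j k s l ≠ binaryCode i j k t l := by
    by_contra! hall
    refine hst (Finset.ext fun a => ?_)
    have h1 := hall (2 * a + 1)
    have e1 : (2 * a + 1) % 2 = 1 := by omega
    have e2 : (2 * a + 1) / 2 = a := by omega
    simp only [binaryCode, e1, e2, one_ne_zero, if_false] at h1
    by_cases ha : a ∈ s <;> by_cases hb : a ∈ t <;> simp_all
  classical
  have h1 := Nat.find_spec hex
  have h2 := fun l => Nat.find_min hex (m := l)
  generalize Nat.find hex = n at h1 h2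
  rcases n with _ | m
  · simp [binaryCode] at h1
  refine ⟨m, ?_, fun l hl => not_not.1 (h2 l (by omega)), h1⟩
  by_contra! hgt
  refine h1 ?_
  have e : ∀ r ⊆ Finset.range T, (m + 1) / 2 ∉ r := fun r hr hmem => by
    have := Finset.mem_range.1 (hr hmem)
    omega
  simp only [binaryCode, e s hs, e t ht, if_false]

/-- If the curvature vanished at all reflection points, then orbits would separate
subexponentially. This contradicts the fact that there are exponentially many binary codes. -/
lemma IsOpenBilliard.exists_kappaMax_pos (hu : 3 ≤ u) (hK : IsOpenBilliard K) :
    ∃ i, 0 < kappaMax K i := by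
  by_contra! hflat
  let E := Space D × Space D × Space D
  set d := Module.finrank ℝ E with hd
  -- a growth rate that is too small for the number of codes
  obtain ⟨ε, hε, -, hε2, -⟩ := exists_pos_le_of_continuous
    (f := fun ε : ℝ => (1 + ε) ^ (2 * d)) (a := 3 / 2) (g := fun _ => 0) (b := 1)
    (by fun_prop) (by fun_prop) (by norm_num) (by norm_num)
  set Λ := 1 + ε with hΛ
  have hdm : 0 < dMax K := (hK.dMin_pos hu).trans_le (by
    obtain ⟨j, hj⟩ := exists_ne_of_three_le hu (⟨0, by omega⟩ : Fin u)
    exact (dMin_le_distMin K hj).trans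
      ((hK.distMin_lt_distMax hu hj).le.trans (distMax_le_dMax K hj)))
  obtain ⟨c, hc, hsep⟩ := IsOrbit.exists_separation_lower hK (κ := fun _ => 0) (γ := 0)
    (d := dMax K) (Λ := Λ) (β := ε / (2 * dMax K)) le_rfl (fun _ => le_rfl)
    (fun i x hx w hw => (hK.le_kappaMax hx hw).trans (hflat i)) (by simp) hdm.le
    (fun p hp j => hK.norm_sub_le_dMax hp j) (by positivity)
    (by
      have : 0 < ε * (ε / (2 * dMax K)) := by positivity
      rw [hΛ]; linarith)
    (by
      have : dMax K * (2 * 0 + ε / (2 * dMax K)) = ε / 2 := by field_simp; ring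
      rw [this, hΛ]; linarith)
  obtain ⟨R, hR, hbd⟩ := hK.exists_norm_le
  have hΛ1 : 1 ≤ Λ := by linarith
  let i₀ : Fin u := ⟨0, by omega⟩
  obtain ⟨i₁, h10⟩ := exists_ne_of_three_le hu i₀
  obtain ⟨i₂, h20, h21⟩ := exists_ne_ne_of_three_le hu i₀ i₁
  have hcount : ∀ T : ℕ, 0 < T →
      (2 : ℝ) ^ T * (c / 4) ^ d ≤ (R + 1 + c / 4) ^ d * (3 / 2) ^ T := by
    intro T hT
    choose p hp hpc using fun s : Finset ℕ =>
      hK.exists_palindromic_orbit (binaryCode_ne_succ h10.symm h20.symm s)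
        (show 0 < 2 * T by omega)
    let Φ : Finset ℕ → E := fun s => (p s 0, outDir (p s) 0, outDir (p s) (-1))
    set r := c / 4 / Λ ^ (2 * T) with hr
    have hr0 : 0 < r := by positivity
    have hrc : r ≤ c / 4 := div_le_self (by positivity) (one_le_pow₀ hΛ1)
    have hPhi : ∀ s ⊆ Finset.range T, ∀ t ⊆ Finset.range T, s ≠ t → 2 * r ≤ ‖Φ s - Φ t‖ := by
      intro s hs t ht hst
      obtain ⟨m, hmT, hm, hm1⟩ := exists_binaryCode_ne (i := i₀) h21.symm hs ht hst
      have n1 : ‖p s 0 - p t 0‖ ≤ ‖Φ s - Φ t‖ := norm_fst_le (Φ s - Φ t)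
      have n2 : ‖outDir (p s) 0 - outDir (p t) 0‖ ≤ ‖Φ s - Φ t‖ :=
        (norm_fst_le (Φ s - Φ t).2).trans (norm_snd_le (Φ s - Φ t))
      have n3 : ‖outDir (p s) (-1) - outDir (p t) (-1)‖ ≤ ‖Φ s - Φ t‖ :=
        (norm_snd_le (Φ s - Φ t).2).trans (norm_snd_le (Φ s - Φ t))
      have hfin : ∀ x, x ≤ ‖Φ s - Φ t‖ → c ≤ Λ ^ m * (‖p s 0 - p t 0‖ + x) →
          2 * r ≤ ‖Φ s - Φ t‖ := by
        intro x hx hcx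
        have h1 : Λ ^ m ≤ Λ ^ (2 * T) := pow_le_pow_right₀ hΛ1 (by omega)
        have h2 : c ≤ Λ ^ (2 * T) * (2 * ‖Φ s - Φ t‖) := by
          refine hcx.trans ?_
          have : ‖p s 0 - p t 0‖ + x ≤ 2 * ‖Φ s - Φ t‖ := by linarith
          calc _ ≤ Λ ^ m * (2 * ‖Φ s - Φ t‖) := by gcongr
            _ ≤ _ := by gcongr
        have h3 : r * Λ ^ (2 * T) = c / 4 := div_mul_cancel₀ _ (by positivity)
        have hP : 0 < Λ ^ (2 * T) := by positivity
        refine le_of_mul_le_mul_left ?_ hP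
        linarith
      have h0s := (hpc s 0 (by omega)).1
      have h0t := (hpc t 0 (by omega)).1
      rw [← hm 0 (Nat.zero_le _)] at h0t
      rw [Nat.cast_zero] at h0s h0t
      rcases (hp s).divergence_nonneg_or_reverse (hp t) hK h0s h0t with hA | hA
      · refine hfin _ n2 (hsep _ _ (hp s) (hp t) m ?_ ?_ hA)
        · intro l hl
          refine ⟨_, (hpc s l (by omega)).1, ?_⟩
          rw [hm l hl]; exact (hpc t l (by omega)).1
        · refine ⟨_, _, ?_, ?_, hm1⟩
          · simpa using (hpc s (m + 1) hmT).1
          · simpa using (hpc t (m + 1) hmT).1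
      · have h1 := hsep _ _ ((hp s).reverse hK) ((hp t).reverse hK) m (by
          intro l hl
          refine ⟨_, (hpc s l (by omega)).2, ?_⟩
          rw [hm l hl]; exact (hpc t l (by omega)).2) (by
          refine ⟨_, _, ?_, ?_, hm1⟩
          · simpa using (hpc s (m + 1) hmT).2
          · simpa using (hpc t (m + 1) hmT).2) hA
        have e : ∀ r : ℤ → Space D, outDir (fun j => r (-j)) 0 = -outDir r (-1) := fun r => by
          rw [outDir, outDir, ← unitDir_swap]; rfl
        rw [e, e, neg_sub_neg, norm_sub_rev (outDir (p t) _), neg_zero] at h1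
        exact hfin _ n3 h1
    classical
    have hinj : Set.InjOn Φ ((Finset.range T).powerset : Set (Finset ℕ)) := by
      intro s hs t ht hst
      by_contra hne
      have h1 := hPhi s (Finset.mem_powerset.1 hs) t (Finset.mem_powerset.1 ht) hne
      rw [hst, sub_self, norm_zero] at h1
      linarith
    have hvol := card_mul_pow_le_of_separated (E := E)
      (s := (Finset.range T).powerset.image Φ) (R := R + 1) hr0 (by positivity)
      (by
        intro x hx
        obtain ⟨s, -, rfl⟩ := Finset.mem_image.1 hx
        have h1 := hbd _ _ (hpc s 0 (by omega)).1
        rw [Nat.cast_zero] at h1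
        refine norm_prod_le_iff.2 ⟨h1.trans (by linarith), norm_prod_le_iff.2 ⟨?_, ?_⟩⟩
        · exact ((hp s).norm_outDir hK 0).le.trans (by linarith)
        · exact ((hp s).norm_outDir hK (-1)).le.trans (by linarith))
      (by
        intro x hx y hy hxy
        obtain ⟨s, hs, rfl⟩ := Finset.mem_image.1 hx
        obtain ⟨t, ht, rfl⟩ := Finset.mem_image.1 hy
        exact hPhi s (Finset.mem_powerset.1 hs) t (Finset.mem_powerset.1 ht)
          (fun h => hxy (by rw [h])))
    rw [Finset.card_image_of_injOn hinj, Finset.card_powerset, Finset.card_range, ← hd] at hvol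
    push_cast at hvol
    have h1 : (c / 4) ^ d = r ^ d * (Λ ^ (2 * d)) ^ T := by
      have h3 : c / 4 = r * Λ ^ (2 * T) := (div_mul_cancel₀ _ (by positivity)).symm
      rw [h3, mul_pow, ← pow_mul, ← pow_mul]
      congr 2
      ring
    have h2 : (Λ ^ (2 * d)) ^ T ≤ (3 / 2) ^ T := by gcongr
    calc (2 : ℝ) ^ T * (c / 4) ^ d = (2 ^ T * r ^ d) * (Λ ^ (2 * d)) ^ T := by rw [h1]; ring
      _ ≤ (R + 1 + c / 4) ^ d * (3 / 2) ^ T := by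
          refine mul_le_mul (hvol.trans ?_) h2 (by positivity) (by positivity)
          gcongr
  have hlim := tendsto_pow_atTop_atTop_of_one_lt (show (1 : ℝ) < 4 / 3 by norm_num)
  have hc4 : 0 < (c / 4) ^ d := by positivity
  obtain ⟨T, hT, hT0⟩ := ((hlim.eventually_gt_atTop
    ((R + 1 + c / 4) ^ d / (c / 4) ^ d)).and (eventually_gt_atTop 0)).exists
  have h1 := hcount T hT0
  rw [div_lt_iff₀ hc4] at hT
  have h2 : (2 : ℝ) ^ T = (4 / 3) ^ T * (3 / 2) ^ T := by rw [← mul_pow]; norm_num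
  have h3 : (0 : ℝ) < (3 / 2) ^ T := by positivity
  have h4 := mul_lt_mul_of_pos_right hT h3
  rw [h2] at h1
  linarith

lemma IsOpenBilliard.gMax_pos (hD : 2 ≤ D) (hu : 3 ≤ u) (hK : IsOpenBilliard K) : 0 < gMax K := by
  obtain ⟨i, hi⟩ := hK.exists_kappaMax_pos hu
  obtain ⟨j, hj⟩ := exists_ne_of_three_le hu i
  have h1 := hK.le_gMax hu (hK.corner_mem_domainD hD hu hj.symm).2
  have h2 : 0 < kappaMax K i / Real.cos (angleMax K i j) :=
    div_pos hi (hK.cos_angleMax_pos hj.symm)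
  have h3 : kappaMax K i / Real.cos (angleMax K i j)
      ≤ gFun (kappaMax K i / Real.cos (angleMax K i j)) (distMin K i j) :=
    le_add_of_nonneg_right (Real.sqrt_nonneg _)
  exact h2.trans_le (h3.trans h1)

end OpenBilliard

namespace OpenBilliard

/-! ### Separation of points on a front -/

variable {D u : ℕ} {K : Fin u → Set (Space D)}

/-- The upper bound, with the rate of any `a ≤ gMin`. If `gMin = 0`, then `a = 0` and `mu K a = 1`, so
that boundedness suffices. -/
lemma IsOpenBilliard.exists_front_upper (hD : 2 ≤ D) (hu : 3 ≤ u) (hK : IsOpenBilliard K) :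
    ∃ C > 0, ∀ a, 0 ≤ a → a ≤ gMin K → ∀ n₀ n x y p q τ σ, n₀ ≤ n →
      IsFrontPair K n x y p q τ σ → ‖x - y‖ ≤ C * mu K a ^ (n - n₀) := by
  have hd := hK.dMin_pos hu
  rcases le_or_gt (gMin K) 0 with hG | hG
  · obtain ⟨R, hR, hbd⟩ := IsFrontPair.exists_norm_sub_le hK
    refine ⟨R, hR, fun a ha haG n₀ n x y p q τ σ _ h => ?_⟩
    obtain rfl : a = 0 := by linarith
    simpa [mu] using hbd _ _ _ _ _ _ _ h
  · obtain ⟨γ, hγ, β, hβ, h1, h2, h3⟩ := hK.exists_rate_lower hD hu hG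
    have hΛ : 1 ≤ 1 + dMin K * gMin K := by
      have : 0 < dMin K * gMin K := by positivity
      linarith
    obtain ⟨C, hC, hup⟩ := IsFrontPair.exists_upper hD hK hγ
      (fun i x hx w hw => hK.kappaMin_le hx hw) h1 (fun p hp j => hK.dMin_le_norm_sub hp j) hβ hΛ
      h2 h3
    refine ⟨C, hC, fun a ha haG n₀ n x y p q τ σ hn h => ?_⟩
    have h4 := hup n x y p q τ σ h
    have hpos : 0 < 1 + dMin K * a := by positivity
    rw [mu, one_div, inv_pow, ← div_eq_mul_inv, le_div_iff₀ (by positivity), mul_comm]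
    refine le_trans ?_ h4
    gcongr
    calc (1 + dMin K * a) ^ (n - n₀) ≤ (1 + dMin K * gMin K) ^ (n - n₀) := by gcongr
      _ ≤ (1 + dMin K * gMin K) ^ n := pow_le_pow_right₀ hΛ (Nat.sub_le _ _)

/-- The lower bound, with the rate of any `b ≥ gMax`. The constant absorbs `n₀` reflections at the
rate of `gMax`. -/
lemma IsOpenBilliard.exists_front_lower (hD : 2 ≤ D) (hu : 3 ≤ u) (hK : IsOpenBilliard K) {L : ℝ}
    (hL : 0 ≤ L) (n₀ : ℕ) :
    ∃ c > 0, ∀ b, gMax K ≤ b → ∀ n x y p q τ σ, n₀ ≤ n → IsFrontPair K n x y p q τ σ →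
      ‖outDir p 0 - outDir q 0‖ ≤ L * ‖x - y‖ → c * lam K b ^ (n - n₀) ≤ ‖x - y‖ := by
  have hG := hK.gMax_pos hD hu
  obtain ⟨γ, hγ, β, hβ, h1, h2, h3⟩ := hK.exists_rate_upper hD hu hG
  have hd : 0 ≤ dMax K := by
    obtain ⟨p, hp, -⟩ := hK.exists_orbit_two (show (⟨0, by omega⟩ : Fin u) ≠ ⟨1, by omega⟩ by simp)
    exact (norm_nonneg _).trans (hK.norm_sub_le_dMax hp 0)
  obtain ⟨c, hc, hlow⟩ := IsFrontPair.exists_lower hK hγ (fun i => hK.kappaMax_nonneg hD hu i)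
    (fun i x hx w hw => hK.le_kappaMax hx hw) h1 hd (fun p hp j => hK.norm_sub_le_dMax hp j) hβ
    h2 h3 hL
  have hΛ : 0 < 1 + dMax K * gMax K := by positivity
  refine ⟨c / (1 + dMax K * gMax K) ^ n₀, by positivity, fun b hb n x y p q τ σ hn h hη => ?_⟩
  have h4 := hlow n x y p q τ σ h hη
  have hle : 1 + dMax K * gMax K ≤ 1 + dMax K * b := by gcongr
  have hpow : (1 + dMax K * gMax K) ^ (n - n₀) ≤ (1 + dMax K * b) ^ (n - n₀) := by gcongr
  have hpos : 0 < (1 + dMax K * gMax K) ^ (n - n₀) := by positivity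
  rw [lam, one_div, inv_pow, ← div_eq_mul_inv, div_div,
    div_le_iff₀ (mul_pos (by positivity) (hpos.trans_le hpow))]
  calc c ≤ (1 + dMax K * gMax K) ^ n * ‖x - y‖ := h4
    _ = ‖x - y‖ * ((1 + dMax K * gMax K) ^ n₀ * (1 + dMax K * gMax K) ^ (n - n₀)) := by
        rw [← pow_add, Nat.add_sub_cancel' hn, mul_comm]
    _ ≤ _ := by gcongr

end OpenBilliard

/-- The constant `C` depends only on the billiard `K`. The constant `c` depends only on the
billiard, on a bound `L` for the curvature (the Lipschitz constant of the normal field) of the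
front, and on `n₀`. The number `n₀` is arbitrary. -/
theorem mainTheorem5 {D u : ℕ} (hD : 2 ≤ D) (hu : 3 ≤ u)
    (K : Fin u → Set (OpenBilliard.Space D)) (hK : OpenBilliard.IsOpenBilliard K) :
    ∃ C : ℝ, 0 < C ∧ ∀ (L : ℝ≥0) (n₀ : ℕ), ∃ c : ℝ, 0 < c ∧
      ∀ a b : ℝ, 0 ≤ a →
        Icc (OpenBilliard.gMin K) (OpenBilliard.gMax K) ⊆ Icc a b →
        ∀ (X : Set (OpenBilliard.Space D)) (ν : OpenBilliard.Space D → OpenBilliard.Space D),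
          OpenBilliard.IsConvexFront K X ν → LipschitzOnWith L ν X →
          ∀ n : ℕ, n₀ ≤ n →
            ∀ x₁ ∈ OpenBilliard.trappedFront K X ν, ∀ x₂ ∈ OpenBilliard.trappedFront K X ν,
              OpenBilliard.SeparateAfter K n x₁ x₂ →
                c * OpenBilliard.lam K b ^ (n - n₀) ≤ ‖x₁.1 - x₂.1‖ ∧
                  ‖x₁.1 - x₂.1‖ ≤ C * OpenBilliard.mu K a ^ (n - n₀) := by
  obtain ⟨C, hC, hupper⟩ := hK.exists_front_upper hD hu
  refine ⟨C, hC, fun L n₀ => ?_⟩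
  obtain ⟨c, hc, hlower⟩ := hK.exists_front_lower hD hu L.coe_nonneg n₀
  refine ⟨c, hc, fun a b ha hab X ν hX hL n hn x₁ hx₁ x₂ hx₂ hsep => ?_⟩
  have hle := hK.gMin_le_gMax hD hu
  obtain ⟨p, q, τ, σ, hpq, hp, hq⟩ := hsep.exists_isFrontPair hX hx₁ hx₂
  refine ⟨hlower b (hab ⟨hle, le_rfl⟩).2 n _ _ p q τ σ hn hpq ?_,
    hupper a ha (hab ⟨le_rfl, hle⟩).1 n₀ n _ _ p q τ σ hn hpq⟩
  rw [hp, hq]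
  exact hL.norm_sub_le hx₁.1.1 hx₂.1.1
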